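/- **Definitions.** Let $S$ be a finite monoid, with Green's relations $\mathscr R,\mathscr L,\mathscr J$ and $\mathscr H=\mathscr R\cap\mathscr L$, and with minimal ideal $M$. Put $\Delta=\{(x,x):x\in S\}$. Ideals are non-empty and two-sided; the Rees congruence of an ideal $I$ is $R_I=\Delta\cup(I\times I)$. An ideal $I$ is *retractable* if there is a homomorphism $f:I\to M$ fixing every element of $M$ (such an $f$ is unique). An *IN-pair* is a pair $(I,N)$, where $I$ is an ideal and $N$ is a normal subgroup of a maximal subgroup of $S$ contained in a stable regular $\mathscr J$-class $J$ that is minimal among the $\mathscr J$-classes contained in $S\setminus I$; here $J$ is stable if for all $x\in J$, $a\in S$, $xa\mathrel{\mathscr J}x$ implies $xa\mathrel{\mathscr R}x$ and $ax\mathrel{\mathscr J}x$ implies $ax\mathrel{\mathscr L}x$. The IN-pair is *proper* if $|N|\ge2$, and *retractable* if $I$ is retractable and $|xN|=|Nx|=1$ for all $x\in M$. Let $\nu_N=\{(sxt,syt)\in J\times J: x,y\in N,\ s,t\in S\}$, $R_{I,N}=\Delta\cup\nu_N\cup(I\times I)$ and, for a retractable IN-pair $\mathcal C=(I,N)$ with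 retraction $f$ of $I$, let $$\lambda_{\mathcal C},\ \rho_{\mathcal C},\ \mu_{\mathcal C}=\Delta\cup\nu_N\cup\{(x,y)\in I\times I: xf\mathrel{\mathscr K}yf\}\quad\text{with }\mathscr K=\mathscr L,\ \mathscr R,\ \mathscr H\text{ respectively.}$$ The partition monoid $\mathcal P_n$ consists of all set partitions of $\{1,\dots,n\}\cup\{1',\dots,n'\}$. To form $\alpha\beta$, identify the lower row of $\alpha$ with the upper row of $\beta$; two vertices of the two outer rows are in the same block of $\alpha\beta$ if and only if they are connected in the resulting graph. The partial Brauer monoid $\mathcal{PB}_n$ is the submonoid of partitions all of whose blocks have size at most $2$. The rank of a partition is the number of its blocks that meet both rows, $\alpha^*$ is obtained from $\alpha$ by interchanging the rows, and a *$*$-congruence* is a congruence $\xi$ such that $(\alpha,\beta)\in\xi$ implies $(\alpha^*,\beta^*)\in\xi$. Write $I_q=\{\alpha\in\mathcal{PB}_n:\operatorname{rank}\alpha\le q\}$. For $\sigma$ in the symmetric group $\mathcal S_q$ ($q\le n$), let $\overline\sigma$ be the partition whose non-singleton blocks are $\{i,(i\sigma)'\}$, $1\le i\le q$, and let $\overline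 N=\{\overline\sigma:\sigma\in N\}$ for $N\subseteq\mathcal S_q$. Let $\mathcal A_q$ be the alternating group and $K\le\mathcal S_4$ the Klein four-group consisting of the identity and the double transpositions. **Theorem.** Let $n\ge2$. 1. The ideals of $\mathcal{PB}_n$ are exactly the sets $I_q$, $q=0,\dots,n$. They yield the Rees congruences $R_q=R_{I_q}$. 2. The proper IN-pairs of $\mathcal{PB}_n$ are exactly the pairs $(I_{q-1},\overline N)$, where $2\le q\le n$ and $N$ is a non-trivial normal subgroup of $\mathcal S_q$. They yield the congruences $R_N=R_{I_{q-1},\overline N}$. 3. The retractable IN-pairs of $\mathcal{PB}_n$ are exactly $\mathcal C_0=(I_0,\{\overline{\mathrm{id}}_1\})$, $\mathcal C_1=(I_1,\{\overline{\mathrm{id}}_2\})$ and $\mathcal C_{\mathcal S_2}=(I_1,\overline{\mathcal S}_2)$. They yield the congruences $\lambda_c,\rho_c,\mu_c$ for $c\in\{0,1,\mathcal S_2\}$. 4. The congruences $R_q$ ($0\le q\le n$), $R_N$ ($N$ as in 2) and $\lambda_c,\rho_c,\mu_c$ ($c\in\{0,1,\mathcal S_2\}$) are pairwise distinct, and they are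 all the congruences of $\mathcal{PB}_n$. 5. The $*$-congruences of $\mathcal{PB}_n$ are those congruences other than $\lambda_0,\lambda_1,\lambda_{\mathcal S_2},\rho_0,\rho_1,\rho_{\mathcal S_2}$. 6. Let $T_0=R_0$, $T_1=R_1$ and $T_{\mathcal S_2}=R_{\mathcal S_2}$. The covering pairs of the lattice of congruences are exactly the following: $\mu_c\prec\lambda_c$, $\mu_c\prec\rho_c$, $\lambda_c\prec T_c$, $\rho_c\prec T_c$ for $c\in\{0,1,\mathcal S_2\}$; $\xi_0\prec\xi_1\prec\xi_{\mathcal S_2}$ for $\xi\in\{\mu,\lambda,\rho,T\}$; and the consecutive pairs in the chain $$R_{\mathcal S_2}\prec R_2\prec R_{\mathcal A_3}\prec R_{\mathcal S_3}\prec R_3\prec R_K\prec R_{\mathcal A_4}\prec R_{\mathcal S_4}\prec R_4\prec R_{\mathcal A_5}\prec R_{\mathcal S_5}\prec R_5\prec\cdots\prec R_{\mathcal S_n}\prec R_n,$$ which ends at $R_n$. The covering pairs of the lattice of $*$-congruences are exactly $\mu_c\prec T_c$ for $c\in\{0,1,\mathcal S_2\}$; $\xi_0\prec\xi_1\prec\xi_{\mathcal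 S_2}$ for $\xi\in\{\mu,T\}$; and the consecutive pairs in the same chain. In 2 and 3, IN-pairs $(I,N_1)$ and $(I,N_2)$ are identified when $N_1,N_2$ are normal subgroups of maximal subgroups $G_1,G_2$ of the same $\mathscr J$-class and correspond under an isomorphism $G_1\to G_2$, $x\mapsto axb$, with inverse $y\mapsto bya$ ($a,b\in S$); then $\nu_{N_1}=\nu_{N_2}$. If $N$ is contained in the distinguished maximal subgroup $\overline{\mathcal S}_q$, for the value of $q$ in question, then no identification is needed. -/

import Mathlib

open Equiv

namespace PartialBrauer

/-! ### General semigroup notions, for a monoid `S` (so that `S¹ = S`) -/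

section Semigroup

/-- Green's relation `R`: `a S = b S`. -/
def GreenR {S : Type*} [Monoid S] (a b : S) : Prop :=
  Set.range (fun s : S => a * s) = Set.range (fun s : S => b * s)

/-- Green's relation `L`: `S a = S b`. -/
def GreenL {S : Type*} [Monoid S] (a b : S) : Prop :=
  Set.range (fun s : S => s * a) = Set.range (fun s : S => s * b)

/-- Green's relation `J`: `S a S = S b S`. -/
def GreenJ {S : Type*} [Monoid S] (a b : S) : Prop :=
  {x : S | ∃ s t, x = s * a * t} = {x : S | ∃ s t, x = s * b * t}

/-- Green's relation `H = R ∩ L`. -/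
def GreenH {S : Type*} [Monoid S] (a b : S) : Prop := GreenR a b ∧ GreenL a b

/-- The order on `J`-classes, `J_a ≤ J_b`, in terms of representatives: `a ∈ S b S`. -/
def JLe {S : Type*} [Monoid S] (a b : S) : Prop := ∃ s t, a = s * b * t

/-- The `H`-class of `e`; the maximal subgroups of `S` are exactly the sets `HClass e` with `e`
idempotent. -/
def HClass {S : Type*} [Monoid S] (e : S) : Set S := {x | GreenH x e}

/-- Two-sided ideals (non-empty by definition). -/
def IsIdeal {S : Type*} [Monoid S] (I : Set S) : Prop :=
  I.Nonempty ∧ ∀ x ∈ I, ∀ a : S, a * x ∈ I ∧ x * a ∈ I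

/-- The minimal ideal of `S`. -/
def IsMinimalIdeal {S : Type*} [Monoid S] (M : Set S) : Prop :=
  IsIdeal M ∧ ∀ I : Set S, IsIdeal I → I ⊆ M → I = M

/-- The restriction of `f` to the ideal `I` is a retraction of `I` onto the minimal ideal `M`: a
homomorphism `I → M` that fixes every element of `M`. Values of `f` outside `I` are irrelevant. -/
def IsRetraction {S : Type*} [Monoid S] (I M : Set S) (f : S → S) : Prop :=
  IsMinimalIdeal M ∧ (∀ x ∈ I, f x ∈ M) ∧ (∀ x ∈ I, ∀ y ∈ I, f (x * y) = f x * f y) ∧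
    ∀ x ∈ M, f x = x

/-- `N` is a normal subgroup of the maximal subgroup `HClass e` with identity `e`. -/
def IsNormalSubgroupAt {S : Type*} [Monoid S] (e : S) (N : Set S) : Prop :=
  IsIdempotentElem e ∧ N ⊆ HClass e ∧ e ∈ N ∧ (∀ x ∈ N, ∀ y ∈ N, x * y ∈ N) ∧
    (∀ x ∈ N, ∃ y ∈ N, x * y = e ∧ y * x = e) ∧
    ∀ g ∈ HClass e, ∀ h ∈ HClass e, g * h = e → ∀ x ∈ N, g * x * h ∈ N

/-- The `J`-class of `e` is stable. -/
def StableJClass {S : Type*} [Monoid S] (e : S) : Prop :=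
  ∀ x a : S, GreenJ x e →
    (GreenJ (x * a) x → GreenR (x * a) x) ∧ (GreenJ (a * x) x → GreenL (a * x) x)

/-- The `J`-class of `e` is regular. -/
def RegularJClass {S : Type*} [Monoid S] (e : S) : Prop :=
  ∀ x : S, GreenJ x e → ∃ y, x = x * y * x

/-- IN-pairs `(I, N)`: `I` is an ideal and `N` is a normal subgroup of a maximal subgroup contained
in a stable regular `J`-class that is minimal among the `J`-classes outside `I`. -/
def IsINPair {S : Type*} [Monoid S] (I N : Set S) : Prop :=
  IsIdeal I ∧ ∃ e : S, IsNormalSubgroupAt e N ∧ StableJClass e ∧ RegularJClass e ∧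
    e ∉ I ∧ ∀ y, y ∉ I → JLe y e → GreenJ y e

/-- An IN-pair is proper if `|N| ≥ 2`. -/
def IsProperINPair {S : Type*} [Monoid S] (I N : Set S) : Prop :=
  IsINPair I N ∧ N.Nontrivial

/-- An IN-pair is retractable if `I` is a retractable ideal and all elements of `N` act in the same
way, on either side, on the minimal ideal. -/
def IsRetractableINPair {S : Type*} [Monoid S] (I N : Set S) : Prop :=
  IsINPair I N ∧ ∃ M : Set S, IsMinimalIdeal M ∧ (∃ f : S → S, IsRetraction I M f) ∧
    ∀ x ∈ M, ∀ a ∈ N, ∀ b ∈ N, x * a = x * b ∧ a * x = b * x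

/-- The relation `ν_N = S¹(N × N)S¹ ∩ (J × J)`, where `J` is the `J`-class containing `N`. -/
def nu {S : Type*} [Monoid S] (N : Set S) (x y : S) : Prop :=
  ∃ s t : S, ∃ a ∈ N, ∃ b ∈ N, x = s * a * t ∧ y = s * b * t ∧ GreenJ x a ∧ GreenJ y b

/-- The Rees relation `R_I = Δ ∪ (I × I)`. -/
def reesRel {S : Type*} [Monoid S] (I : Set S) (x y : S) : Prop :=
  x = y ∨ (x ∈ I ∧ y ∈ I)

/-- The relation `R_{I,N} = Δ ∪ ν_N ∪ (I × I)`. -/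
def reesNRel {S : Type*} [Monoid S] (I N : Set S) (x y : S) : Prop :=
  x = y ∨ nu N x y ∨ (x ∈ I ∧ y ∈ I)

/-- `Δ ∪ ν_N ∪ {(x, y) ∈ I × I | (f x, f y) ∈ K}`, where `f` is the retraction of `I` onto the
minimal ideal. (The retraction of a retractable ideal is unique when the minimal ideal is regular,
as in every finite monoid.) -/
def zetaRel {S : Type*} [Monoid S] (K : S → S → Prop) (I N : Set S) (x y : S) : Prop :=
  x = y ∨ nu N x y ∨
    (x ∈ I ∧ y ∈ I ∧ ∃ (M : Set S) (f : S → S), IsRetraction I M f ∧ K (f x) (f y))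

/-- `λ_{I,N}`. -/
def lamRel {S : Type*} [Monoid S] (I N : Set S) (x y : S) : Prop := zetaRel GreenL I N x y

/-- `ρ_{I,N}`. -/
def rhoRel {S : Type*} [Monoid S] (I N : Set S) (x y : S) : Prop := zetaRel GreenR I N x y

/-- `μ_{I,N}`. -/
def muRel {S : Type*} [Monoid S] (I N : Set S) (x y : S) : Prop := zetaRel GreenH I N x y

/-- `N₁` and `N₂` are normal subgroups of maximal subgroups `G₁`, `G₂`, and correspond to each
other under an isomorphism `G₁ → G₂` of the form `x ↦ a x b` with inverse `y ↦ b y a`. This is the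
standard identification of all the maximal subgroups in one (stable, regular) `J`-class. -/
def Corresponding {S : Type*} [Monoid S] (N₁ N₂ : Set S) : Prop :=
  ∃ e₁ e₂ a b : S, IsNormalSubgroupAt e₁ N₁ ∧ IsNormalSubgroupAt e₂ N₂ ∧
    (∀ x ∈ HClass e₁, a * x * b ∈ HClass e₂ ∧ b * (a * x * b) * a = x) ∧
    (∀ y ∈ HClass e₂, b * y * a ∈ HClass e₁ ∧ a * (b * y * a) * b = y) ∧
    (∀ x ∈ HClass e₁, ∀ y ∈ HClass e₁, a * (x * y) * b = (a * x * b) * (a * y * b)) ∧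
    N₂ = (fun x => a * x * b) '' N₁

end Semigroup

/-! ### The partition monoid -/

/-- Partitions of `n ∪ n'`, as equivalence relations: `Sum.inl i` is the upper vertex `i`, and
`Sum.inr i` is the lower vertex `i'`. -/
def PartitionMonoid (n : ℕ) : Type := Setoid (Fin n ⊕ Fin n)

namespace PartitionMonoid

/-- The vertices of a product graph: upper (`inl i`), middle (`inr (inl i)`) and lower
(`inr (inr i)`) rows. -/
abbrev V3 (n : ℕ) : Type := Fin n ⊕ (Fin n ⊕ Fin n)

/-- The upper and middle rows. -/
def upMid (n : ℕ) : Fin n ⊕ Fin n → V3 n := Sum.elim Sum.inl (fun i => Sum.inr (Sum.inl i))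

/-- The middle and lower rows. -/
def midLow (n : ℕ) : Fin n ⊕ Fin n → V3 n := Sum.inr

/-- The upper and lower rows. -/
def upLow (n : ℕ) : Fin n ⊕ Fin n → V3 n := Sum.elim Sum.inl (fun i => Sum.inr (Sum.inr i))

/-- Connectedness in the product graph of `α` and `β`: the join of `α`, placed on the upper two
rows, and `β`, placed on the lower two rows. -/
def productGraph {n : ℕ} (α β : Setoid (Fin n ⊕ Fin n)) : Setoid (V3 n) :=
  Setoid.map α (upMid n) ⊔ Setoid.map β (midLow n)

/-- The product `α β`: restrict connectedness in the product graph to the upper and lower rows. -/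
def mul {n : ℕ} (α β : Setoid (Fin n ⊕ Fin n)) : Setoid (Fin n ⊕ Fin n) :=
  Setoid.comap (upLow n) (productGraph α β)

/-- The identity, with blocks `{i, i'}`. -/
def one (n : ℕ) : Setoid (Fin n ⊕ Fin n) := Setoid.ker (Sum.elim id id)

theorem map_le {X Y : Type*} {r : Setoid X} {s : Setoid Y} {f : X → Y}
    (h : ∀ x y, r x y → s (f x) (f y)) : Setoid.map r f ≤ s := by
  apply Setoid.eqvGen_le
  rintro _ _ ⟨a, b, hab, rfl, rfl⟩
  exact h a b hab

theorem map_rel {X Y : Type*} {r : Setoid X} {f : X → Y} {x y : X} (h : r x y) :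
    Setoid.map r f (f x) (f y) := Setoid.le_comap_map h

theorem comap_sup_map {W V : Type*} (i : W → V) (E : Setoid V) (F : Setoid W) :
    Setoid.comap i (E ⊔ Setoid.map F i) = Setoid.comap i E ⊔ F := by
  apply le_antisymm
  · intro x y hxy
    have key : ∀ u v : V, (E ⊔ Setoid.map F i) u v →
        ((∃ w, (Setoid.comap i E ⊔ F) x w ∧ E (i w) u) ↔
          (∃ w, (Setoid.comap i E ⊔ F) x w ∧ E (i w) v)) := by
      let T : Setoid V := Setoid.comap
        (fun u => ∃ w, (Setoid.comap i E ⊔ F) x w ∧ E (i w) u) ⊥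
      have hT : E ⊔ Setoid.map F i ≤ T := by
        apply sup_le
        · intro u v huv
          refine propext ⟨?_, ?_⟩
          · rintro ⟨w, h1, h2⟩
            exact ⟨w, h1, E.trans' h2 huv⟩
          · rintro ⟨w, h1, h2⟩
            exact ⟨w, h1, E.trans' h2 (E.symm' huv)⟩
        · apply map_le
          have aux : ∀ a b, F a b → (∃ w, (Setoid.comap i E ⊔ F) x w ∧ E (i w) (i a)) →
              (∃ w, (Setoid.comap i E ⊔ F) x w ∧ E (i w) (i b)) := by
            rintro a b hab ⟨w, h1, h2⟩
            have h3 : (Setoid.comap i E ⊔ F) w a := (le_sup_left : Setoid.comap i E ≤ _) h2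
            have h4 : (Setoid.comap i E ⊔ F) a b := (le_sup_right : F ≤ _) hab
            exact ⟨b, Setoid.trans' _ h1 (Setoid.trans' _ h3 h4), E.refl' _⟩
          intro a b hab
          exact propext ⟨aux a b hab, aux b a (F.symm' hab)⟩
      intro u v huv
      exact iff_of_eq (hT huv)
    obtain ⟨w, h1, h2⟩ := (key _ _ hxy).1 ⟨x, Setoid.refl' _ x, E.refl' _⟩
    have h3 : (Setoid.comap i E ⊔ F) w y := (le_sup_left : Setoid.comap i E ≤ _) h2
    exact Setoid.trans' _ h1 h3
  · apply sup_le
    · intro x y h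
      exact (le_sup_left : E ≤ E ⊔ Setoid.map F i) h
    · intro x y h
      exact (le_sup_right : Setoid.map F i ≤ E ⊔ Setoid.map F i) (map_rel h)

theorem map_sup {X Y : Type*} (r s : Setoid X) (f : X → Y) :
    Setoid.map (r ⊔ s) f = Setoid.map r f ⊔ Setoid.map s f := by
  apply le_antisymm
  · have h : r ⊔ s ≤ Setoid.comap f (Setoid.map r f ⊔ Setoid.map s f) :=
      sup_le (fun _ _ h => (le_sup_left : Setoid.map r f ≤ _) (map_rel h))
        (fun _ _ h => (le_sup_right : Setoid.map s f ≤ _) (map_rel h))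
    exact map_le fun x y hxy => h hxy
  · exact sup_le (map_le fun x y h => map_rel ((le_sup_left : r ≤ r ⊔ s) h))
      (map_le fun x y h => map_rel ((le_sup_right : s ≤ r ⊔ s) h))

theorem map_map {X Y Z : Type*} (r : Setoid X) (f : X → Y) (g : Y → Z) :
    Setoid.map (Setoid.map r f) g = Setoid.map r (g ∘ f) := by
  apply le_antisymm
  · have h : Setoid.map r f ≤ Setoid.comap g (Setoid.map r (g ∘ f)) :=
      map_le fun x y hxy => map_rel (f := g ∘ f) hxy
    exact map_le fun x y hxy => h hxy
  · exact map_le fun x y h => map_rel (map_rel h)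

theorem map_cases {X Y : Type*} {r : Setoid X} {f : X → Y} (hf : Function.Injective f) {u v : Y}
    (h : Setoid.map r f u v) : u = v ∨ ∃ x y, f x = u ∧ f y = v ∧ r x y := by
  induction h with
  | rel u v h =>
    obtain ⟨a, b, hab, ha, hb⟩ := h
    exact Or.inr ⟨a, b, ha, hb, hab⟩
  | refl u => exact Or.inl rfl
  | symm u v _ ih =>
    rcases ih with h | ⟨x, y, h1, h2, h3⟩
    · exact Or.inl h.symm
    · exact Or.inr ⟨y, x, h2, h1, r.symm' h3⟩
  | trans u v w _ _ ih1 ih2 =>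
    rcases ih1 with rfl | ⟨x, y, h1, h2, h3⟩
    · exact ih2
    · rcases ih2 with rfl | ⟨x', y', h1', h2', h3'⟩
      · exact Or.inr ⟨x, y, h1, h2, h3⟩
      · obtain rfl : y = x' := hf (h2.trans h1'.symm)
        exact Or.inr ⟨x, y', h1, h2', r.trans' h3 h3'⟩

/-- Restricting to a second set of vertices an equivalence supported on a first set. -/
theorem comap_map_square {A B C V : Type*} (f : A → V) (g : B → V) (p : C → A) (q : C → B)
    (P : Setoid A) (hf : Function.Injective f) (hg : Function.Injective g)
    (hpq : ∀ c, f (p c) = g (q c)) (hpull : ∀ a b, f a = g b → ∃ c, p c = a ∧ q c = b) :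
    Setoid.comap g (Setoid.map P f) = Setoid.map (Setoid.comap p P) q := by
  apply le_antisymm
  · intro x y hxy
    rcases map_cases hf hxy with h | ⟨a, b, ha, hb, hab⟩
    · rw [hg h]
    · obtain ⟨c, rfl, rfl⟩ := hpull _ _ ha
      obtain ⟨d, rfl, rfl⟩ := hpull _ _ hb
      exact map_rel hab
  · apply map_le
    intro x y hxy
    change Setoid.map P f (g (q x)) (g (q y))
    rw [← hpq, ← hpq]
    exact map_rel hxy

theorem mul_assoc' {n : ℕ} (α β γ : Setoid (Fin n ⊕ Fin n)) :
    mul (mul α β) γ = mul α (mul β γ) := by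
  -- the four rows of the triple product graph
  let r1 : Fin n → Fin n ⊕ V3 n := Sum.inl
  let r2 : Fin n → Fin n ⊕ V3 n := fun i => Sum.inr (Sum.inl i)
  let r3 : Fin n → Fin n ⊕ V3 n := fun i => Sum.inr (Sum.inr (Sum.inl i))
  let r4 : Fin n → Fin n ⊕ V3 n := fun i => Sum.inr (Sum.inr (Sum.inr i))
  let k123 : V3 n → Fin n ⊕ V3 n := Sum.elim r1 (Sum.elim r2 r3)
  let k134 : V3 n → Fin n ⊕ V3 n := Sum.elim r1 (Sum.elim r3 r4)
  let k124 : V3 n → Fin n ⊕ V3 n := Sum.elim r1 (Sum.elim r2 r4)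
  let k234 : V3 n → Fin n ⊕ V3 n := Sum.inr
  have i123 : Function.Injective k123 := by
    rintro (x | x | x) (y | y | y) h <;> simp_all [k123, r1, r2, r3]
  have i134 : Function.Injective k134 := by
    rintro (x | x | x) (y | y | y) h <;> simp_all [k134, r1, r3, r4]
  have i124 : Function.Injective k124 := by
    rintro (x | x | x) (y | y | y) h <;> simp_all [k124, r1, r2, r4]
  have i234 : Function.Injective k234 := Sum.inr_injective
  have e12 : k123 ∘ upMid n = k124 ∘ upMid n := by
    funext x; rcases x with x | x <;> rfl
  have e23 : k123 ∘ midLow n = k234 ∘ upMid n := by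
    funext x; rcases x with x | x <;> rfl
  have e34 : k234 ∘ midLow n = k134 ∘ midLow n := by
    funext x; rcases x with x | x <;> rfl
  have e14 : k134 ∘ upLow n = k124 ∘ upLow n := by
    funext x; rcases x with x | x <;> rfl
  have s1 : Setoid.comap k134 (Setoid.map (productGraph α β) k123) =
      Setoid.map (mul α β) (upMid n) := by
    apply comap_map_square _ _ _ _ _ i123 i134
    · rintro (x | x) <;> rfl
    · rintro (x | x | x) (y | y | y) h <;> simp [k123, k134, r1, r2, r3, r4] at h
      · exact ⟨Sum.inl x, rfl, by rw [h]; rfl⟩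
      · exact ⟨Sum.inr x, rfl, by rw [h]; rfl⟩
  have s2 : Setoid.comap k124 (Setoid.map (productGraph β γ) k234) =
      Setoid.map (mul β γ) (midLow n) := by
    apply comap_map_square _ _ _ _ _ i234 i124
    · rintro (x | x) <;> rfl
    · rintro (x | x | x) (y | y | y) h <;> simp [k234, k124, r1, r2, r4] at h
      · exact ⟨Sum.inl x, rfl, by rw [h]; rfl⟩
      · exact ⟨Sum.inr x, rfl, by rw [h]; rfl⟩
  have t1 : mul (mul α β) γ = Setoid.comap (k134 ∘ upLow n)
      (Setoid.map (productGraph α β) k123 ⊔ Setoid.map (Setoid.map γ (midLow n)) k134) := by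
    rw [Setoid.comap_comp, comap_sup_map, s1]
    rfl
  have t2 : mul α (mul β γ) = Setoid.comap (k124 ∘ upLow n)
      (Setoid.map (productGraph β γ) k234 ⊔ Setoid.map (Setoid.map α (upMid n)) k124) := by
    rw [Setoid.comap_comp, comap_sup_map, s2, sup_comm]
    rfl
  rw [t1, t2, e14]
  congr 1
  rw [productGraph, productGraph, map_sup, map_sup]
  simp only [map_map]
  rw [e12, e23, e34, sup_comm _ (Setoid.map α (k124 ∘ upMid n)), sup_assoc]

theorem one_mul' {n : ℕ} (β : Setoid (Fin n ⊕ Fin n)) : mul (one n) β = β := by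
  apply le_antisymm
  · have h : productGraph (one n) β ≤
        Setoid.comap (Sum.elim Sum.inl (Sum.elim Sum.inl Sum.inr)) β := by
      apply sup_le
      · apply map_le
        rintro (x | x) (y | y) h <;> obtain rfl : x = y := h <;> exact β.refl' _
      · apply map_le
        rintro (x | x) (y | y) h <;> exact h
    rintro (x | x) (y | y) hxy <;> exact h hxy
  · have hm : ∀ x y, β x y → productGraph (one n) β (midLow n x) (midLow n y) :=
      fun x y h => (le_sup_right : Setoid.map β (midLow n) ≤ _) (map_rel h)
    have hu : ∀ x : Fin n ⊕ Fin n, productGraph (one n) β (upLow n x) (midLow n x) := by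
      rintro (x | x)
      · refine (le_sup_left : Setoid.map (one n) (upMid n) ≤ _) ?_
        exact map_rel (r := one n) (f := upMid n) (x := Sum.inl x) (y := Sum.inr x) rfl
      · exact Setoid.refl' _ _
    intro x y hxy
    exact Setoid.trans' (productGraph _ _) (hu x)
      (Setoid.trans' (productGraph _ _) (hm x y hxy) (Setoid.symm' (productGraph _ _) (hu y)))

theorem mul_one' {n : ℕ} (β : Setoid (Fin n ⊕ Fin n)) : mul β (one n) = β := by
  apply le_antisymm
  · have h : productGraph β (one n) ≤
        Setoid.comap (Sum.elim Sum.inl (Sum.elim Sum.inr Sum.inr)) β := by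
      apply sup_le
      · apply map_le
        rintro (x | x) (y | y) h <;> exact h
      · apply map_le
        rintro (x | x) (y | y) h <;> obtain rfl : x = y := h <;> exact β.refl' _
    rintro (x | x) (y | y) hxy <;> exact h hxy
  · have hm : ∀ x y, β x y → productGraph β (one n) (upMid n x) (upMid n y) :=
      fun x y h => (le_sup_left : Setoid.map β (upMid n) ≤ _) (map_rel h)
    have hu : ∀ x : Fin n ⊕ Fin n, productGraph β (one n) (upLow n x) (upMid n x) := by
      rintro (x | x)
      · exact Setoid.refl' _ _
      · refine (le_sup_right : Setoid.map (one n) (midLow n) ≤ _) ?_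
        exact map_rel (r := one n) (f := midLow n) (x := Sum.inr x) (y := Sum.inl x) rfl
    intro x y hxy
    exact Setoid.trans' (productGraph _ _) (hu x)
      (Setoid.trans' (productGraph _ _) (hm x y hxy) (Setoid.symm' (productGraph _ _) (hu y)))

instance instMonoid (n : ℕ) : Monoid (PartitionMonoid n) where
  mul α β := mul α β
  one := one n
  mul_assoc := mul_assoc'
  one_mul := one_mul'
  mul_one := mul_one'

/-- The set of blocks of a partition. -/
def blocks {n : ℕ} (α : PartitionMonoid n) : Set (Set (Fin n ⊕ Fin n)) := Setoid.classes α

/-- Transversals are the blocks that meet both rows. -/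
def IsTransversal {n : ℕ} (B : Set (Fin n ⊕ Fin n)) : Prop :=
  (∃ i, Sum.inl i ∈ B) ∧ ∃ j, Sum.inr j ∈ B

/-- The rank is the number of transversals. -/
noncomputable def rank {n : ℕ} (α : PartitionMonoid n) : ℕ :=
  {B | B ∈ α.blocks ∧ IsTransversal B}.ncard

/-- The involution `α ↦ α*`, interchanging the two rows. -/
def flip {n : ℕ} (α : PartitionMonoid n) : PartitionMonoid n :=
  Setoid.comap (Sum.swap : Fin n ⊕ Fin n → Fin n ⊕ Fin n) α

/-- All blocks have size at most two. -/
def SmallBlocks {n : ℕ} (α : PartitionMonoid n) : Prop := ∀ B ∈ α.blocks, B.ncard ≤ 2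

/-- An elementary form of the condition that all classes have at most two elements. -/
def Small {X : Type*} (r : Setoid X) : Prop := ∀ x y z, r x y → r x z → x = y ∨ x = z ∨ y = z

theorem classes_iff {X : Type*} [Finite X] (r : Setoid X) :
    (∀ B ∈ r.classes, B.ncard ≤ 2) ↔ Small r := by
  constructor
  · intro h x y z hy hz
    by_contra! hne
    have hB := h _ (Setoid.mem_classes r x)
    have hsub : ({x, y, z} : Set X) ⊆ {w | r w x} := by
      rintro w (rfl | rfl | rfl)
      · exact r.refl' _
      · exact r.symm' hy
      · exact r.symm' hz
    have h3 : ({x, y, z} : Set X).ncard = 3 :=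
      Set.ncard_eq_three.2 ⟨x, y, z, hne.1, hne.2.1, hne.2.2, rfl⟩
    have := Set.ncard_le_ncard hsub (Set.toFinite _)
    omega
  · rintro h B ⟨x, rfl⟩
    by_contra! hB
    obtain ⟨a, b, c, ha, hb, hc, hab, hac, hbc⟩ := (Set.two_lt_ncard_iff (Set.toFinite _)).1 hB
    rcases h a b c (r.trans' ha (r.symm' hb)) (r.trans' ha (r.symm' hc)) with h | h | h
    · exact hab h
    · exact hac h
    · exact hbc h

theorem smallBlocks_iff {n : ℕ} (α : PartitionMonoid n) :
    α.SmallBlocks ↔ Small (X := Fin n ⊕ Fin n) α :=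
  classes_iff (X := Fin n ⊕ Fin n) α

theorem small_map {X Y : Type*} {r : Setoid X} (hr : Small r) {f : X → Y}
    (hf : Function.Injective f) : Small (Setoid.map r f) := by
  intro u v w huv huw
  rcases map_cases hf huv with h | ⟨x, y, rfl, rfl, hxy⟩
  · exact Or.inl h
  rcases map_cases hf huw with h | ⟨x', z, hx, rfl, hxz⟩
  · exact Or.inr (Or.inl h)
  obtain rfl := hf hx
  rcases hr _ _ _ hxy hxz with h | h | h
  · exact Or.inl (congrArg f h)
  · exact Or.inr (Or.inl (congrArg f h))
  · exact Or.inr (Or.inr (congrArg f h))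

/-- In the join of two equivalences with classes of size at most two, a class contains at most two
elements that are isolated for one of the two equivalences. -/
theorem small_join {V : Type*} [Finite V] (A B : Setoid V) (hA : Small A) (hB : Small B)
    (out : Set V) (hout : ∀ v ∈ out, (∀ w, A v w → v = w) ∨ (∀ w, B v w → v = w))
    (x y z : V) (hx : x ∈ out) (hy : y ∈ out) (hz : z ∈ out) (hxy : (A ⊔ B) x y)
    (hxz : (A ⊔ B) x z) : x = y ∨ x = z ∨ y = z := by
  classical
  by_contra! hne
  let G : SimpleGraph V :=
    { Adj := fun u v => u ≠ v ∧ (A u v ∨ B u v)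
      symm := ⟨fun u v h => ⟨h.1.symm, h.2.imp (fun h => A.symm' h) (fun h => B.symm' h)⟩⟩
      loopless := ⟨fun u h => h.1 rfl⟩ }
  have hreach : ∀ u v, (A ⊔ B) u v → G.Reachable u v := by
    have hle : A ⊔ B ≤ G.reachableSetoid := by
      apply sup_le
      · intro u v h
        by_cases huv : u = v
        · rw [huv]
        · exact SimpleGraph.Adj.reachable (G := G) ⟨huv, Or.inl h⟩
      · intro u v h
        by_cases huv : u = v
        · rw [huv]
        · exact SimpleGraph.Adj.reachable (G := G) ⟨huv, Or.inr h⟩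
    intro u v h
    exact hle h
  let C := G.connectedComponentMk x
  let H := G.induce C.supp
  have hconn : H.Connected := C.maximal_connected_induce_supp.prop
  have : Fintype V := Fintype.ofFinite V
  have hedge := hconn.card_vert_le_card_edgeSet_add_one
  have hsum := H.sum_degrees_eq_twice_card_edges
  have hd : ∀ v : C.supp, H.degree v + (if (v : V) ∈ out then 1 else 0) ≤ 2 := by
    intro v
    have hone : ∀ K : Setoid V, Small K →
        (Finset.univ.filter fun w : C.supp => v ≠ w ∧ K v w).card ≤ 1 := by
      intro K hK
      rw [Finset.card_le_one]
      intro a ha b hb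
      simp only [Finset.mem_filter, Finset.mem_univ, true_and] at ha hb
      rcases hK _ _ _ ha.2 hb.2 with h | h | h
      · exact absurd (Subtype.ext h) ha.1
      · exact absurd (Subtype.ext h) hb.1
      · exact Subtype.ext h
    have hzero : ∀ K : Setoid V, (∀ w, K v w → (v : V) = w) →
        (Finset.univ.filter fun w : C.supp => v ≠ w ∧ K v w).card = 0 := by
      intro K hK
      rw [Finset.card_eq_zero, Finset.filter_eq_empty_iff]
      rintro w - ⟨h1, h2⟩
      exact h1 (Subtype.ext (hK _ h2))
    have hsub : H.degree v ≤ (Finset.univ.filter fun w : C.supp => v ≠ w ∧ A v w).card +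
        (Finset.univ.filter fun w : C.supp => v ≠ w ∧ B v w).card := by
      rw [← SimpleGraph.card_neighborFinset_eq_degree]
      refine le_trans (Finset.card_le_card ?_) (Finset.card_union_le _ _)
      intro w hw
      rw [SimpleGraph.mem_neighborFinset] at hw
      have hw' : (v : V) ≠ w ∧ (A v w ∨ B v w) := hw
      have hne' : v ≠ w := fun h => hw'.1 (congrArg _ h)
      simp only [Finset.mem_union, Finset.mem_filter, Finset.mem_univ, true_and]
      exact hw'.2.imp (fun h => ⟨hne', h⟩) (fun h => ⟨hne', h⟩)
    have h1 := hone A hA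
    have h2 := hone B hB
    split_ifs with ho
    · rcases hout _ ho with h | h
      · have := hzero A h
        omega
      · have := hzero B h
        omega
    · omega
  have htot : ∑ v : C.supp, (H.degree v + (if (v : V) ∈ out then 1 else 0)) ≤
      ∑ _v : C.supp, 2 := Finset.sum_le_sum fun v _ => hd v
  have hxC : x ∈ C.supp := rfl
  have hyC : y ∈ C.supp := SimpleGraph.ConnectedComponent.sound (hreach _ _ hxy).symm
  have hzC : z ∈ C.supp := SimpleGraph.ConnectedComponent.sound (hreach _ _ hxz).symm
  have h3 : 3 ≤ ∑ v : C.supp, (if (v : V) ∈ out then 1 else 0) := by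
    rw [← Finset.card_filter]
    have hc : ({⟨x, hxC⟩, ⟨y, hyC⟩, ⟨z, hzC⟩} : Finset C.supp).card = 3 := by
      rw [Finset.card_eq_three]
      exact ⟨_, _, _, fun h => hne.1 (congrArg Subtype.val h),
        fun h => hne.2.1 (congrArg Subtype.val h), fun h => hne.2.2 (congrArg Subtype.val h), rfl⟩
    rw [← hc]
    apply Finset.card_le_card
    intro w hw
    simp only [Finset.mem_insert, Finset.mem_singleton] at hw
    simp only [Finset.mem_filter, Finset.mem_univ, true_and]
    rcases hw with rfl | rfl | rfl
    · exact hx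
    · exact hy
    · exact hz
  rw [Finset.sum_add_distrib, hsum] at htot
  rw [Nat.card_eq_fintype_card, Nat.card_eq_fintype_card] at hedge
  rw [← SimpleGraph.edgeFinset_card] at hedge
  simp only [Finset.sum_const, Finset.card_univ, smul_eq_mul] at htot
  omega

theorem small_mul {n : ℕ} {α β : Setoid (Fin n ⊕ Fin n)} (hα : Small α) (hβ : Small β) :
    Small (mul α β) := by
  have i1 : Function.Injective (upMid n) := by
    rintro (x | x) (y | y) h <;> simp_all [upMid]
  have i2 : Function.Injective (midLow n) := Sum.inr_injective
  have i3 : Function.Injective (upLow n) := by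
    rintro (x | x) (y | y) h <;> simp_all [upLow]
  have hout : ∀ v ∈ Set.range (upLow n), (∀ w, Setoid.map α (upMid n) v w → v = w) ∨
      (∀ w, Setoid.map β (midLow n) v w → v = w) := by
    rintro _ ⟨x | x, rfl⟩
    · right
      intro w hw
      rcases map_cases i2 hw with h | ⟨a, b, ha, -, -⟩
      · exact h
      · simp [midLow, upLow] at ha
    · left
      intro w hw
      rcases map_cases i1 hw with h | ⟨a, b, ha, -, -⟩
      · exact h
      · rcases a with a | a <;> simp [upMid, upLow] at ha
  intro x y z hxy hxz
  rcases small_join _ _ (small_map hα i1) (small_map hβ i2) _ hout (upLow n x) (upLow n y)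
    (upLow n z) ⟨x, rfl⟩ ⟨y, rfl⟩ ⟨z, rfl⟩ hxy hxz with h | h | h
  · exact Or.inl (i3 h)
  · exact Or.inr (Or.inl (i3 h))
  · exact Or.inr (Or.inr (i3 h))

theorem small_one (n : ℕ) : Small (one n) := by
  rintro (x | x) (y | y) (z | z) hxy hxz <;> obtain rfl : x = y := hxy <;>
    obtain rfl : x = z := hxz <;> simp

theorem small_flip {n : ℕ} {α : PartitionMonoid n} (hα : α.SmallBlocks) :
    α.flip.SmallBlocks := by
  rw [smallBlocks_iff] at hα ⊢
  intro x y z hxy hxz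
  have hs : Function.Injective (Sum.swap : Fin n ⊕ Fin n → Fin n ⊕ Fin n) :=
    Sum.swap_leftInverse.injective
  rcases hα _ _ _ hxy hxz with h | h | h
  · exact Or.inl (hs h)
  · exact Or.inr (Or.inl (hs h))
  · exact Or.inr (Or.inr (hs h))

/-- For a permutation `σ` of `{1, …, q}`, the partition whose non-singleton blocks are
`{i, (σ i)'}` for `i = 1, …, q` (used for `q ≤ n`). -/
def barSetoid (n : ℕ) {q : ℕ} (σ : Perm (Fin q)) : Setoid (Fin n ⊕ Fin n) where
  r x y := x = y ∨
    (∃ (i : Fin q) (a b : Fin n), (a : ℕ) = i ∧ (b : ℕ) = σ i ∧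
      ((x = Sum.inl a ∧ y = Sum.inr b) ∨ (x = Sum.inr b ∧ y = Sum.inl a)))
  iseqv := by
    refine ⟨fun x => Or.inl rfl, ?_, ?_⟩
    · rintro x y (h | ⟨i, a, b, ha, hb, h⟩)
      · exact Or.inl h.symm
      · exact Or.inr ⟨i, a, b, ha, hb, h.symm.imp And.symm And.symm⟩
    · rintro x y z (rfl | ⟨i, a, b, ha, hb, h⟩) hyz
      · exact hyz
      rcases hyz with rfl | ⟨j, c, d, hc, hd, h'⟩
      · exact Or.inr ⟨i, a, b, ha, hb, h⟩
      left
      rcases h with ⟨rfl, rfl⟩ | ⟨rfl, rfl⟩ <;> rcases h' with ⟨h1, rfl⟩ | ⟨h1, rfl⟩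
      · simp at h1
      · obtain rfl : b = d := Sum.inr_injective h1
        have hij : σ i = σ j := Fin.ext (by omega)
        obtain rfl := σ.injective hij
        exact congrArg _ (Fin.ext (by omega))
      · obtain rfl : a = c := Sum.inl_injective h1
        obtain rfl : i = j := Fin.ext (by omega)
        exact congrArg _ (Fin.ext (by omega))
      · simp at h1

theorem small_bar (n : ℕ) {q : ℕ} (σ : Perm (Fin q)) : Small (barSetoid n σ) := by
  rintro x y z (h | ⟨i, a, b, ha, hb, h⟩) hxz
  · exact Or.inl h
  rcases hxz with h' | ⟨j, c, d, hc, hd, h'⟩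
  · exact Or.inr (Or.inl h')
  refine Or.inr (Or.inr ?_)
  rcases h with ⟨rfl, rfl⟩ | ⟨rfl, rfl⟩ <;> rcases h' with ⟨h1, rfl⟩ | ⟨h1, rfl⟩
  · obtain rfl : a = c := Sum.inl_injective h1
    obtain rfl : i = j := Fin.ext (by omega)
    exact congrArg _ (Fin.ext (by omega))
  · simp at h1
  · simp at h1
  · obtain rfl : b = d := Sum.inr_injective h1
    have hij : σ i = σ j := Fin.ext (by omega)
    obtain rfl := σ.injective hij
    exact congrArg _ (Fin.ext (by omega))

end PartitionMonoid

/-! ### The partial Brauer monoid -/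

/-- The partial Brauer monoid: all partitions whose blocks have size at most two. -/
def PB (n : ℕ) : Submonoid (PartitionMonoid n) where
  carrier := {α | α.SmallBlocks}
  mul_mem' {α β} hα hβ := (PartitionMonoid.smallBlocks_iff _).2
    (PartitionMonoid.small_mul ((PartitionMonoid.smallBlocks_iff α).1 hα)
      ((PartitionMonoid.smallBlocks_iff β).1 hβ))
  one_mem' := (PartitionMonoid.smallBlocks_iff _).2 (PartitionMonoid.small_one n)

/-- The involution `α ↦ α*` of the partial Brauer monoid. -/
def pbFlip {n : ℕ} (α : PB n) : PB n :=
  ⟨PartitionMonoid.flip (α : PartitionMonoid n), PartitionMonoid.small_flip α.2⟩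

/-- The ideal `I_q`, of all elements of rank at most `q`. -/
def rankIdeal (n q : ℕ) : Set (PB n) := {α | (α : PartitionMonoid n).rank ≤ q}

/-- The element `σ̄` of the partial Brauer monoid associated to a permutation `σ ∈ S_q`, `q ≤ n`. -/
def bar (n : ℕ) {q : ℕ} (σ : Perm (Fin q)) : PB n :=
  ⟨PartitionMonoid.barSetoid n σ, (PartitionMonoid.smallBlocks_iff _).2
    (PartitionMonoid.small_bar n σ)⟩

/-- The set `N̄ = {σ̄ | σ ∈ N}`. -/
def barSet (n : ℕ) {q : ℕ} (N : Subgroup (Perm (Fin q))) : Set (PB n) :=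
  {α | ∃ σ ∈ N, α = bar n σ}

/-- Names of the three retractable IN-pairs. -/
inductive RetractLabel : Type
  | zero
  | one
  | symTwo

/-- The rank `q` of the `J`-class that contains the group of the IN-pair. -/
def RetractLabel.q : RetractLabel → ℕ
  | .zero => 1
  | .one => 2
  | .symTwo => 2

/-- The normal subgroup of `S_q` belonging to the IN-pair. -/
def RetractLabel.subgroup : (c : RetractLabel) → Subgroup (Perm (Fin c.q))
  | .zero => ⊥
  | .one => ⊥
  | .symTwo => ⊤

/-- The ideal of the IN-pair: `I_0` for `C_0`, and `I_1` for `C_1` and `C_{S_2}`. -/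
def RetractLabel.ideal (n : ℕ) (c : RetractLabel) : Set (PB n) := rankIdeal n (c.q - 1)

/-- The group of the IN-pair, as a subset of the partial Brauer monoid. -/
def RetractLabel.group (n : ℕ) (c : RetractLabel) : Set (PB n) := barSet n c.subgroup

/-- Names of the congruences in the classification: `λ_c`, `ρ_c`, `μ_c` for the three retractable
IN-pairs, the Rees congruences `R_q` for `q = 0, …, n`, and `R_N` for the non-trivial normal
subgroups `N` of `S_q`, `q = 2, …, n`. -/
inductive CongLabel (n : ℕ) : Type
  | lam (c : RetractLabel)
  | rho (c : RetractLabel)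
  | mu (c : RetractLabel)
  | rees (q : ℕ) (hqn : q ≤ n)
  | norm (q : ℕ) (hq : 2 ≤ q) (hqn : q ≤ n) (N : Subgroup (Perm (Fin q))) (hN : N.Normal)
      (hN' : N ≠ ⊥)

/-- The relation on the partial Brauer monoid with a given name. -/
def CongLabel.rel {n : ℕ} : CongLabel n → PB n → PB n → Prop
  | .lam c => lamRel (c.ideal n) (c.group n)
  | .rho c => rhoRel (c.ideal n) (c.group n)
  | .mu c => muRel (c.ideal n) (c.group n)
  | .rees q _ => reesRel (rankIdeal n q)
  | .norm q _ _ N _ _ => reesNRel (rankIdeal n (q - 1)) (barSet n N)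

/-- The names `λ_c` and `ρ_c`. -/
def CongLabel.IsLeftRight {n : ℕ} : CongLabel n → Prop
  | .lam _ => True
  | .rho _ => True
  | _ => False

/-- `c` is directly followed by `d` in the chain `0, 1, S_2`. -/
def RetractLabel.Step : RetractLabel → RetractLabel → Prop
  | .zero, .one => True
  | .one, .symTwo => True
  | _, _ => False

/-- `N` is the Klein four-group `K` (so `q = 4`): the identity and the double transpositions. -/
def IsKlein {q : ℕ} (N : Subgroup (Perm (Fin q))) : Prop :=
  q = 4 ∧ ∀ σ : Perm (Fin q), σ ∈ N ↔ σ = 1 ∨ σ.cycleType = {2, 2}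

/-- `N` is the alternating group. -/
def IsAlt {q : ℕ} (N : Subgroup (Perm (Fin q))) : Prop := N = alternatingGroup (Fin q)

/-- The lowest non-trivial term of the chain of normal subgroups of `S_q`: this is `S_2` for
`q = 2`, `K` for `q = 4`, and `A_q` for `q = 3` and for `q ≥ 5`. -/
def IsFirst {q : ℕ} (N : Subgroup (Perm (Fin q))) : Prop :=
  (q = 2 ∧ N = ⊤) ∨ IsKlein N ∨ ((q = 3 ∨ 5 ≤ q) ∧ IsAlt N)

/-- The edges, from lower end to upper end, of the upper part of both Hasse diagrams:
the chain `R_1, R_{S_2}, R_2, R_{A_3}, R_{S_3}, R_3, R_K, R_{A_4}, R_{S_4}, R_4, R_{A_5}, …, R_n`,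
preceded by the edge from `R_0` to `R_1`. -/
def CongLabel.ChainEdge {n : ℕ} : CongLabel n → CongLabel n → Prop
  | .rees q _, .rees q' _ => q = 0 ∧ q' = 1
  | .rees q _, .norm q' _ _ N _ _ => q' = q + 1 ∧ IsFirst N
  | .norm q _ _ N _ _, .norm q' _ _ N' _ _ =>
      q' = q ∧ ((IsKlein N ∧ IsAlt N') ∨ (IsAlt N ∧ N' = ⊤))
  | .norm q _ _ N _ _, .rees q' _ => q' = q ∧ N = ⊤
  | _, _ => False

/-- The name stands for the largest of the congruences associated to the pair `c`: this is `R_0`,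
`R_1` or `R_{S_2}`, respectively. -/
def CongLabel.IsTopOf {n : ℕ} (c : RetractLabel) : CongLabel n → Prop
  | .rees q _ => (c = .zero ∧ q = 0) ∨ (c = .one ∧ q = 1)
  | .norm q _ _ N _ _ => c = .symTwo ∧ q = 2 ∧ N = ⊤
  | _ => False

/-- The edges, from lower end to upper end, of the Hasse diagram of the congruence lattice. -/
def CongLabel.Edge {n : ℕ} : CongLabel n → CongLabel n → Prop
  | .mu c, .mu d => c.Step d
  | .lam c, .lam d => c.Step d
  | .rho c, .rho d => c.Step d
  | .mu c, .lam d => c = d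
  | .mu c, .rho d => c = d
  | .lam c, l => l.IsTopOf c
  | .rho c, l => l.IsTopOf c
  | l, l' => l.ChainEdge l'

/-- The edges, from lower end to upper end, of the Hasse diagram of the lattice of
`*`-congruences. -/
def CongLabel.StarEdge {n : ℕ} : CongLabel n → CongLabel n → Prop
  | .mu c, .mu d => c.Step d
  | .mu c, l => l.IsTopOf c
  | l, l' => l.ChainEdge l'

/-- `*`-congruences: congruences compatible with the involution. -/
def IsStarCon {n : ℕ} (c : Con (PB n)) : Prop := ∀ α β : PB n, c α β → c (pbFlip α) (pbFlip β)

end PartialBrauer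

open PartialBrauer

namespace PartialBrauer

/-! ### Relations between vertices of an element of the partial Brauer monoid -/

/-! ### Blocks, products, the involution, rank and Green's relations -/

section Basic

variable {n : ℕ}

/-! A congruence turns out to be determined by four data: a level `q` with `1 ≤ q ≤ n + 1`, a normal
subgroup `N` of the symmetric group of degree `q`, and two flags that say whether it relates
elements of rank at most one with different upper, respectively lower, blocks. The relation
`levelRel` with these data is equality above rank `q` and the relation `nu` of `N` in rank `q`.
Below rank `q` it relates two elements when their upper blocks agree, unless the first flag is set,
and their lower blocks agree, unless the second flag is set.

Such a relation is a congruence for two reasons. At rank at most one, multiplication on one side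
leaves the blocks within the row on the other side alone (`UU_mul_iff`). Permutations of at most two
points act trivially on the minimal ideal (`mul_bar_of_le_two`), so for `q ≤ 2` the part in rank `q`
is compatible with the part below. For `q ≥ 3` both flags are required, and nothing below rank `q`
is distinguished.

Conversely, let `Collapses ξ r` mean that `ξ` identifies the idempotent `idem n r` with the element
`om n` of rank zero. A related pair of unequal ranks collapses the larger rank
(`collapses_of_rk_lt`). A related pair of equal positive rank with different rows can be multiplied
to a pair of unequal ranks (`exists_mul_rk_lt`), so it collapses that rank as well. A non-trivial
permutation related to the identity collapses the rank just below (`collapses_of_bar`). Let `q - 1`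
be the greatest collapsing rank. Then `ξ` is trivial above rank `q`, and in rank `q` coordinates
(`coord_eq_bar`) reduce it to a normal subgroup. Below rank `q`, one pair of rank at most one with
different upper blocks generates all pairs of the minimal ideal with equal lower blocks
(`rel_om_mul`), dually for lower blocks, and a collapse in rank at least two sets both flags. This
gives `exists_level`.

Inclusion of these congruences is inclusion of the flags together with the lexicographic order on
`(q, N)` (`levelRel_le_iff`). The normal subgroups of a symmetric group form a chain, so `(q, N)` is
encoded by one number, the height. The covering pairs then follow from arithmetic with heights and
flags. The involution exchanges the flags, which singles out the `*`-congruences.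

For the IN-pairs, charts transport every maximal subgroup to the distinguished one of the same rank.
A retraction has no freedom (`IsRetraction.UU_iff`), and this rules out ideals that contain elements
of rank two. -/

/-- The equivalence relation underlying an element of the partial Brauer monoid. -/
def rel (α : PB n) : Setoid (Fin n ⊕ Fin n) := α.1

/-- Two upper vertices lie in the same block. -/
def UU (α : PB n) (i j : Fin n) : Prop := rel α (.inl i) (.inl j)

/-- Two lower vertices lie in the same block. -/
def LL (α : PB n) (i j : Fin n) : Prop := rel α (.inr i) (.inr j)

/-- An upper and a lower vertex lie in the same block. -/
def UL (α : PB n) (i j : Fin n) : Prop := rel α (.inl i) (.inr j)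

/-- The upper vertices that belong to transversals. -/
def dom (α : PB n) : Set (Fin n) := {i | ∃ j, UL α i j}

/-- The rank of an element of the partial Brauer monoid. -/
noncomputable def rk (α : PB n) : ℕ := (α : PartitionMonoid n).rank

theorem rel_small (α : PB n) : PartitionMonoid.Small (rel α) :=
  (PartitionMonoid.smallBlocks_iff _).1 α.2

theorem ext_rel {α β : PB n} (h1 : ∀ i j, UU α i j ↔ UU β i j) (h2 : ∀ i j, LL α i j ↔ LL β i j)
    (h3 : ∀ i j, UL α i j ↔ UL β i j) : α = β := by
  apply Subtype.ext
  refine Setoid.ext (s := rel α) (t := rel β) ?_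
  rintro (i | i) (j | j)
  · exact h1 i j
  · exact h3 i j
  · exact ⟨fun h => (rel β).symm' ((h3 j i).1 ((rel α).symm' h)),
      fun h => (rel α).symm' ((h3 j i).2 ((rel β).symm' h))⟩
  · exact h2 i j

theorem UU_refl (α : PB n) (i : Fin n) : UU α i i := (rel α).refl' _
theorem LL_refl (α : PB n) (i : Fin n) : LL α i i := (rel α).refl' _
theorem UU_symm {α : PB n} {i j : Fin n} (h : UU α i j) : UU α j i := (rel α).symm' h
theorem LL_symm {α : PB n} {i j : Fin n} (h : LL α i j) : LL α j i := (rel α).symm' h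

theorem UU_trans {α : PB n} {i j k : Fin n} (h : UU α i j) (h' : UU α j k) : UU α i k :=
  (rel α).trans' h h'

theorem UU_unique {α : PB n} {i j k : Fin n} (h : UU α i j) (h' : UU α i k) :
    i = j ∨ i = k ∨ j = k := by
  simpa using rel_small α _ _ _ h h'

theorem UL_fun {α : PB n} {i j k : Fin n} (h : UL α i j) (h' : UL α i k) : j = k := by
  simpa using rel_small α _ _ _ h h'

theorem UL_inj {α : PB n} {i j k : Fin n} (h : UL α i k) (h' : UL α j k) : i = j := by
  simpa using rel_small α _ _ _ ((rel α).symm' h) ((rel α).symm' h')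

theorem eq_of_UU_of_mem_dom {α : PB n} {i j : Fin n} (h : UU α i j) (hi : i ∈ dom α) : i = j := by
  obtain ⟨k, hk⟩ := hi
  simpa using rel_small α _ _ _ h hk

theorem eq_of_LL_of_UL {α : PB n} {i j k : Fin n} (h : LL α i j) (hi : UL α k i) : i = j := by
  simpa using rel_small α _ _ _ h ((rel α).symm' hi)

/-! ### The involution -/

@[simp] theorem UU_flip (α : PB n) (i j : Fin n) : UU (pbFlip α) i j ↔ LL α i j := Iff.rfl
@[simp] theorem LL_flip (α : PB n) (i j : Fin n) : LL (pbFlip α) i j ↔ UU α i j := Iff.rfl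
@[simp] theorem UL_flip (α : PB n) (i j : Fin n) : UL (pbFlip α) i j ↔ UL α j i :=
  ⟨fun h => (rel α).symm' h, fun h => (rel α).symm' h⟩

@[simp] theorem flip_flip (α : PB n) : pbFlip (pbFlip α) = α :=
  ext_rel (by simp) (by simp) (by simp)

theorem flip_injective : Function.Injective (pbFlip (n := n)) := fun a b h => by
  rw [← flip_flip a, h, flip_flip]

theorem mem_dom_flip {α : PB n} {j : Fin n} : j ∈ dom (pbFlip α) ↔ ∃ i, UL α i j := by
  simp [dom]

/-! ### Products -/

/-- To bound a product from above, give an equivalence relation on the three rows of the product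
graph that contains both factors. -/
theorem rel_mul_le {α β : PB n} (T : Setoid (PartitionMonoid.V3 n))
    (hα : ∀ x y, rel α x y → T (PartitionMonoid.upMid n x) (PartitionMonoid.upMid n y))
    (hβ : ∀ x y, rel β x y → T (PartitionMonoid.midLow n x) (PartitionMonoid.midLow n y))
    {x y : Fin n ⊕ Fin n} (h : rel (α * β) x y) :
    T (PartitionMonoid.upLow n x) (PartitionMonoid.upLow n y) := by
  have : PartitionMonoid.productGraph (rel α) (rel β) ≤ T :=
    sup_le (PartitionMonoid.map_le hα) (PartitionMonoid.map_le hβ)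
  exact this h

theorem productGraph_left {α : PB n} (β : PB n) {x y : Fin n ⊕ Fin n} (h : rel α x y) :
    PartitionMonoid.productGraph (rel α) (rel β)
      (PartitionMonoid.upMid n x) (PartitionMonoid.upMid n y) :=
  (le_sup_left : Setoid.map (rel α) (PartitionMonoid.upMid n) ≤ _) (PartitionMonoid.map_rel h)

theorem productGraph_right (α : PB n) {β : PB n} {x y : Fin n ⊕ Fin n} (h : rel β x y) :
    PartitionMonoid.productGraph (rel α) (rel β)
      (PartitionMonoid.midLow n x) (PartitionMonoid.midLow n y) :=
  (le_sup_right : Setoid.map (rel β) (PartitionMonoid.midLow n) ≤ _) (PartitionMonoid.map_rel h)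

/-- Predicates on the three rows that are preserved by the factors are preserved by the product. -/
theorem closed_mul {α β : PB n} (P Q R : Fin n → Prop)
    (hα : ∀ x y, rel α x y → Sum.elim P Q x → Sum.elim P Q y)
    (hβ : ∀ x y, rel β x y → Sum.elim Q R x → Sum.elim Q R y)
    {x y : Fin n ⊕ Fin n} (h : rel (α * β) x y) : Sum.elim P R x → Sum.elim P R y := by
  -- A predicate on the three rows is a map to `Prop`; having equal values under it is the
  -- equivalence relation that must contain both factors.
  have key := rel_mul_le (α := α) (β := β)
    (Setoid.comap (Sum.elim P (Sum.elim Q R) : PartitionMonoid.V3 n → Prop) ⊥) ?_ ?_ h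
  · have key' : Sum.elim P R x = Sum.elim P R y := by
      rcases x with x | x <;> rcases y with y | y <;> exact key
    exact fun hx => key' ▸ hx
  · intro x y hxy
    have e : ∀ z, (Sum.elim P (Sum.elim Q R) : PartitionMonoid.V3 n → Prop)
        (PartitionMonoid.upMid n z) = Sum.elim P Q z := by rintro (z | z) <;> rfl
    change (_ : Prop) = _
    rw [e, e]
    exact propext ⟨hα _ _ hxy, hα _ _ ((rel α).symm' hxy)⟩
  · intro x y hxy
    have e : ∀ z, (Sum.elim P (Sum.elim Q R) : PartitionMonoid.V3 n → Prop)
        (PartitionMonoid.midLow n z) = Sum.elim Q R z := by rintro (z | z) <;> rfl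
    change (_ : Prop) = _
    rw [e, e]
    exact propext ⟨hβ _ _ hxy, hβ _ _ ((rel β).symm' hxy)⟩

theorem closed_of {α : PB n} {P Q : Fin n → Prop} (h1 : ∀ i j, UU α i j → P i → P j)
    (h2 : ∀ i j, UL α i j → (P i ↔ Q j)) (h3 : ∀ i j, LL α i j → Q i → Q j) :
    ∀ x y, rel α x y → Sum.elim P Q x → Sum.elim P Q y := by
  rintro (i | i) (j | j) h
  · exact h1 i j h
  · exact (h2 i j h).1
  · exact (h2 j i ((rel α).symm' h)).2
  · exact h3 i j h

theorem UU_mul_of_UU {α : PB n} (β : PB n) {i j : Fin n} (h : UU α i j) : UU (α * β) i j :=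
  productGraph_left β h

theorem LL_mul_of_LL (α : PB n) {β : PB n} {i j : Fin n} (h : LL β i j) : LL (α * β) i j :=
  productGraph_right α h

theorem UL_mul {α β : PB n} {i j k : Fin n} (h : UL α i k) (h' : UL β k j) : UL (α * β) i j :=
  Setoid.trans' (PartitionMonoid.productGraph (rel α) (rel β)) (productGraph_left β h)
    (productGraph_right α h')

theorem UU_mul {α β : PB n} {i j k l : Fin n} (h : UL α i k) (h' : UU β k l) (h'' : UL α j l) :
    UU (α * β) i j :=
  Setoid.trans' (PartitionMonoid.productGraph (rel α) (rel β)) (productGraph_left β h)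
    (Setoid.trans' (PartitionMonoid.productGraph (rel α) (rel β)) (productGraph_right α h')
      (Setoid.symm' _ (productGraph_left β h'')))

/-- Reversing the order of the three rows turns the product graph of two elements into that of their
flips in the opposite order. The inclusion `key` suffices: applied to the flipped factors it is the
converse inclusion. -/
theorem flip_mul (α β : PB n) : pbFlip (α * β) = pbFlip β * pbFlip α := by
  have key : ∀ α β : PB n, ∀ x y, rel (pbFlip (α * β)) x y → rel (pbFlip β * pbFlip α) x y := by
    intro α β x y h
    let σ : PartitionMonoid.V3 n → PartitionMonoid.V3 n :=
      Sum.elim (fun i => .inr (.inr i)) (Sum.elim (fun i => .inr (.inl i)) Sum.inl)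
    have h1 : rel (α * β) x.swap y.swap := h
    have h2 := rel_mul_le (Setoid.comap σ
      (PartitionMonoid.productGraph (rel (pbFlip β)) (rel (pbFlip α)))) ?_ ?_ h1
    · rcases x with x | x <;> rcases y with y | y <;> exact h2
    · rintro x y h
      have h3 : rel (pbFlip α) x.swap y.swap := by
        rcases x with x | x <;> rcases y with y | y <;> exact h
      have h4 := productGraph_right (pbFlip β) h3
      rcases x with x | x <;> rcases y with y | y <;> exact h4
    · rintro x y h
      have h3 : rel (pbFlip β) x.swap y.swap := by
        rcases x with x | x <;> rcases y with y | y <;> exact h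
      have h4 := productGraph_left (pbFlip α) h3
      rcases x with x | x <;> rcases y with y | y <;> exact h4
  apply Subtype.ext
  refine Setoid.ext (s := rel _) (t := rel _) fun x y => ⟨key α β x y, fun h => ?_⟩
  have h1 := key (pbFlip β) (pbFlip α) x.swap y.swap (by
    change rel (pbFlip β * pbFlip α) x.swap.swap y.swap.swap
    simpa using h)
  rw [flip_flip, flip_flip] at h1
  exact h1

/-- The `α`-block of an upper vertex outside all transversals never reaches the middle row, so it is
closed in the product graph. -/
theorem dom_mul_subset (α β : PB n) : dom (α * β) ⊆ dom α := by
  rintro i ⟨j, h⟩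
  by_contra hi
  have hi' : ∀ j, UL α i j → False := fun j hj => hi ⟨j, hj⟩
  refine closed_mul (UU α i) (fun _ => False) (fun _ => False) ?_ ?_ h (UU_refl α i)
  · refine closed_of (fun k l h h' => UU_trans h' h) (fun k l h => ?_) (fun _ _ _ h => h)
    simp only [iff_false]
    exact fun h' => hi' l ((rel α).trans' h' h)
  · exact closed_of (fun _ _ _ h => h) (fun _ _ _ => Iff.rfl) (fun _ _ _ h => h)

theorem exists_UL_left {α β : PB n} {i j : Fin n} (h : UL (α * β) i j) : ∃ k, UL α i k :=
  dom_mul_subset α β ⟨j, h⟩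

theorem UU_of_UU_mul {α β : PB n} {i j : Fin n} (hi : i ∉ dom α) (h : UU (α * β) i j) :
    UU α i j := by
  have hi' : ∀ j, UL α i j → False := fun j hj => hi ⟨j, hj⟩
  refine closed_mul (UU α i) (fun _ => False) (fun _ => False) ?_ ?_ h (UU_refl α i)
  · refine closed_of (fun k l h h' => UU_trans h' h) (fun k l h => ?_) (fun _ _ _ h => h)
    simp only [iff_false]
    exact fun h' => hi' l ((rel α).trans' h' h)
  · exact closed_of (fun _ _ _ h => h) (fun _ _ _ => Iff.rfl) (fun _ _ _ h => h)

/-! ### Rank -/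

/-- Blocks have at most two elements, so a transversal has exactly one upper vertex and can be
counted by it. -/
theorem rk_eq_ncard (α : PB n) : rk α = (dom α).ncard := by
  symm
  refine Set.ncard_congr (fun i _ => {x | rel α x (.inl i)}) ?_ ?_ ?_
  · rintro i ⟨j, hj⟩
    exact ⟨⟨_, rfl⟩, ⟨i, (rel α).refl' _⟩, ⟨j, (rel α).symm' hj⟩⟩
  · intro i j hi hj h
    have h1 : (Sum.inl i : Fin n ⊕ Fin n) ∈ {x | rel α x (.inl j)} := by
      rw [← h]; exact (rel α).refl' _
    exact eq_of_UU_of_mem_dom h1 hi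
  · rintro B ⟨⟨x, rfl⟩, ⟨i, hi⟩, ⟨j, hj⟩⟩
    refine ⟨i, ⟨j, (rel α).trans' hi ((rel α).symm' hj)⟩, ?_⟩
    ext y
    exact ⟨fun h => (rel α).trans' h hi, fun h => (rel α).trans' h ((rel α).symm' hi)⟩

theorem rk_flip (α : PB n) : rk (pbFlip α) = rk α := by
  have key : ∀ α : PB n, rk α ≤ rk (pbFlip α) := by
    intro α
    rw [rk_eq_ncard, rk_eq_ncard]
    choose! f hf using fun (i : Fin n) (hi : i ∈ dom α) => hi
    refine Set.ncard_le_ncard_of_injOn f (fun i hi => ⟨i, by simpa using hf i hi⟩) ?_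
    intro i hi j hj hij
    exact UL_inj (hf i hi) (hij ▸ hf j hj)
  exact le_antisymm (by simpa using key (pbFlip α)) (key α)

theorem rk_mul_le_left (α β : PB n) : rk (α * β) ≤ rk α := by
  rw [rk_eq_ncard, rk_eq_ncard]
  exact Set.ncard_le_ncard (dom_mul_subset α β)

theorem rk_mul_le_right (α β : PB n) : rk (α * β) ≤ rk β := by
  rw [← rk_flip, flip_mul, ← rk_flip β]
  exact rk_mul_le_left _ _

theorem rk_mul₃_le (α β γ : PB n) : rk (α * β * γ) ≤ rk β :=
  (rk_mul_le_left _ _).trans (rk_mul_le_right _ _)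

theorem rk_le (α : PB n) : rk α ≤ n := by
  rw [rk_eq_ncard]
  simpa using Set.ncard_le_card (dom α)

theorem rk_eq_zero_iff {α : PB n} : rk α = 0 ↔ ∀ i j, ¬ UL α i j := by
  rw [rk_eq_ncard, Set.ncard_eq_zero]
  simp [dom, Set.eq_empty_iff_forall_notMem]

theorem dom_eq_of_rk_le_one {α : PB n} (h : rk α ≤ 1) {i j : Fin n} (hi : i ∈ dom α)
    (hj : j ∈ dom α) : i = j := by
  rw [rk_eq_ncard, Set.ncard_le_one_iff] at h
  exact h hi hj

/-- If the rank of `α` is at most one, then multiplying `α` on the right does not change the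
relation between its upper vertices. -/
theorem UU_mul_iff {α : PB n} (h : rk α ≤ 1) (β : PB n) (i j : Fin n) :
    UU (α * β) i j ↔ UU α i j := by
  refine ⟨fun h' => ?_, UU_mul_of_UU β⟩
  by_cases hi : i ∈ dom α
  · by_cases hj : j ∈ dom α
    · rw [dom_eq_of_rk_le_one h hi hj]; exact UU_refl _ _
    · exact UU_symm (UU_of_UU_mul hj (UU_symm h'))
  · exact UU_of_UU_mul hi h'

theorem LL_mul_iff {β : PB n} (h : rk β ≤ 1) (α : PB n) (i j : Fin n) :
    LL (α * β) i j ↔ LL β i j := by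
  have := UU_mul_iff (α := pbFlip β) (by rwa [rk_flip]) (pbFlip α) i j
  rwa [← flip_mul] at this

theorem ext_of_rk_zero {α β : PB n} (hα : rk α = 0) (hβ : rk β = 0)
    (h1 : ∀ i j, UU α i j ↔ UU β i j) (h2 : ∀ i j, LL α i j ↔ LL β i j) : α = β :=
  ext_rel h1 h2 fun i j =>
    ⟨fun h => absurd h (rk_eq_zero_iff.1 hα i j), fun h => absurd h (rk_eq_zero_iff.1 hβ i j)⟩

theorem rk_mul_left_zero {α : PB n} (h : rk α = 0) (β : PB n) : rk (α * β) = 0 := by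
  have := rk_mul_le_left α β; omega

theorem rk_mul_right_zero {β : PB n} (h : rk β = 0) (α : PB n) : rk (α * β) = 0 := by
  have := rk_mul_le_right α β; omega

/-! ### Green's relations -/

/-- The upper rows of two elements have the same blocks and the same vertices in transversals. -/
def SameTop (α β : PB n) : Prop := (∀ i j, UU α i j ↔ UU β i j) ∧ dom α = dom β

/-- The lower rows of two elements have the same blocks and the same vertices in transversals. -/
def SameBot (α β : PB n) : Prop := SameTop (pbFlip α) (pbFlip β)

theorem SameTop.refl (α : PB n) : SameTop α α := ⟨fun _ _ => Iff.rfl, rfl⟩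
theorem SameTop.symm {α β : PB n} (h : SameTop α β) : SameTop β α :=
  ⟨fun i j => (h.1 i j).symm, h.2.symm⟩
theorem SameTop.trans {α β γ : PB n} (h : SameTop α β) (h' : SameTop β γ) : SameTop α γ :=
  ⟨fun i j => (h.1 i j).trans (h'.1 i j), h.2.trans h'.2⟩
theorem SameTop.rk_eq {α β : PB n} (h : SameTop α β) : rk α = rk β := by
  rw [rk_eq_ncard, rk_eq_ncard, h.2]
theorem SameBot.refl (α : PB n) : SameBot α α := SameTop.refl _
theorem SameBot.symm {α β : PB n} (h : SameBot α β) : SameBot β α := SameTop.symm h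

/-- This is the stability of the `J`-classes: a product that keeps the rank keeps all upper
endpoints of transversals, and only those endpoints could have been joined to new upper vertices. -/
theorem sameTop_mul_of_rk_eq {α β : PB n} (h : rk (α * β) = rk α) : SameTop (α * β) α := by
  have hd : dom (α * β) = dom α := by
    refine Set.eq_of_subset_of_ncard_le (dom_mul_subset α β) ?_
    rw [← rk_eq_ncard, ← rk_eq_ncard, h]
  refine ⟨fun i j => ⟨fun h' => ?_, UU_mul_of_UU β⟩, hd⟩
  by_cases hi : i ∈ dom α
  · rw [eq_of_UU_of_mem_dom h' (hd ▸ hi)]; exact UU_refl _ _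
  · exact UU_of_UU_mul hi h'

theorem sameBot_mul_of_rk_eq {α β : PB n} (h : rk (α * β) = rk β) : SameBot (α * β) β := by
  have := sameTop_mul_of_rk_eq (α := pbFlip β) (β := pbFlip α)
    (by rw [← flip_mul, rk_flip, rk_flip, h])
  rwa [← flip_mul] at this

/-- Reflection in the middle row folds the product graph of `α` and its flip onto `α` itself. -/
theorem rel_of_rel_mul_flip {α : PB n} {x y : Fin n ⊕ Fin n} (h : rel (α * pbFlip α) x y) :
    UU α (x.elim id id) (y.elim id id) := by
  let c : PartitionMonoid.V3 n → Fin n ⊕ Fin n := Sum.elim .inl (Sum.elim .inr .inl)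
  have h1 := rel_mul_le (Setoid.comap c (rel α)) ?_ ?_ h
  · rcases x with x | x <;> rcases y with y | y <;> exact h1
  · rintro (x | x) (y | y) h <;> exact h
  · rintro (x | x) (y | y) h <;> exact h

theorem UU_mul_flip (α : PB n) (i j : Fin n) : UU (α * pbFlip α) i j ↔ UU α i j :=
  ⟨fun h => rel_of_rel_mul_flip h, UU_mul_of_UU _⟩

theorem flip_mul_flip_self (α : PB n) : pbFlip (α * pbFlip α) = α * pbFlip α := by
  rw [flip_mul, flip_flip]

theorem LL_mul_flip (α : PB n) (i j : Fin n) : LL (α * pbFlip α) i j ↔ UU α i j := by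
  rw [← UU_flip, flip_mul_flip_self, UU_mul_flip]

theorem UL_mul_flip (α : PB n) (i j : Fin n) :
    UL (α * pbFlip α) i j ↔ i = j ∧ i ∈ dom α := by
  constructor
  · intro h
    have h1 : i ∈ dom α := exists_UL_left h
    exact ⟨eq_of_UU_of_mem_dom (rel_of_rel_mul_flip h) h1, h1⟩
  · rintro ⟨rfl, k, hk⟩
    exact UL_mul hk (by simpa using hk)

/-- The product of an element with its flip is a projection that remembers the upper row and nothing
else. -/
theorem SameTop.mul_flip_eq {α β : PB n} (h : SameTop α β) :
    α * pbFlip α = β * pbFlip β := by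
  apply ext_rel <;> intro i j
  · rw [UU_mul_flip, UU_mul_flip, h.1]
  · rw [LL_mul_flip, LL_mul_flip, h.1]
  · rw [UL_mul_flip, UL_mul_flip, h.2]

theorem SameBot.flip_mul_eq {α β : PB n} (h : SameBot α β) :
    pbFlip α * α = pbFlip β * β := by
  simpa using SameTop.mul_flip_eq h

theorem SameTop.mul_eq {α β : PB n} (h : SameTop α β) : α * pbFlip α * β = β := by
  have hle : ∀ x y, rel (α * pbFlip α * β) x y → rel β x y := by
    intro x y hxy
    -- Folding the upper row onto the middle row turns each block of the projection into a relation
    -- that already holds in `β`.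
    let c : PartitionMonoid.V3 n → Fin n ⊕ Fin n := Sum.elim .inl id
    have h1 := rel_mul_le (Setoid.comap c (rel β)) ?_ ?_ hxy
    · rcases x with x | x <;> rcases y with y | y <;> exact h1
    · have h2 : ∀ i j, UL (α * pbFlip α) i j → i = j := fun i j h => ((UL_mul_flip α i j).1 h).1
      rintro (x | x) (y | y) h'
      · exact (h.1 x y).1 ((UU_mul_flip α x y).1 h')
      · obtain rfl := h2 x y h'
        exact UU_refl β x
      · obtain rfl := h2 y x ((rel _).symm' h')
        exact UU_refl β y
      · exact (h.1 x y).1 ((LL_mul_flip α x y).1 h')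
    · rintro x y h'; exact h'
  apply ext_rel <;> intro i j
  · exact ⟨hle _ _, fun h' => UU_mul_of_UU _ ((UU_mul_flip α i j).2 ((h.1 i j).2 h'))⟩
  · exact ⟨hle _ _, LL_mul_of_LL _⟩
  · exact ⟨hle _ _, fun h' => UL_mul ((UL_mul_flip α i i).2 ⟨rfl, h.2 ▸ ⟨j, h'⟩⟩) h'⟩

theorem SameBot.mul_eq {α β : PB n} (h : SameBot α β) : β * (pbFlip α * α) = β := by
  have := SameTop.mul_eq h
  apply flip_injective
  rw [flip_mul, flip_mul]
  exact this

theorem mul_flip_mul (α : PB n) : α * pbFlip α * α = α := (SameTop.refl α).mul_eq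

theorem greenR_iff {S : Type*} [Monoid S] {a b : S} :
    GreenR a b ↔ (∃ s, a = b * s) ∧ ∃ s, b = a * s := by
  constructor
  · intro h
    constructor
    · have : a ∈ Set.range (fun s : S => a * s) := ⟨1, mul_one a⟩
      rw [h] at this
      obtain ⟨s, hs⟩ := this
      exact ⟨s, hs.symm⟩
    · have : b ∈ Set.range (fun s : S => b * s) := ⟨1, mul_one b⟩
      rw [← h] at this
      obtain ⟨s, hs⟩ := this
      exact ⟨s, hs.symm⟩
  · rintro ⟨⟨s, rfl⟩, ⟨t, ht⟩⟩
    ext x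
    constructor
    · rintro ⟨u, rfl⟩
      exact ⟨s * u, (mul_assoc _ _ _).symm⟩
    · rintro ⟨u, rfl⟩
      exact ⟨t * u, by simp only [← mul_assoc]; rw [← ht]⟩

theorem greenL_iff {S : Type*} [Monoid S] {a b : S} :
    GreenL a b ↔ (∃ s, a = s * b) ∧ ∃ s, b = s * a := by
  constructor
  · intro h
    constructor
    · have : a ∈ Set.range (fun s : S => s * a) := ⟨1, one_mul a⟩
      rw [h] at this
      obtain ⟨s, hs⟩ := this
      exact ⟨s, hs.symm⟩
    · have : b ∈ Set.range (fun s : S => s * b) := ⟨1, one_mul b⟩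
      rw [← h] at this
      obtain ⟨s, hs⟩ := this
      exact ⟨s, hs.symm⟩
  · rintro ⟨⟨s, rfl⟩, ⟨t, ht⟩⟩
    ext x
    constructor
    · rintro ⟨u, rfl⟩
      exact ⟨u * s, mul_assoc _ _ _⟩
    · rintro ⟨u, rfl⟩
      exact ⟨u * t, by simp only [mul_assoc]; rw [← ht]⟩

theorem greenJ_iff {S : Type*} [Monoid S] {a b : S} : GreenJ a b ↔ JLe a b ∧ JLe b a := by
  constructor
  · intro h
    constructor
    · have : a ∈ {x : S | ∃ s t, x = s * a * t} := ⟨1, 1, by simp⟩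
      rw [h] at this
      exact this
    · have : b ∈ {x : S | ∃ s t, x = s * b * t} := ⟨1, 1, by simp⟩
      rw [← h] at this
      exact this
  · rintro ⟨⟨s, t, rfl⟩, ⟨u, v, hb⟩⟩
    ext x
    constructor
    · rintro ⟨c, d, rfl⟩
      exact ⟨c * s, t * d, by simp only [mul_assoc]⟩
    · rintro ⟨c, d, rfl⟩
      refine ⟨c * u, v * d, ?_⟩
      conv_lhs => rw [hb]
      simp only [mul_assoc]

/-- One direction is stability. For the other, the projection on the common upper row is a left
identity, which exhibits each of the elements as a right multiple of the other. -/
theorem greenR_iff_sameTop {α β : PB n} : GreenR α β ↔ SameTop α β := by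
  rw [greenR_iff]
  constructor
  · rintro ⟨⟨s, hs⟩, ⟨t, ht⟩⟩
    have h1 : rk α ≤ rk β := hs ▸ rk_mul_le_left β s
    have h2 : rk β ≤ rk α := by rw [ht]; exact rk_mul_le_left α t
    have h3 : SameTop (β * s) β := sameTop_mul_of_rk_eq (by rw [← hs]; omega)
    rwa [← hs] at h3
  · intro h
    exact ⟨⟨pbFlip β * α, by rw [← mul_assoc, h.symm.mul_eq]⟩,
      ⟨pbFlip α * β, by rw [← mul_assoc, h.mul_eq]⟩⟩

theorem greenL_iff_sameBot {α β : PB n} : GreenL α β ↔ SameBot α β := by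
  rw [SameBot, ← greenR_iff_sameTop, greenR_iff, greenL_iff]
  constructor
  · rintro ⟨⟨s, hs⟩, ⟨t, ht⟩⟩
    exact ⟨⟨pbFlip s, by rw [hs, flip_mul]⟩, ⟨pbFlip t, by rw [← flip_mul, ← ht]⟩⟩
  · rintro ⟨⟨s, hs⟩, ⟨t, ht⟩⟩
    exact ⟨⟨pbFlip s, flip_injective (by rw [hs, flip_mul, flip_flip])⟩,
      ⟨pbFlip t, flip_injective (by rw [ht, flip_mul, flip_flip])⟩⟩

end Basic

/-! ### Partial injections, permutations, coordinates and hooks -/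

section Special

variable {n : ℕ}

/-! ### Partial injections as elements of the partial Brauer monoid -/

/-- Partial injections of `Fin n`, as relations. -/
structure PInj (n : ℕ) where
  /-- the graph of the partial injection -/
  r : Fin n → Fin n → Prop
  fn : ∀ {i j k}, r i j → r i k → j = k
  inj : ∀ {i j k}, r i k → r j k → i = j

/-- The inverse of a partial injection. -/
def PInj.symm (f : PInj n) : PInj n := ⟨fun i j => f.r j i, fun h h' => f.inj h h',
  fun h h' => f.fn h h'⟩

/-- The identity on a set, as a partial injection. -/
def PInj.ofSet (A : Set (Fin n)) : PInj n := ⟨fun i j => i = j ∧ i ∈ A,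
  fun h h' => h.1.symm.trans h'.1, fun h h' => h.1.trans h'.1.symm⟩

/-- The partition with blocks `{i, (f i)'}` and singletons. -/
def PInj.toSetoid (f : PInj n) : Setoid (Fin n ⊕ Fin n) where
  r x y := x = y ∨ ∃ i j, f.r i j ∧ ((x = .inl i ∧ y = .inr j) ∨ (x = .inr j ∧ y = .inl i))
  iseqv := by
    refine ⟨fun x => Or.inl rfl, ?_, ?_⟩
    · rintro x y (h | ⟨i, j, h, h'⟩)
      · exact Or.inl h.symm
      · exact Or.inr ⟨i, j, h, h'.symm.imp And.symm And.symm⟩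
    · rintro x y z (rfl | ⟨i, j, h, h'⟩) hyz
      · exact hyz
      rcases hyz with rfl | ⟨k, l, hkl, h''⟩
      · exact Or.inr ⟨i, j, h, h'⟩
      left
      rcases h' with ⟨rfl, rfl⟩ | ⟨rfl, rfl⟩ <;> rcases h'' with ⟨h1, rfl⟩ | ⟨h1, rfl⟩
      · simp at h1
      · obtain rfl := Sum.inr_injective h1
        rw [f.inj h hkl]
      · obtain rfl := Sum.inl_injective h1
        rw [f.fn h hkl]
      · simp at h1

theorem PInj.small (f : PInj n) : PartitionMonoid.Small f.toSetoid := by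
  rintro x y z (h | ⟨i, j, h, h'⟩) hxz
  · exact Or.inl h
  rcases hxz with h1 | ⟨k, l, hkl, h''⟩
  · exact Or.inr (Or.inl h1)
  refine Or.inr (Or.inr ?_)
  rcases h' with ⟨rfl, rfl⟩ | ⟨rfl, rfl⟩ <;> rcases h'' with ⟨h1, rfl⟩ | ⟨h1, rfl⟩
  · obtain rfl := Sum.inl_injective h1
    rw [f.fn h hkl]
  · simp at h1
  · simp at h1
  · obtain rfl := Sum.inr_injective h1
    rw [f.inj h hkl]

/-- The element of the partial Brauer monoid given by a partial injection. -/
def pinj (f : PInj n) : PB n := ⟨f.toSetoid, (PartitionMonoid.smallBlocks_iff _).2 f.small⟩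

theorem rel_pinj {f : PInj n} {x y : Fin n ⊕ Fin n} : rel (pinj f) x y ↔
    x = y ∨ ∃ i j, f.r i j ∧ ((x = .inl i ∧ y = .inr j) ∨ (x = .inr j ∧ y = .inl i)) := Iff.rfl

@[simp] theorem UU_pinj (f : PInj n) (i j : Fin n) : UU (pinj f) i j ↔ i = j := by
  simp [UU, rel_pinj]

@[simp] theorem LL_pinj (f : PInj n) (i j : Fin n) : LL (pinj f) i j ↔ i = j := by
  simp [LL, rel_pinj]

@[simp] theorem UL_pinj (f : PInj n) (i j : Fin n) : UL (pinj f) i j ↔ f.r i j := by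
  simp only [UL, rel_pinj]
  simp

theorem flip_pinj (f : PInj n) : pbFlip (pinj f) = pinj f.symm :=
  ext_rel (by simp) (by simp) (by simp [PInj.symm])

/-- The pullback of an equivalence relation along a partial function. -/
def pullback {V X : Type*} (g : V → X → Prop) (hg : ∀ {v x y}, g v x → g v y → x = y)
    (s : Setoid X) : Setoid V where
  r u v := u = v ∨ ∃ x y, g u x ∧ g v y ∧ s x y
  iseqv := by
    refine ⟨fun x => Or.inl rfl, ?_, ?_⟩
    · rintro u v (h | ⟨x, y, h1, h2, h3⟩)
      · exact Or.inl h.symm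
      · exact Or.inr ⟨y, x, h2, h1, s.symm' h3⟩
    · rintro u v w (rfl | ⟨x, y, h1, h2, h3⟩) hvw
      · exact hvw
      rcases hvw with rfl | ⟨x', y', h1', h2', h3'⟩
      · exact Or.inr ⟨x, y, h1, h2, h3⟩
      · obtain rfl := hg h2 h1'
        exact Or.inr ⟨x, y', h1, h2', s.trans' h3 h3'⟩

/-- The vertex of `β` that a vertex of the product graph of `pinj f` and `β` is identified with. -/
def PInj.lift (f : PInj n) : PartitionMonoid.V3 n → Fin n ⊕ Fin n → Prop :=
  Sum.elim (fun i x => ∃ k, f.r i k ∧ x = .inl k)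
    (Sum.elim (fun i x => x = .inl i) (fun i x => x = .inr i))

theorem PInj.lift_fn (f : PInj n) {v : PartitionMonoid.V3 n} {x y : Fin n ⊕ Fin n}
    (hx : f.lift v x) (hy : f.lift v y) : x = y := by
  rcases v with i | i | i
  · obtain ⟨k, hk, rfl⟩ := hx
    obtain ⟨l, hl, rfl⟩ := hy
    rw [f.fn hk hl]
  · exact hx.trans hy.symm
  · exact hx.trans hy.symm

/-- Multiplication by a partial injection on the left only renames upper vertices. Each vertex of
the product graph corresponds to at most one vertex of `β`, and the pullback of `β` along this
partial map contains both factors. -/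
theorem rel_pinj_mul_le {f : PInj n} {β : PB n} {x y : Fin n ⊕ Fin n}
    (h : rel (pinj f * β) x y) :
    x = y ∨ ∃ x' y', f.lift (PartitionMonoid.upLow n x) x' ∧
      f.lift (PartitionMonoid.upLow n y) y' ∧ rel β x' y' := by
  have hi : Function.Injective (PartitionMonoid.upLow n) := by
    rintro (x | x) (y | y) h <;> simp_all [PartitionMonoid.upLow]
  have h1 := rel_mul_le (pullback f.lift f.lift_fn (rel β)) ?_ ?_ h
  · exact h1.imp (fun h => hi h) id
  · rintro x y (rfl | ⟨i, j, hij, ⟨rfl, rfl⟩ | ⟨rfl, rfl⟩⟩)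
    · exact Or.inl rfl
    · exact Or.inr ⟨.inl j, .inl j, ⟨j, hij, rfl⟩, rfl, (rel β).refl' _⟩
    · exact Or.inr ⟨.inl j, .inl j, rfl, ⟨j, hij, rfl⟩, (rel β).refl' _⟩
  · intro x y h
    exact Or.inr ⟨x, y, by rcases x with x | x <;> rfl, by rcases y with y | y <;> rfl, h⟩

theorem UU_pinj_mul (f : PInj n) (β : PB n) (i j : Fin n) :
    UU (pinj f * β) i j ↔ i = j ∨ ∃ k l, f.r i k ∧ f.r j l ∧ UU β k l := by
  constructor
  · intro h
    rcases rel_pinj_mul_le h with h | ⟨_, _, ⟨k, hk, rfl⟩, ⟨l, hl, rfl⟩, h⟩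
    · exact Or.inl (Sum.inl_injective h)
    · exact Or.inr ⟨k, l, hk, hl, h⟩
  · rintro (rfl | ⟨k, l, hk, hl, h⟩)
    · exact UU_refl _ _
    · exact UU_mul (by simpa using hk) h (by simpa using hl)

theorem UL_pinj_mul (f : PInj n) (β : PB n) (i j : Fin n) :
    UL (pinj f * β) i j ↔ ∃ k, f.r i k ∧ UL β k j := by
  constructor
  · intro h
    rcases rel_pinj_mul_le h with h | ⟨_, _, ⟨k, hk, rfl⟩, rfl, h⟩
    · simp at h
    · exact ⟨k, hk, h⟩
  · rintro ⟨k, hk, h⟩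
    exact UL_mul (by simpa using hk) h

theorem LL_pinj_mul (f : PInj n) (β : PB n) (i j : Fin n) :
    LL (pinj f * β) i j ↔ LL β i j := by
  refine ⟨fun h => ?_, LL_mul_of_LL _⟩
  rcases rel_pinj_mul_le h with h | ⟨_, _, rfl, rfl, h⟩
  · obtain rfl := Sum.inr_injective h
    exact LL_refl _ _
  · exact h

theorem mul_pinj_eq (β : PB n) (f : PInj n) :
    β * pinj f = pbFlip (pinj f.symm * pbFlip β) := by
  rw [flip_mul, flip_flip, flip_pinj]; rfl

theorem LL_mul_pinj (f : PInj n) (β : PB n) (i j : Fin n) :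
    LL (β * pinj f) i j ↔ i = j ∨ ∃ k l, f.r k i ∧ f.r l j ∧ LL β k l := by
  rw [mul_pinj_eq, LL_flip, UU_pinj_mul]; rfl

theorem UL_mul_pinj (f : PInj n) (β : PB n) (i j : Fin n) :
    UL (β * pinj f) i j ↔ ∃ k, UL β i k ∧ f.r k j := by
  rw [mul_pinj_eq, UL_flip, UL_pinj_mul]
  simp [PInj.symm, and_comm]

theorem UU_mul_pinj (f : PInj n) (β : PB n) (i j : Fin n) :
    UU (β * pinj f) i j ↔ UU β i j := by
  rw [mul_pinj_eq, UU_flip, LL_pinj_mul]; rfl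

/-! ### The elements `bar n σ` -/

/-- The partial injection underlying `bar n σ`. -/
def barInj (n : ℕ) {q : ℕ} (σ : Perm (Fin q)) : PInj n where
  r a b := ∃ i : Fin q, (a : ℕ) = i ∧ (b : ℕ) = σ i
  fn := by
    rintro a b c ⟨i, h1, h2⟩ ⟨j, h3, h4⟩
    obtain rfl : i = j := Fin.ext (by omega)
    exact Fin.ext (by omega)
  inj := by
    rintro a b c ⟨i, h1, h2⟩ ⟨j, h3, h4⟩
    have h : σ i = σ j := Fin.ext (by omega)
    obtain rfl := σ.injective h
    exact Fin.ext (by omega)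

theorem bar_eq_pinj {q : ℕ} (σ : Perm (Fin q)) : bar n σ = pinj (barInj n σ) := by
  apply Subtype.ext
  refine Setoid.ext (s := rel (bar n σ)) (t := rel (pinj (barInj n σ))) fun x y => or_congr Iff.rfl ?_
  constructor
  · rintro ⟨i, a, b, ha, hb, h⟩
    exact ⟨a, b, ⟨i, ha, hb⟩, h⟩
  · rintro ⟨a, b, ⟨i, ha, hb⟩, h⟩
    exact ⟨i, a, b, ha, hb, h⟩

@[simp] theorem UU_bar {q : ℕ} (σ : Perm (Fin q)) (a b : Fin n) : UU (bar n σ) a b ↔ a = b := by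
  simp [bar_eq_pinj]

@[simp] theorem LL_bar {q : ℕ} (σ : Perm (Fin q)) (a b : Fin n) : LL (bar n σ) a b ↔ a = b := by
  simp [bar_eq_pinj]

theorem UL_bar {q : ℕ} (σ : Perm (Fin q)) (a b : Fin n) :
    UL (bar n σ) a b ↔ ∃ i : Fin q, (a : ℕ) = i ∧ (b : ℕ) = σ i := by
  simp [bar_eq_pinj, barInj]

/-- The identity of the distinguished maximal subgroup of rank `q`. -/
abbrev idem (n q : ℕ) : PB n := bar n (1 : Perm (Fin q))

theorem UL_idem {q : ℕ} {a b : Fin n} : UL (idem n q) a b ↔ a = b ∧ (a : ℕ) < q := by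
  rw [UL_bar]
  constructor
  · rintro ⟨i, h1, h2⟩
    simp only [Perm.coe_one, id_eq] at h2
    exact ⟨Fin.ext (by omega), by omega⟩
  · rintro ⟨rfl, h⟩
    exact ⟨⟨a, h⟩, rfl, rfl⟩

theorem idem_eq_pinj (q : ℕ) : idem n q = pinj (.ofSet {a | (a : ℕ) < q}) :=
  ext_rel (by simp) (by simp) (fun i j => by rw [UL_idem]; simp [PInj.ofSet])

theorem flip_bar {q : ℕ} (σ : Perm (Fin q)) : pbFlip (bar n σ) = bar n σ⁻¹ := by
  refine ext_rel (by simp) (by simp) fun a b => ?_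
  rw [UL_flip, UL_bar, UL_bar]
  constructor
  · rintro ⟨i, h1, h2⟩
    exact ⟨σ i, h2, by simpa using h1⟩
  · rintro ⟨i, h1, h2⟩
    exact ⟨σ⁻¹ i, h2, by simpa using h1⟩

@[simp] theorem flip_idem (q : ℕ) : pbFlip (idem n q) = idem n q := by
  rw [flip_bar, inv_one]

/-- The order is reversed because partitions compose from left to right and permutations from right
to left. -/
theorem bar_mul_bar {q : ℕ} (hq : q ≤ n) (σ τ : Perm (Fin q)) :
    bar n σ * bar n τ = bar n (τ * σ) := by
  rw [bar_eq_pinj σ]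
  refine ext_rel (fun a b => ?_) (fun a b => ?_) fun a b => ?_
  · rw [UU_pinj_mul, UU_bar]
    constructor
    · rintro (h | ⟨k, l, hk, hl, h⟩)
      · exact h
      · rw [UU_bar] at h
        subst h
        exact (barInj n σ).inj hk hl
    · exact Or.inl
  · rw [LL_pinj_mul, LL_bar, LL_bar]
  · rw [UL_pinj_mul, UL_bar]
    constructor
    · rintro ⟨k, ⟨i, h1, h2⟩, h⟩
      rw [UL_bar] at h
      obtain ⟨j, h3, h4⟩ := h
      obtain rfl : j = σ i := Fin.ext (by omega)
      exact ⟨i, h1, h4⟩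
    · rintro ⟨i, h1, h2⟩
      exact ⟨⟨σ i, by omega⟩, ⟨i, h1, rfl⟩, (UL_bar _ _ _).2 ⟨σ i, rfl, h2⟩⟩

theorem idem_mul_bar {q : ℕ} (hq : q ≤ n) (σ : Perm (Fin q)) : idem n q * bar n σ = bar n σ := by
  rw [bar_mul_bar hq, mul_one]

theorem bar_mul_idem {q : ℕ} (hq : q ≤ n) (σ : Perm (Fin q)) : bar n σ * idem n q = bar n σ := by
  rw [bar_mul_bar hq, one_mul]

theorem idem_mul_idem_of_le {p q : ℕ} (hpq : p ≤ q) : idem n p * idem n q = idem n p := by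
  rw [idem_eq_pinj p]
  refine ext_rel (fun a b => ?_) (fun a b => ?_) fun a b => ?_
  · rw [UU_pinj_mul]
    simp only [UU_bar, UU_pinj, PInj.ofSet]
    constructor
    · rintro (h | ⟨k, l, ⟨rfl, -⟩, ⟨rfl, -⟩, h⟩)
      · exact h
      · exact h
    · exact Or.inl
  · rw [LL_pinj_mul]; simp
  · rw [UL_pinj_mul]
    simp only [UL_pinj, PInj.ofSet, UL_idem]
    constructor
    · rintro ⟨k, ⟨rfl, h⟩, rfl, -⟩
      exact ⟨rfl, h⟩
    · rintro ⟨rfl, h⟩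
      exact ⟨a, ⟨rfl, h⟩, rfl, lt_of_lt_of_le h hpq⟩

theorem idem_mul_idem_of_ge {p q : ℕ} (hpq : p ≤ q) : idem n q * idem n p = idem n p := by
  apply flip_injective
  rw [flip_mul, flip_idem, flip_idem, idem_mul_idem_of_le hpq]

theorem dom_bar {q : ℕ} (hq : q ≤ n) (σ : Perm (Fin q)) : dom (bar n σ) = {a : Fin n | (a : ℕ) < q} := by
  ext a
  constructor
  · rintro ⟨b, hb⟩
    obtain ⟨i, h1, -⟩ := (UL_bar _ _ _).1 hb
    exact lt_of_eq_of_lt h1 i.2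
  · intro h
    exact ⟨⟨σ ⟨a, h⟩, by omega⟩, (UL_bar _ _ _).2 ⟨⟨a, h⟩, rfl, rfl⟩⟩

theorem ncard_lt {q : ℕ} (hq : q ≤ n) : {a : Fin n | (a : ℕ) < q}.ncard = q := by
  have : {a : Fin n | (a : ℕ) < q} = Set.range (Fin.castLE hq) := by
    ext a
    constructor
    · intro h
      exact ⟨⟨a, h⟩, rfl⟩
    · rintro ⟨b, rfl⟩
      exact b.2
  rw [this, Set.ncard_range_of_injective (Fin.castLE_injective hq)]
  simp

theorem rk_bar {q : ℕ} (hq : q ≤ n) (σ : Perm (Fin q)) : rk (bar n σ) = q := by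
  rw [rk_eq_ncard, dom_bar hq, ncard_lt hq]

theorem bar_injective {q : ℕ} (hq : q ≤ n) : Function.Injective (bar n (q := q)) := by
  intro σ τ h
  ext i
  have h1 : UL (bar n σ) ⟨i, by omega⟩ ⟨σ i, by omega⟩ := (UL_bar _ _ _).2 ⟨i, rfl, rfl⟩
  rw [h, UL_bar] at h1
  obtain ⟨j, h2, h3⟩ := h1
  obtain rfl : i = j := Fin.ext h2
  exact h3

/-- The element all of whose blocks are singletons. -/
abbrev om (n : ℕ) : PB n := idem n 0

theorem rk_om : rk (om n) = 0 := rk_bar (Nat.zero_le n) _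

/-- An element of rank `q` of the local monoid at the idempotent of rank `q` is a permutation. -/
theorem exists_bar_eq {q : ℕ} (hq : q ≤ n) {x : PB n} (hx : rk x = q)
    (h : idem n q * x * idem n q = x) : ∃ σ : Perm (Fin q), x = bar n σ := by
  -- This describes the upper row; applied to the flipped element it describes the lower row.
  have key : ∀ x : PB n, rk x = q → idem n q * x * idem n q = x →
      dom x = {a : Fin n | (a : ℕ) < q} ∧ ∀ i j, UU x i j → i = j := by
    intro x hx h
    have h1 : dom x ⊆ {a : Fin n | (a : ℕ) < q} := by
      rw [← dom_bar hq 1, ← h, mul_assoc]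
      exact dom_mul_subset _ _
    have h2 : dom x = {a : Fin n | (a : ℕ) < q} :=
      Set.eq_of_subset_of_ncard_le h1 (by rw [ncard_lt hq, ← rk_eq_ncard, hx])
    refine ⟨h2, fun i j hij => ?_⟩
    by_cases hi : i ∈ dom x
    · exact eq_of_UU_of_mem_dom hij hi
    · rw [h2] at hi
      rw [← h, mul_assoc, idem_eq_pinj, UU_pinj_mul] at hij
      rcases hij with hij | ⟨k, l, hk, -⟩
      · exact hij
      · exact absurd hk.2 hi
  obtain ⟨hd, hU⟩ := key x hx h
  obtain ⟨hd', hL⟩ := key (pbFlip x) (by rw [rk_flip, hx]) (by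
    apply flip_injective
    rw [flip_mul, flip_mul, flip_idem, flip_flip, ← mul_assoc, h])
  have h1 : ∀ i : Fin q, ∃ j : Fin q, UL x (Fin.castLE hq i) (Fin.castLE hq j) := by
    intro i
    have : Fin.castLE hq i ∈ dom x := by rw [hd]; exact i.2
    obtain ⟨j, hj⟩ := this
    have h2 : j ∈ dom (pbFlip x) := ⟨Fin.castLE hq i, by simpa using hj⟩
    rw [hd'] at h2
    exact ⟨⟨j, h2⟩, hj⟩
  choose f hf using h1
  have hinj : Function.Injective f := fun i j hij =>
    Fin.castLE_injective hq (UL_inj (hf i) (hij ▸ hf j))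
  refine ⟨Equiv.ofBijective f (Finite.injective_iff_bijective.1 hinj), ?_⟩
  refine ext_rel (fun i j => ?_) (fun i j => ?_) fun i j => ?_
  · rw [UU_bar]
    exact ⟨hU i j, fun h => h ▸ UU_refl _ _⟩
  · rw [LL_bar]
    exact ⟨hL i j, fun h => h ▸ LL_refl _ _⟩
  · rw [UL_bar]
    constructor
    · intro h
      have hi : i ∈ dom x := ⟨j, h⟩
      rw [hd] at hi
      refine ⟨⟨i, hi⟩, rfl, ?_⟩
      exact congrArg Fin.val (UL_fun h (hf ⟨i, hi⟩))
    · rintro ⟨k, h1, h2⟩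
      obtain rfl : i = Fin.castLE hq k := Fin.ext h1
      obtain rfl : j = Fin.castLE hq (f k) := Fin.ext h2
      exact hf k

/-! ### Coordinates -/

/-- The `R`-class of `α` contains an element whose lower row is that of the distinguished
idempotent. -/
theorem exists_coord {q : ℕ} {α : PB n} (hα : rk α = q) :
    ∃ a, SameTop a α ∧ SameBot a (idem n q) := by
  have hq : q ≤ n := hα ▸ rk_le α
  have hcard : Nat.card (dom (pbFlip α)) = Nat.card {a : Fin n | (a : ℕ) < q} := by
    rw [Nat.card_coe_set_eq, Nat.card_coe_set_eq, ncard_lt hq, ← rk_eq_ncard, rk_flip, hα]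
  -- Any bijection from the lower endpoints of the transversals of `α` to the first `q` vertices
  -- serves to relabel the lower row.
  let e := (Finite.equivFin _).trans ((finCongr hcard).trans (Finite.equivFin _).symm)
  let f : PInj n :=
    { r := fun i j => ∃ h : i ∈ dom (pbFlip α), (e ⟨i, h⟩ : Fin n) = j
      fn := by
        rintro i j k ⟨h, rfl⟩ ⟨h', rfl⟩
        rfl
      inj := by
        rintro i j k ⟨h, h1⟩ ⟨h', h2⟩
        have := e.injective (Subtype.ext (h1.trans h2.symm))
        exact congrArg Subtype.val this }
  refine ⟨α * pinj f, ⟨fun i j => UU_mul_pinj f α i j, ?_⟩, ⟨fun i j => ?_, ?_⟩⟩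
  · ext i
    constructor
    · rintro ⟨j, hj⟩
      obtain ⟨k, hk, -⟩ := (UL_mul_pinj _ _ _ _).1 hj
      exact ⟨k, hk⟩
    · rintro ⟨k, hk⟩
      have hk' : k ∈ dom (pbFlip α) := mem_dom_flip.2 ⟨i, hk⟩
      exact ⟨e ⟨k, hk'⟩, (UL_mul_pinj _ _ _ _).2 ⟨k, hk, hk', rfl⟩⟩
  · rw [UU_flip, UU_flip, LL_bar, LL_mul_pinj]
    constructor
    · rintro (h | ⟨k, l, ⟨hk, rfl⟩, ⟨hl, rfl⟩, h⟩)
      · exact h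
      · obtain ⟨k', hk'⟩ := mem_dom_flip.1 hk
        obtain rfl := eq_of_LL_of_UL h hk'
        rfl
    · exact Or.inl
  · rw [flip_idem, dom_bar hq]
    ext j
    constructor
    · rintro ⟨i, hi⟩
      obtain ⟨k, -, hk, rfl⟩ := (UL_mul_pinj _ _ _ _).1 ((UL_flip _ _ _).1 hi)
      exact (e ⟨k, hk⟩).2
    · intro hj
      obtain ⟨⟨k, hk⟩, hk'⟩ := e.surjective ⟨j, hj⟩
      obtain ⟨i, hi⟩ := mem_dom_flip.1 hk
      exact ⟨i, (UL_flip _ _ _).2 ((UL_mul_pinj _ _ _ _).2 ⟨k, hi, hk, by rw [hk']⟩)⟩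

/-- Coordinates for the `R`-class of `α`, in equational form. -/
structure IsCoord (q : ℕ) (α a : PB n) : Prop where
  mul_flip_mul : a * (pbFlip a * α) = α
  flip_mul_self : pbFlip a * a = idem n q
  mul_flip_self : a * pbFlip a = α * pbFlip α

theorem exists_isCoord {q : ℕ} {α : PB n} (hα : rk α = q) : ∃ a, IsCoord q α a := by
  obtain ⟨a, h1, h2⟩ := exists_coord hα
  refine ⟨a, by rw [← mul_assoc, h1.mul_eq], ?_, h1.mul_flip_eq⟩
  rw [h2.flip_mul_eq, flip_idem, bar_mul_idem (hα ▸ rk_le α)]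

theorem IsCoord.mul_idem {q : ℕ} {α a : PB n} (h : IsCoord q α a) : a * idem n q = a := by
  rw [← h.flip_mul_self, ← mul_assoc, PartialBrauer.mul_flip_mul]

theorem IsCoord.idem_mul_flip {q : ℕ} {α a : PB n} (h : IsCoord q α a) :
    idem n q * pbFlip a = pbFlip a := by
  apply flip_injective
  rw [flip_mul, flip_flip, flip_idem, h.mul_idem]

theorem IsCoord.mul_flip_mul_of_sameTop {q : ℕ} {α β a : PB n} (h : IsCoord q α a)
    (hs : SameTop α β) : a * (pbFlip a * β) = β := by
  rw [← mul_assoc, h.mul_flip_self, hs.mul_eq]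

/-- Elements with the same upper and lower row of rank `q`, in coordinates. -/
theorem coord_eq_bar {q : ℕ} {x y c d : PB n} (hx : rk x = q) (hc : IsCoord q x c)
    (hd : IsCoord q (pbFlip x) d) (h1 : SameTop x y) (h2 : SameBot x y) :
    ∃ σ : Perm (Fin q), pbFlip c * y * d = bar n σ ∧ y = c * bar n σ * pbFlip d := by
  have hq : q ≤ n := hx ▸ rk_le x
  have hy1 : c * (pbFlip c * y) = y := hc.mul_flip_mul_of_sameTop h1
  have hy2 : y * d * pbFlip d = y := by
    apply flip_injective
    rw [flip_mul, flip_mul, flip_flip]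
    exact hd.mul_flip_mul_of_sameTop h2
  have hy3 : c * (pbFlip c * y * d) * pbFlip d = y := by
    rw [← mul_assoc, hy1, hy2]
  -- The passage to coordinates is undone by `c` and `pbFlip d`, so it cannot lower the rank.
  have hr : rk (pbFlip c * y * d) = q := by
    have h3 : rk y = q := by rw [← h1.rk_eq, hx]
    have h4 := rk_mul₃_le (pbFlip c) y d
    have h5 := rk_mul₃_le c (pbFlip c * y * d) (pbFlip d)
    rw [hy3] at h5
    omega
  obtain ⟨σ, hσ⟩ := exists_bar_eq hq hr (by
    rw [← mul_assoc, ← mul_assoc, hc.idem_mul_flip, mul_assoc, hd.mul_idem])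
  exact ⟨σ, hσ, by rw [← hσ, hy3]⟩

theorem exists_coord_eq {q : ℕ} {x : PB n} (hx : rk x = q) : ∃ c d : PB n, ∃ σ : Perm (Fin q),
    IsCoord q x c ∧ IsCoord q (pbFlip x) d ∧ pbFlip c * x * d = bar n σ ∧
      x = c * bar n σ * pbFlip d := by
  obtain ⟨c, hc⟩ := exists_isCoord hx
  obtain ⟨d, hd⟩ := exists_isCoord (α := pbFlip x) (by rw [rk_flip, hx])
  obtain ⟨σ, h⟩ := coord_eq_bar hx hc hd (SameTop.refl x) (SameBot.refl x)
  exact ⟨c, d, σ, hc, hd, h⟩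

theorem exists_eq_mul_idem_mul {q : ℕ} {x : PB n} (hx : rk x = q) :
    (∃ s t, x = s * idem n q * t) ∧ ∃ s t, idem n q = s * x * t := by
  have hq : q ≤ n := hx ▸ rk_le x
  obtain ⟨c, d, σ, hc, hd, h1, h2⟩ := exists_coord_eq hx
  refine ⟨⟨c, bar n σ * pbFlip d, ?_⟩, ⟨pbFlip c, d * bar n σ⁻¹, ?_⟩⟩
  · conv_lhs => rw [h2]
    rw [hc.mul_idem, mul_assoc]
  · rw [← mul_assoc, h1, bar_mul_bar hq, inv_mul_cancel]

/-- Every element is `J`-equivalent to the distinguished idempotent of its rank, and these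
idempotents form a chain. -/
theorem jLe_iff {α β : PB n} : JLe α β ↔ rk α ≤ rk β := by
  constructor
  · rintro ⟨s, t, rfl⟩
    exact rk_mul₃_le _ _ _
  · intro h
    obtain ⟨⟨s, t, h1⟩, -⟩ := exists_eq_mul_idem_mul (x := α) rfl
    obtain ⟨-, u, v, h2⟩ := exists_eq_mul_idem_mul (x := β) rfl
    refine ⟨s * idem n (rk α) * u, v * t, ?_⟩
    conv_lhs => rw [h1, ← idem_mul_idem_of_le h, h2]
    simp only [mul_assoc]

theorem greenJ_iff_rk {α β : PB n} : GreenJ α β ↔ rk α = rk β := by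
  rw [greenJ_iff, jLe_iff, jLe_iff]
  omega

/-! ### Hooks -/

/-- The involution on vertices of the element with hooks `{a, b}` and `{a', b'}`. -/
def hookInvol (a b : Fin n) : Fin n ⊕ Fin n → Fin n ⊕ Fin n :=
  Sum.elim (fun i => if i = a then .inl b else if i = b then .inl a else .inr i)
    (fun i => if i = a then .inr b else if i = b then .inr a else .inl i)

theorem hookInvol_invol (a b : Fin n) (x : Fin n ⊕ Fin n) :
    hookInvol a b (hookInvol a b x) = x := by
  rcases x with i | i
  all_goals
    simp only [hookInvol, Sum.elim_inl, Sum.elim_inr]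
    by_cases h1 : i = a <;> by_cases h2 : i = b <;> simp_all

/-- The equivalence relation whose classes are the orbits of an involution. -/
def involSetoid {X : Type*} (ι : X → X) (hι : ∀ x, ι (ι x) = x) : Setoid X where
  r x y := x = y ∨ ι x = y
  iseqv := by
    refine ⟨fun x => Or.inl rfl, ?_, ?_⟩
    · rintro x y (h | h)
      · exact Or.inl h.symm
      · exact Or.inr (by rw [← h, hι])
    · rintro x y z (rfl | rfl) (rfl | rfl)
      · exact Or.inl rfl
      · exact Or.inr rfl
      · exact Or.inr rfl
      · exact Or.inl (hι x).symm

/-- The element with hooks `{a, b}` and `{a', b'}` and blocks `{i, i'}` for the other `i`. -/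
def hook (a b : Fin n) : PB n := ⟨involSetoid (hookInvol a b) (hookInvol_invol a b),
  (PartitionMonoid.smallBlocks_iff _).2 (by
    rintro x y z (h | h) (h' | h')
    · exact Or.inl h
    · exact Or.inl h
    · exact Or.inr (Or.inl h')
    · exact Or.inr (Or.inr (h.symm.trans h')))⟩

theorem UU_hook {a b i j : Fin n} :
    UU (hook a b) i j ↔ i = j ∨ (i = a ∧ j = b) ∨ (i = b ∧ j = a) := by
  change (Sum.inl i = (Sum.inl j : Fin n ⊕ Fin n) ∨ hookInvol a b (.inl i) = .inl j) ↔ _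
  simp only [hookInvol, Sum.elim_inl, Sum.inl.injEq]
  by_cases h1 : i = a <;> by_cases h2 : i = b <;> simp_all
  all_goals aesop

theorem flip_hook (a b : Fin n) : pbFlip (hook a b) = hook a b := by
  have h : ∀ x, hookInvol a b x.swap = (hookInvol a b x).swap := by
    rintro (i | i) <;> simp only [hookInvol, Sum.swap_inl, Sum.swap_inr, Sum.elim_inl,
      Sum.elim_inr] <;> split_ifs <;> rfl
  have hs : Function.Injective (Sum.swap : Fin n ⊕ Fin n → Fin n ⊕ Fin n) :=
    Sum.swap_leftInverse.injective
  apply Subtype.ext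
  refine Setoid.ext (s := rel (pbFlip (hook a b))) (t := rel (hook a b)) fun x y => ?_
  change (x.swap = y.swap ∨ hookInvol a b x.swap = y.swap) ↔ (x = y ∨ hookInvol a b x = y)
  rw [h, hs.eq_iff, hs.eq_iff]

theorem LL_hook {a b i j : Fin n} :
    LL (hook a b) i j ↔ i = j ∨ (i = a ∧ j = b) ∨ (i = b ∧ j = a) := by
  rw [← flip_hook, LL_flip, UU_hook]

theorem UL_hook {a b i j : Fin n} : UL (hook a b) i j ↔ i = j ∧ i ≠ a ∧ i ≠ b := by
  change (Sum.inl i = (Sum.inr j : Fin n ⊕ Fin n) ∨ hookInvol a b (.inl i) = .inr j) ↔ _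
  simp only [hookInvol, Sum.elim_inl, reduceCtorEq, false_or]
  by_cases h1 : i = a <;> by_cases h2 : i = b <;> simp_all

end Special

/-! ### What a single related pair forces -/

section Generation

variable {n : ℕ}

/-! ### Separation of elements by rank -/

/-- A hook at `{v, i}` reroutes the transversal of `α` that starts at `i` through the block `{u,
v}`, so that it starts at `u`. In `β` the vertices `u` and `v` are not joined, and `u` ends up in no
transversal. Restricting the upper row to `dom α` with `i` exchanged for `u` therefore keeps the
full rank of `α` only. -/
theorem exists_mul_rk_lt_of_UU {α β : PB n} (hd : dom α = dom β) {i u v : Fin n} (hi : i ∈ dom α)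
    (h : UU α u v) (h' : ¬ UU β u v) : ∃ γ, rk (γ * α) = rk α ∧ rk (γ * β) < rk α := by
  have huv : u ≠ v := fun e => h' (e ▸ UU_refl β u)
  have hu : u ∉ dom α := fun hu => huv (eq_of_UU_of_mem_dom h hu)
  have hv : v ∉ dom α := fun hv => huv (eq_of_UU_of_mem_dom (UU_symm h) hv).symm
  have hui : u ≠ i := fun e => hu (e ▸ hi)
  let B : Set (Fin n) := insert u (dom α \ {i})
  have hB : B.ncard = rk α := by rw [rk_eq_ncard]; exact Set.ncard_exchange hu hi
  have hγα : ∀ k ∈ B, k ∈ dom (hook v i * α) := by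
    rintro k (rfl | ⟨⟨j, hj⟩, hki⟩)
    · obtain ⟨j, hj⟩ := hi
      refine ⟨j, ?_⟩
      let G := PartitionMonoid.productGraph (rel (hook v i)) (rel α)
      have h1 : UL (hook v i) k k := UL_hook.2 ⟨rfl, huv, hui⟩
      have h2 : LL (hook v i) v i := LL_hook.2 (Or.inr (Or.inl ⟨rfl, rfl⟩))
      exact G.trans' (productGraph_left α h1) (G.trans' (productGraph_right _ h)
        (G.trans' (productGraph_left α h2) (productGraph_right _ hj)))
    · exact ⟨j, UL_mul (UL_hook.2 ⟨rfl, fun e => hv (e ▸ ⟨j, hj⟩), hki⟩) hj⟩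
  have hγβ : u ∉ dom (hook v i * β) := by
    rintro ⟨j, hj⟩
    have hiu : ¬ UU β u i := fun e => hui (eq_of_UU_of_mem_dom (UU_symm e) (hd ▸ hi)).symm
    refine closed_mul (UU β u) (UU β u) (fun _ => False) ?_ ?_ hj (UU_refl β u)
    · refine closed_of ?_ (fun k l h1 => by rw [(UL_hook.1 h1).1]) ?_
      · intro k l h1 h2
        rcases UU_hook.1 h1 with rfl | ⟨rfl, rfl⟩ | ⟨rfl, rfl⟩
        · exact h2
        · exact absurd h2 h'
        · exact absurd h2 hiu
      · intro k l h1 h2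
        rcases LL_hook.1 h1 with rfl | ⟨rfl, rfl⟩ | ⟨rfl, rfl⟩
        · exact h2
        · exact absurd h2 h'
        · exact absurd h2 hiu
    · refine closed_of (fun k l h1 h2 => UU_trans h2 h1) ?_ (fun _ _ _ h => h)
      intro k l h1
      simp only [iff_false]
      intro h2
      have : k ∈ dom β := ⟨l, h1⟩
      have h3 := eq_of_UU_of_mem_dom (UU_symm h2) this
      exact hu (hd ▸ h3 ▸ this)
  refine ⟨pinj (.ofSet B) * hook v i, le_antisymm (rk_mul_le_right _ _) ?_, ?_⟩
  · rw [← hB, rk_eq_ncard, mul_assoc]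
    refine Set.ncard_le_ncard fun k hk => ?_
    obtain ⟨j, hj⟩ := hγα k hk
    exact ⟨j, (UL_pinj_mul _ _ _ _).2 ⟨k, ⟨rfl, hk⟩, hj⟩⟩
  · rw [← hB, rk_eq_ncard, mul_assoc]
    refine Set.ncard_lt_ncard ?_
    have hsub : dom (pinj (.ofSet B) * (hook v i * β)) ⊆ B ∩ dom (hook v i * β) := by
      rintro k ⟨j, hj⟩
      obtain ⟨l, ⟨rfl, hk⟩, hl⟩ := (UL_pinj_mul _ _ _ _).1 hj
      exact ⟨hk, j, hl⟩
    exact ⟨fun k hk => (hsub hk).1, fun hle => hγβ (hsub (hle (Set.mem_insert u _))).2⟩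

/-- Restriction of the upper row to `dom α` keeps all transversals of `α` but loses one of `β`,
because `dom β` is a different set of the same size. -/
theorem exists_mul_rk_lt_of_dom {α β : PB n} (hr : rk α = rk β) (hd : dom α ≠ dom β) :
    ∃ γ, rk (γ * α) = rk α ∧ rk (γ * β) < rk α := by
  refine ⟨pinj (.ofSet (dom α)), le_antisymm (rk_mul_le_right _ _) ?_, ?_⟩
  · rw [rk_eq_ncard, rk_eq_ncard]
    refine Set.ncard_le_ncard ?_
    rintro i ⟨j, hj⟩
    exact ⟨j, (UL_pinj_mul _ _ _ _).2 ⟨i, ⟨rfl, j, hj⟩, hj⟩⟩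
  · rw [rk_eq_ncard, rk_eq_ncard]
    have hsub : dom (pinj (.ofSet (dom α)) * β) ⊆ dom α ∩ dom β := by
      rintro k ⟨j, hj⟩
      obtain ⟨l, ⟨rfl, hk⟩, hl⟩ := (UL_pinj_mul _ _ _ _).1 hj
      exact ⟨hk, j, hl⟩
    refine Set.ncard_lt_ncard ⟨fun k hk => (hsub hk).1, fun hle => hd ?_⟩
    refine Set.eq_of_subset_of_ncard_le (fun k hk => (hsub (hle hk)).2) ?_
    rw [← rk_eq_ncard, ← rk_eq_ncard, hr]

/-- Elements of the same positive rank with different upper rows can be separated by rank. -/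
theorem exists_mul_rk_lt {α β : PB n} (hr : rk α = rk β) (h0 : 0 < rk α) (h : ¬ SameTop α β) :
    ∃ γ, (rk (γ * α) = rk α ∧ rk (γ * β) < rk α) ∨ (rk (γ * β) = rk α ∧ rk (γ * α) < rk α) := by
  by_cases hd : dom α = dom β
  · obtain ⟨i, hi⟩ : (dom α).Nonempty := by
      rw [← Set.ncard_pos, ← rk_eq_ncard]; exact h0
    have h1 : ¬ ∀ u v, (UU α u v ↔ UU β u v) := fun h' => h ⟨h', hd⟩
    push Not at h1
    obtain ⟨u, v, ⟨h2, h3⟩ | ⟨h2, h3⟩⟩ := h1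
    · obtain ⟨γ, hγ⟩ := exists_mul_rk_lt_of_UU hd hi h2 h3
      exact ⟨γ, Or.inl hγ⟩
    · obtain ⟨γ, hγ⟩ := exists_mul_rk_lt_of_UU hd.symm (hd ▸ hi) h3 h2
      exact ⟨γ, Or.inr (by rwa [hr])⟩
  · obtain ⟨γ, hγ⟩ := exists_mul_rk_lt_of_dom hr hd
    exact ⟨γ, Or.inl hγ⟩

/-! ### Consequences of related pairs -/

theorem con_mul_left {M : Type*} [Monoid M] (ξ : Con M) (u : M) {x y : M} (h : ξ x y) :
    ξ (u * x) (u * y) := ξ.mul (ξ.refl u) h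

theorem con_mul_right {M : Type*} [Monoid M] (ξ : Con M) (u : M) {x y : M} (h : ξ x y) :
    ξ (x * u) (y * u) := ξ.mul h (ξ.refl u)

/-- The image of a congruence under the involution. -/
def flipCon (ξ : Con (PB n)) : Con (PB n) where
  r x y := ξ (pbFlip x) (pbFlip y)
  iseqv := ⟨fun _ => ξ.refl _, fun h => ξ.symm h, fun h h' => ξ.trans h h'⟩
  mul' h h' := by
    rw [flip_mul, flip_mul]
    exact ξ.mul h' h

theorem flipCon_apply {ξ : Con (PB n)} {x y : PB n} :
    flipCon ξ x y ↔ ξ (pbFlip x) (pbFlip y) := Iff.rfl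

/-- The distinguished idempotent of rank `q` is related to an element of rank zero. -/
def Collapses (ξ : Con (PB n)) (q : ℕ) : Prop := ξ (idem n q) (om n)

theorem collapses_flipCon {ξ : Con (PB n)} {q : ℕ} : Collapses (flipCon ξ) q ↔ Collapses ξ q := by
  simp only [Collapses, flipCon_apply, flip_idem]

/-- An element of rank zero is determined by its two rows, and the outer factors supply both of
them. In particular the minimal ideal is a rectangular band. -/
theorem mul_mul_self_of_rk_zero {x : PB n} (hx : rk x = 0) (y : PB n) : x * y * x = x := by
  refine ext_of_rk_zero (rk_mul_right_zero hx _) hx (fun i j => ?_) fun i j => ?_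
  · rw [mul_assoc, UU_mul_iff (by omega)]
  · rw [LL_mul_iff (by omega)]

theorem Collapses.mono {ξ : Con (PB n)} {p q : ℕ} (h : Collapses ξ q) (hpq : p ≤ q) :
    Collapses ξ p := by
  have h1 := con_mul_left ξ (idem n p) h
  rwa [idem_mul_idem_of_le hpq, idem_mul_idem_of_ge (Nat.zero_le p)] at h1

theorem Collapses.exists_rk_zero {ξ : Con (PB n)} {q : ℕ} (hq : q ≤ n) (h : Collapses ξ q)
    {x : PB n} (hx : rk x ≤ q) : ∃ y, rk y = 0 ∧ ξ x y := by
  obtain ⟨s, t, rfl⟩ := (jLe_iff (α := x) (β := idem n q)).2 (by rwa [rk_bar hq])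
  exact ⟨s * om n * t, rk_mul_left_zero (rk_mul_right_zero rk_om _) _,
    con_mul_right ξ t (con_mul_left ξ s h)⟩

/-- Multiplying the given pair by `om n` on either side relates `om n` to `δ * om n` and to `om n *
δ`. Multiplying the first of these by `δ` relates `om n * δ` to `δ`, so all of them lie in one
class. -/
theorem collapses_of_rk_zero {ξ : Con (PB n)} {q : ℕ} {δ : PB n} (h : ξ (idem n q) δ)
    (hδ : rk δ = 0) : Collapses ξ q := by
  have h1 := con_mul_right ξ (om n) h
  have h2 := con_mul_left ξ (om n) h
  rw [idem_mul_idem_of_ge (Nat.zero_le q)] at h1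
  rw [idem_mul_idem_of_le (Nat.zero_le q)] at h2
  have h3 := con_mul_right ξ δ h1
  rw [mul_mul_self_of_rk_zero hδ] at h3
  exact ξ.trans h (ξ.symm (ξ.trans h2 h3))

/-- The larger element may be taken to be the idempotent `E`, related to some `δ` of smaller rank.
Choose `i` in `dom E` but not in `dom δ`, and delete another vertex `k` of `dom E`. This leaves rank
`q` for `E`, and a smaller rank for `δ` because `i` is still missing there. By induction rank `q`
collapses, so `δ` is related to an element of rank zero, and hence so is `E`. -/
theorem collapses_of_rk_lt {ξ : Con (PB n)} {q : ℕ} : ∀ {α β : PB n}, ξ α β → rk α = q →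
    rk β < q → Collapses ξ q := by
  induction q with
  | zero => intro α β _ _ h; omega
  | succ q ih =>
    intro α β h hα hβ
    have hq : q + 1 ≤ n := hα ▸ rk_le α
    obtain ⟨-, s, t, hst⟩ := exists_eq_mul_idem_mul hα
    set E := idem n (q + 1) with hE
    have hEE : E * E = E := idem_mul_bar hq 1
    set δ := s * β * t
    have h1 : ξ E δ := by
      rw [hst]; exact con_mul_right ξ t (con_mul_left ξ s h)
    have hδ : rk δ < q + 1 := lt_of_le_of_lt (rk_mul₃_le s β t) hβ
    rcases Nat.eq_zero_or_pos (rk δ) with h0 | h0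
    · exact collapses_of_rk_zero h1 h0
    obtain ⟨i, hiE, hi⟩ : ∃ i ∈ dom E, i ∉ dom δ := by
      refine Set.exists_mem_notMem_of_ncard_lt_ncard ?_ (Set.toFinite _)
      rw [← rk_eq_ncard, ← rk_eq_ncard, rk_bar hq]
      exact hδ
    have hsub : (dom E \ {i}).ncard = q := by
      rw [Set.ncard_sdiff_singleton_of_mem hiE, ← rk_eq_ncard, rk_bar hq, Nat.add_sub_cancel]
    -- A second vertex exists because `0 < rk δ ≤ q`.
    obtain ⟨k, hkE, hki⟩ : (dom E \ {i}).Nonempty := by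
      rw [← Set.ncard_pos, hsub]; omega
    set e : PB n := pinj (.ofSet (dom E \ {k})) with he
    have hek : (dom E \ {k}).ncard = q := by
      rw [Set.ncard_sdiff_singleton_of_mem hkE, ← rk_eq_ncard, rk_bar hq, Nat.add_sub_cancel]
    have hde : dom (e * E) = dom E \ {k} := by
      ext l
      constructor
      · rintro ⟨j, hj⟩
        obtain ⟨l', ⟨rfl, hl⟩, -⟩ := (UL_pinj_mul _ _ _ _).1 hj
        exact hl
      · intro hl
        obtain ⟨⟨j, hj⟩, -⟩ := id hl
        exact ⟨j, (UL_pinj_mul _ _ _ _).2 ⟨l, ⟨rfl, hl⟩, hj⟩⟩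
    have h2 : Collapses ξ q := by
      refine ih (con_mul_left ξ e h1) (by rw [rk_eq_ncard, hde, hek]) ?_
      rw [rk_eq_ncard, ← hek]
      have hsub' : dom (e * δ) ⊆ (dom E \ {k}) ∩ dom δ := by
        rintro l ⟨j, hj⟩
        obtain ⟨l', ⟨rfl, hl⟩, hj'⟩ := (UL_pinj_mul _ _ _ _).1 hj
        exact ⟨hl, j, hj'⟩
      refine Set.ncard_lt_ncard ⟨fun l hl => (hsub' hl).1, fun hle => hi ?_⟩
      exact (hsub' (hle ⟨hiE, fun e => hki e.symm⟩)).2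
    obtain ⟨y, hy, hy'⟩ := h2.exists_rk_zero (by omega) (x := δ) (by omega)
    exact collapses_of_rk_zero (ξ.trans h1 hy') hy

theorem collapses_of_not_sameTop {ξ : Con (PB n)} {q : ℕ} {α β : PB n} (h : ξ α β)
    (hα : rk α = q) (hβ : rk β ≤ q) (hq : 0 < q) (hs : ¬ SameTop α β) : Collapses ξ q := by
  rcases hβ.lt_or_eq with h1 | h1
  · exact collapses_of_rk_lt h hα h1
  obtain ⟨γ, ⟨h2, h3⟩ | ⟨h2, h3⟩⟩ := exists_mul_rk_lt (hα.trans h1.symm) (by omega) hs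
  · exact collapses_of_rk_lt (con_mul_left ξ γ h) (h2.trans hα) (by omega)
  · exact collapses_of_rk_lt (con_mul_left ξ γ (ξ.symm h)) (h2.trans hα) (by omega)

theorem collapses_of_not_sameBot {ξ : Con (PB n)} {q : ℕ} {α β : PB n} (h : ξ α β)
    (hα : rk α = q) (hβ : rk β ≤ q) (hq : 0 < q) (hs : ¬ SameBot α β) : Collapses ξ q := by
  rw [← collapses_flipCon]
  refine collapses_of_not_sameTop (α := pbFlip α) (β := pbFlip β) ?_ (by rwa [rk_flip])
    (by rwa [rk_flip]) hq hs
  rw [flipCon_apply, flip_flip, flip_flip]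
  exact h

/-- In the product of a hook and an element in which the vertices of the hook are isolated. -/
theorem UU_hook_mul {a b : Fin n} {γ : PB n} (hγ : rk γ = 0) (ha : ∀ i, UU γ a i → a = i)
    (hb : ∀ i, UU γ b i → b = i) (i j : Fin n) :
    UU (hook a b * γ) i j ↔ UU (hook a b) i j ∨ UU γ i j := by
  have hd : ∀ i, i ∈ dom (hook a b) ↔ i ≠ a ∧ i ≠ b := by
    intro i
    constructor
    · rintro ⟨j, hj⟩
      exact (UL_hook.1 hj).2
    · intro h
      exact ⟨i, UL_hook.2 ⟨rfl, h⟩⟩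
  constructor
  · intro h
    by_cases hi : i ∈ dom (hook a b)
    · right
      have hi' := (hd i).1 hi
      have hia : ¬ UU γ i a := fun e => hi'.1 (ha _ (UU_symm e)).symm
      have hib : ¬ UU γ i b := fun e => hi'.2 (hb _ (UU_symm e)).symm
      refine closed_mul (UU γ i) (UU γ i) (fun _ => False) ?_ ?_ h (UU_refl γ i)
      · refine closed_of ?_ (fun k l h1 => by rw [(UL_hook.1 h1).1]) ?_
        · intro k l h1 h2
          rcases UU_hook.1 h1 with rfl | ⟨rfl, rfl⟩ | ⟨rfl, rfl⟩
          · exact h2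
          · exact absurd h2 hia
          · exact absurd h2 hib
        · intro k l h1 h2
          rcases LL_hook.1 h1 with rfl | ⟨rfl, rfl⟩ | ⟨rfl, rfl⟩
          · exact h2
          · exact absurd h2 hia
          · exact absurd h2 hib
      · exact closed_of (fun k l h1 h2 => UU_trans h2 h1)
          (fun k l h1 => absurd h1 (rk_eq_zero_iff.1 hγ k l)) (fun _ _ _ h => h)
    · exact Or.inl (UU_of_UU_mul hi h)
  · rintro (h | h)
    · exact UU_mul_of_UU _ h
    · by_cases hi : i ∈ dom (hook a b)
      · by_cases hj : j ∈ dom (hook a b)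
        · exact UU_mul (UL_hook.2 ⟨rfl, (hd i).1 hi⟩) h (UL_hook.2 ⟨rfl, (hd j).1 hj⟩)
        · rw [hd, not_and_or, not_not, not_not] at hj
          obtain rfl | rfl := hj
          · rw [ha _ (UU_symm h)]; exact UU_refl _ _
          · rw [hb _ (UU_symm h)]; exact UU_refl _ _
      · rw [hd, not_and_or, not_not, not_not] at hi
        obtain rfl | rfl := hi
        · rw [ha _ h]; exact UU_refl _ _
        · rw [hb _ h]; exact UU_refl _ _

theorem UU_om_mul (x : PB n) (i j : Fin n) : UU (om n * x) i j ↔ i = j := by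
  rw [UU_mul_iff (by rw [rk_om]; omega), UU_bar]

theorem LL_mul_om (x : PB n) (i j : Fin n) : LL (x * om n) i j ↔ i = j := by
  rw [LL_mul_iff (by rw [rk_om]; omega), LL_bar]

theorem om_mul_congr {x y : PB n} (hx : rk x ≤ 1) (hy : rk y ≤ 1)
    (h : ∀ i j, LL x i j ↔ LL y i j) : om n * x = om n * y :=
  ext_of_rk_zero (rk_mul_left_zero rk_om _) (rk_mul_left_zero rk_om _)
    (fun i j => by rw [UU_om_mul, UU_om_mul])
    (fun i j => by rw [LL_mul_iff hx, LL_mul_iff hy, h])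

theorem mul_om_congr {x y : PB n} (hx : rk x ≤ 1) (hy : rk y ≤ 1)
    (h : ∀ i j, UU x i j ↔ UU y i j) : x * om n = y * om n :=
  ext_of_rk_zero (rk_mul_right_zero rk_om _) (rk_mul_right_zero rk_om _)
    (fun i j => by rw [UU_mul_iff hx, UU_mul_iff hy, h])
    (fun i j => by rw [LL_mul_om, LL_mul_om])

/-- The partial injection `a ↦ u`, `b ↦ v` pulls the difference between the upper rows of `x` and
`y` back to the single hook `{a, b}`: all other upper vertices become isolated. The factor `z` on
the right gives both elements rank zero and the same lower row. -/
theorem rel_hook_om {ξ : Con (PB n)} {x y : PB n} (h : ξ x y) (hx : rk x ≤ 1) (hy : rk y ≤ 1)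
    {u v : Fin n} (h1 : UU x u v) (h2 : ¬ UU y u v) {a b : Fin n} (hab : a ≠ b) {z : PB n}
    (hz : rk z = 0) : ξ (hook a b * (om n * z)) (om n * z) := by
  have huv : u ≠ v := fun e => h2 (e ▸ UU_refl y u)
  let f : PInj n :=
    { r := fun i j => (i = a ∧ j = u) ∨ (i = b ∧ j = v)
      fn := by
        rintro i j k (⟨rfl, rfl⟩ | ⟨rfl, rfl⟩) (⟨h3, rfl⟩ | ⟨h3, rfl⟩)
        · rfl
        · exact absurd h3 hab
        · exact absurd h3.symm hab
        · rfl
      inj := by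
        rintro i j k (⟨rfl, rfl⟩ | ⟨rfl, rfl⟩) (⟨rfl, h3⟩ | ⟨rfl, h3⟩)
        · rfl
        · exact absurd h3 huv
        · exact absurd h3.symm huv
        · rfl }
  have hfx : rk (pinj f * x) ≤ 1 := (rk_mul_le_right _ _).trans hx
  have hfy : rk (pinj f * y) ≤ 1 := (rk_mul_le_right _ _).trans hy
  have hoz : rk (om n * z) = 0 := rk_mul_right_zero hz _
  have e1 : pinj f * x * z = hook a b * (om n * z) := by
    refine ext_of_rk_zero (rk_mul_right_zero hz _) (rk_mul_right_zero hoz _)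
      (fun i j => ?_) fun i j => ?_
    · rw [UU_mul_iff hfx, UU_hook_mul hoz (fun i h => (UU_om_mul _ _ _).1 h)
        (fun i h => (UU_om_mul _ _ _).1 h), UU_om_mul, UU_pinj_mul, UU_hook]
      constructor
      · rintro (h3 | ⟨k, l, ⟨rfl, rfl⟩ | ⟨rfl, rfl⟩, ⟨rfl, rfl⟩ | ⟨rfl, rfl⟩, h3⟩) <;> simp_all
      · rintro ((h3 | ⟨rfl, rfl⟩ | ⟨rfl, rfl⟩) | h3)
        · exact Or.inl h3
        · exact Or.inr ⟨u, v, Or.inl ⟨rfl, rfl⟩, Or.inr ⟨rfl, rfl⟩, h1⟩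
        · exact Or.inr ⟨v, u, Or.inr ⟨rfl, rfl⟩, Or.inl ⟨rfl, rfl⟩, UU_symm h1⟩
        · exact Or.inl h3
    · rw [LL_mul_iff (by omega), ← mul_assoc, LL_mul_iff (by omega)]
  have e2 : pinj f * y * z = om n * z := by
    refine ext_of_rk_zero (rk_mul_right_zero hz _) hoz (fun i j => ?_) fun i j => ?_
    · rw [UU_mul_iff hfy, UU_om_mul, UU_pinj_mul]
      constructor
      · rintro (h3 | ⟨k, l, ⟨rfl, rfl⟩ | ⟨rfl, rfl⟩, ⟨rfl, rfl⟩ | ⟨rfl, rfl⟩, h3⟩)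
        · exact h3
        · rfl
        · exact absurd h3 h2
        · exact absurd (UU_symm h3) h2
        · rfl
      · exact Or.inl
    · rw [LL_mul_iff (by omega), LL_mul_iff (by omega)]
  have h3 := con_mul_right ξ z (con_mul_left ξ (pinj f) h)
  rwa [e1, e2] at h3

/-- Upper hooks can be removed one at a time, by induction on the number of upper vertices that are
not isolated. If `γ'` is `γ` without the hook `{a, b}`, the relation for `γ'` multiplied by `hook a
b` relates `γ` to an element whose only upper hook is `{a, b}`, and `step` removes that one. -/
theorem rel_om_mul {ξ : Con (PB n)} {x y : PB n} (h : ξ x y) (hx : rk x ≤ 1) (hy : rk y ≤ 1)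
    (hne : ¬ ∀ i j, (UU x i j ↔ UU y i j)) :
    ∀ {γ : PB n}, rk γ = 0 → ξ γ (om n * γ) := by
  have step : ∀ {a b : Fin n}, a ≠ b → ∀ {z : PB n}, rk z = 0 →
      ξ (hook a b * (om n * z)) (om n * z) := by
    push Not at hne
    obtain ⟨u, v, ⟨h2, h3⟩ | ⟨h2, h3⟩⟩ := hne
    · exact fun hab z hz => rel_hook_om h hx hy h2 h3 hab hz
    · exact fun hab z hz => rel_hook_om (ξ.symm h) hy hx h3 h2 hab hz
  have main : ∀ m, ∀ γ : PB n, {i | ∃ j, i ≠ j ∧ UU γ i j}.ncard = m → rk γ = 0 →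
      ξ γ (om n * γ) := by
    intro m
    induction m using Nat.strong_induction_on with
    | _ m ih =>
    intro γ hm hγ
    by_cases hex : ∃ a b, a ≠ b ∧ UU γ a b
    · obtain ⟨a, b, hab, hγab⟩ := hex
      set A : Set (Fin n) := {k | k ≠ a ∧ k ≠ b}
      set γ' := pinj (.ofSet A) * γ with hγ'
      have hγ'0 : rk γ' = 0 := rk_mul_right_zero hγ _
      have hU : ∀ i j, UU γ' i j ↔ i = j ∨ (i ∈ A ∧ j ∈ A ∧ UU γ i j) := by
        intro i j
        rw [hγ', UU_pinj_mul]
        refine or_congr Iff.rfl ⟨?_, ?_⟩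
        · rintro ⟨k, l, ⟨rfl, hi⟩, ⟨rfl, hj⟩, h'⟩
          exact ⟨hi, hj, h'⟩
        · rintro ⟨hi, hj, h'⟩
          exact ⟨i, j, ⟨rfl, hi⟩, ⟨rfl, hj⟩, h'⟩
      have ha : ∀ i, UU γ' a i → a = i := fun i h => by
        rcases (hU _ _).1 h with h | ⟨h, -⟩
        · exact h
        · exact absurd rfl h.1
      have hb : ∀ i, UU γ' b i → b = i := fun i h => by
        rcases (hU _ _).1 h with h | ⟨h, -⟩
        · exact h
        · exact absurd rfl h.2
      have e1 : hook a b * γ' = γ := by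
        refine ext_of_rk_zero (rk_mul_right_zero hγ'0 _) hγ (fun i j => ?_) fun i j => ?_
        · rw [UU_hook_mul hγ'0 ha hb, UU_hook, hU]
          constructor
          · rintro ((rfl | ⟨rfl, rfl⟩ | ⟨rfl, rfl⟩) | rfl | ⟨-, -, h⟩)
            · exact UU_refl _ _
            · exact hγab
            · exact UU_symm hγab
            · exact UU_refl _ _
            · exact h
          · intro h
            by_cases hij : i = j
            · exact Or.inl (Or.inl hij)
            by_cases hia : i = a
            · subst hia
              rcases UU_unique h hγab with h | h | h
              · exact absurd h hij
              · exact absurd h hab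
              · exact Or.inl (Or.inr (Or.inl ⟨rfl, h⟩))
            by_cases hib : i = b
            · subst hib
              rcases UU_unique h (UU_symm hγab) with h | h | h
              · exact absurd h hij
              · exact absurd h.symm hab
              · exact Or.inl (Or.inr (Or.inr ⟨rfl, h⟩))
            refine Or.inr (Or.inr ⟨⟨hia, hib⟩, ⟨fun hja => ?_, fun hjb => ?_⟩, h⟩)
            · subst hja
              rcases UU_unique (UU_symm h) hγab with h | h | h
              · exact hij h.symm
              · exact hab h
              · exact hib h
            · subst hjb
              rcases UU_unique (UU_symm h) (UU_symm hγab) with h | h | h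
              · exact hij h.symm
              · exact hab h.symm
              · exact hia h
        · rw [LL_mul_iff (by omega), LL_mul_iff (by omega)]
      have e2 : om n * γ' = om n * γ :=
        om_mul_congr (by omega) (by omega) fun i j => by rw [hγ', LL_mul_iff (by omega)]
      have h1 : ξ γ' (om n * γ') := by
        refine ih _ ?_ γ' rfl hγ'0
        rw [← hm]
        refine Set.ncard_lt_ncard ⟨?_, fun hle => ?_⟩
        · rintro i ⟨j, hij, h⟩
          rcases (hU _ _).1 h with h | h
          · exact absurd h hij
          · exact ⟨j, hij, h.2.2⟩
        · obtain ⟨j, hj, h⟩ := hle (show a ∈ {i | ∃ j, i ≠ j ∧ UU γ i j} from ⟨b, hab, hγab⟩)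
          exact hj (ha _ h)
      have h2 := con_mul_left ξ (hook a b) h1
      rw [e1, e2] at h2
      exact ξ.trans h2 (step hab hγ)
    · have : om n * γ = γ := by
        refine ext_of_rk_zero (rk_mul_right_zero hγ _) hγ (fun i j => ?_) fun i j => ?_
        · rw [UU_om_mul]
          refine ⟨fun h => h ▸ UU_refl _ _, fun h => ?_⟩
          by_contra hij
          exact hex ⟨i, j, hij, h⟩
        · rw [LL_mul_iff (by omega)]
      rw [this]
      exact ξ.refl _
  exact fun {γ} hγ => main _ γ rfl hγ

/-- Both elements are related to the element of rank zero with isolated upper vertices and their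
common lower row. -/
theorem rel_of_LL_eq {ξ : Con (PB n)} {x y : PB n} (h : ξ x y) (hx : rk x ≤ 1) (hy : rk y ≤ 1)
    (hne : ¬ ∀ i j, (UU x i j ↔ UU y i j)) {γ δ : PB n} (hγ : rk γ = 0) (hδ : rk δ = 0)
    (hL : ∀ i j, LL γ i j ↔ LL δ i j) : ξ γ δ := by
  have h1 := rel_om_mul h hx hy hne hγ
  have h2 := rel_om_mul h hx hy hne hδ
  rw [om_mul_congr (by omega) (by omega) hL] at h1
  exact ξ.trans h1 (ξ.symm h2)

theorem rel_of_UU_eq {ξ : Con (PB n)} {x y : PB n} (h : ξ x y) (hx : rk x ≤ 1) (hy : rk y ≤ 1)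
    (hne : ¬ ∀ i j, (LL x i j ↔ LL y i j)) {γ δ : PB n} (hγ : rk γ = 0) (hδ : rk δ = 0)
    (hU : ∀ i j, UU γ i j ↔ UU δ i j) : ξ γ δ := by
  have := rel_of_LL_eq (ξ := flipCon ξ) (x := pbFlip x) (y := pbFlip y) (γ := pbFlip γ)
    (δ := pbFlip δ) (by rw [flipCon_apply, flip_flip, flip_flip]; exact h)
    (by rwa [rk_flip]) (by rwa [rk_flip]) hne (by rwa [rk_flip]) (by rwa [rk_flip]) hU
  rwa [flipCon_apply, flip_flip, flip_flip] at this

/-- The congruence contains a pair of elements of rank at most one with different upper blocks. -/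
def HasUpper (ξ : Con (PB n)) : Prop :=
  ∃ x y, ξ x y ∧ rk x ≤ 1 ∧ rk y ≤ 1 ∧ ¬ ∀ i j, (UU x i j ↔ UU y i j)

/-- The congruence contains a pair of elements of rank at most one with different lower blocks. -/
def HasLower (ξ : Con (PB n)) : Prop :=
  ∃ x y, ξ x y ∧ rk x ≤ 1 ∧ rk y ≤ 1 ∧ ¬ ∀ i j, (LL x i j ↔ LL y i j)

theorem HasUpper.of_flipCon {ξ : Con (PB n)} (h : HasUpper (flipCon ξ)) : HasLower ξ := by
  obtain ⟨x, y, h, hx, hy, hne⟩ := h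
  exact ⟨pbFlip x, pbFlip y, h, by rwa [rk_flip], by rwa [rk_flip], hne⟩

theorem HasUpper.rel {ξ : Con (PB n)} (h : HasUpper ξ) {γ δ : PB n} (hγ : rk γ = 0)
    (hδ : rk δ = 0) (hL : ∀ i j, LL γ i j ↔ LL δ i j) : ξ γ δ := by
  obtain ⟨x, y, h, hx, hy, hne⟩ := h
  exact rel_of_LL_eq h hx hy hne hγ hδ hL

theorem HasLower.rel {ξ : Con (PB n)} (h : HasLower ξ) {γ δ : PB n} (hγ : rk γ = 0)
    (hδ : rk δ = 0) (hU : ∀ i j, UU γ i j ↔ UU δ i j) : ξ γ δ := by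
  obtain ⟨x, y, h, hx, hy, hne⟩ := h
  exact rel_of_UU_eq h hx hy hne hγ hδ hU

/-- Multiply the collapsing pair by an element with an upper hook on the first two vertices. Since
`q ≥ 2`, the idempotent preserves this hook, while `om n` destroys it. -/
theorem Collapses.hasUpper {ξ : Con (PB n)} {q : ℕ} (h2 : 2 ≤ q) (hq : q ≤ n)
    (h : Collapses ξ q) : HasUpper ξ := by
  let a : Fin n := ⟨0, by omega⟩
  let b : Fin n := ⟨1, by omega⟩
  have hab : a ≠ b := by simp [a, b]
  let κ := hook a b * om n
  have hκ : rk κ = 0 := rk_mul_right_zero rk_om _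
  refine ⟨idem n q * κ, om n * κ, con_mul_right ξ κ h, by rw [rk_mul_right_zero hκ]; omega,
    by rw [rk_mul_right_zero hκ]; omega, fun hall => hab ?_⟩
  rw [← UU_om_mul κ, ← hall]
  have h1 : UU κ a b := UU_mul_of_UU _ (UU_hook.2 (Or.inr (Or.inl ⟨rfl, rfl⟩)))
  exact UU_mul (UL_idem.2 ⟨rfl, by simp only [a]; omega⟩) h1
    (UL_idem.2 ⟨rfl, by simp only [b]; omega⟩)

theorem Collapses.hasLower {ξ : Con (PB n)} {q : ℕ} (h2 : 2 ≤ q) (hq : q ≤ n)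
    (h : Collapses ξ q) : HasLower ξ :=
  (Collapses.hasUpper h2 hq (collapses_flipCon.2 h)).of_flipCon

/-- In the rectangular band of elements of rank zero, `x * y` has the upper row of `x` and the lower
row of `y`, so it links the two. -/
theorem rel_of_rk_zero {ξ : Con (PB n)} (hU : HasUpper ξ) (hL : HasLower ξ) {x y : PB n}
    (hx : rk x = 0) (hy : rk y = 0) : ξ x y := by
  refine ξ.trans (y := x * y) (hL.rel hx (rk_mul_left_zero hx _) fun i j => ?_)
    (hU.rel (rk_mul_left_zero hx _) hy fun i j => ?_)
  · rw [UU_mul_iff (by omega)]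
  · rw [LL_mul_iff (by omega)]

theorem Collapses.rel {ξ : Con (PB n)} {q : ℕ} (h2 : 2 ≤ q) (hq : q ≤ n)
    (h : Collapses ξ q) {x y : PB n} (hx : rk x ≤ q) (hy : rk y ≤ q) : ξ x y := by
  obtain ⟨x', hx', hxx'⟩ := h.exists_rk_zero hq hx
  obtain ⟨y', hy', hyy'⟩ := h.exists_rk_zero hq hy
  exact ξ.trans hxx' (ξ.trans (rel_of_rk_zero (h.hasUpper h2 hq) (h.hasLower h2 hq) hx' hy')
    (ξ.symm hyy'))

/-- In coordinates an element of rank one is `c * idem n 1 * pbFlip d`. Replacing the idempotent by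
`om n` cuts its only transversal and leaves the other blocks alone. -/
theorem Collapses.rel_retract {ξ : Con (PB n)} (h : Collapses ξ 1) {x : PB n} (hx : rk x ≤ 1) :
    ξ x (x * om n * x) := by
  rcases Nat.eq_zero_or_pos (rk x) with h0 | h0
  · rw [mul_mul_self_of_rk_zero h0]
    exact ξ.refl _
  obtain ⟨c, d, σ, hc, hd, -, hx'⟩ := exists_coord_eq (x := x) (q := 1) (by omega)
  have hσ : bar n σ = idem n 1 := congrArg _ (Subsingleton.elim _ _)
  rw [hσ] at hx'
  have hn : 1 ≤ n := le_trans h0 (rk_le x)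
  have hcr : rk c ≤ 1 := by
    rw [← hc.mul_idem]; exact (rk_mul_le_right _ _).trans (rk_bar hn _).le
  have hdr : rk (pbFlip d) ≤ 1 := by
    rw [← hd.idem_mul_flip]; exact (rk_mul_le_left _ _).trans (rk_bar hn _).le
  have e : c * om n * pbFlip d = x * om n * x := by
    refine ext_of_rk_zero (rk_mul_left_zero (rk_mul_right_zero rk_om _) _)
      (rk_mul_left_zero (rk_mul_right_zero rk_om _) _) (fun i j => ?_) fun i j => ?_
    · rw [mul_assoc, mul_assoc, UU_mul_iff hcr, UU_mul_iff hx, ← UU_mul_flip, hc.mul_flip_self,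
        UU_mul_flip]
    · rw [LL_mul_iff hdr, LL_mul_iff hx, LL_flip, ← UU_mul_flip, hd.mul_flip_self,
        UU_mul_flip, UU_flip]
  have h1 := con_mul_right ξ (pbFlip d) (con_mul_left ξ c h)
  rwa [← hx', e] at h1

/-- Delete a moved point `i` from the upper row. The permutation then loses the lower endpoint `σ
i`, and the identity loses `i`. The lower rows differ in rank `q - 1`, which is positive, so this
rank collapses. -/
theorem collapses_of_bar {ξ : Con (PB n)} {q : ℕ} (hq : q ≤ n) (h2 : 2 ≤ q)
    {σ : Perm (Fin q)} (hσ : σ ≠ 1) (h : ξ (bar n σ) (idem n q)) : Collapses ξ (q - 1) := by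
  obtain ⟨i, hi⟩ : ∃ i, σ i ≠ i := by
    by_contra! hall
    exact hσ (Equiv.ext hall)
  let B : Set (Fin n) := {a | (a : ℕ) < q} \ {Fin.castLE hq i}
  have hB : B.ncard = q - 1 := by
    rw [Set.ncard_sdiff_singleton_of_mem (by exact i.2), ncard_lt hq]
  have hdom : ∀ τ : Perm (Fin q), dom (pinj (.ofSet B) * bar n τ) = B := by
    intro τ
    ext k
    constructor
    · rintro ⟨j, hj⟩
      obtain ⟨l, ⟨rfl, hl⟩, -⟩ := (UL_pinj_mul _ _ _ _).1 hj
      exact hl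
    · intro hk
      have hk' : k ∈ dom (bar n τ) := by rw [dom_bar hq]; exact hk.1
      obtain ⟨j, hj⟩ := hk'
      exact ⟨j, (UL_pinj_mul _ _ _ _).2 ⟨k, ⟨rfl, hk⟩, hj⟩⟩
  have hrk : ∀ τ : Perm (Fin q), rk (pinj (.ofSet B) * bar n τ) = q - 1 := fun τ => by
    rw [rk_eq_ncard, hdom, hB]
  refine collapses_of_not_sameBot (con_mul_left ξ (pinj (.ofSet B)) h) (hrk σ) (hrk 1).le
    (by omega) fun hs => ?_
  have h3 : Fin.castLE hq (σ i) ∈ dom (pbFlip (pinj (.ofSet B) * idem n q)) := by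
    rw [mem_dom_flip]
    refine ⟨Fin.castLE hq (σ i), (UL_pinj_mul _ _ _ _).2 ⟨_, ⟨rfl, ⟨(σ i).2, ?_⟩⟩,
      UL_idem.2 ⟨rfl, (σ i).2⟩⟩⟩
    exact fun e => hi (Fin.castLE_injective hq e)
  rw [← hs.2, mem_dom_flip] at h3
  obtain ⟨k, hk⟩ := h3
  obtain ⟨l, ⟨rfl, hkB⟩, hl⟩ := (UL_pinj_mul _ _ _ _).1 hk
  obtain ⟨m, hm, hm'⟩ := (UL_bar _ _ _).1 hl
  have : m = i := σ.injective (Fin.ext hm'.symm)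
  subst this
  exact hkB.2 (Fin.ext hm)

/-- The permutations `σ` such that `bar n σ` is related to the identity of its group. -/
def permSubgroup (ξ : Con (PB n)) {q : ℕ} (hq : q ≤ n) : Subgroup (Perm (Fin q)) where
  carrier := {σ | ξ (bar n σ) (idem n q)}
  one_mem' := ξ.refl _
  mul_mem' {σ τ} hσ hτ := by
    have := ξ.mul hτ hσ
    rwa [bar_mul_bar hq, idem_mul_bar hq] at this
  inv_mem' {σ} hσ := by
    have := con_mul_right ξ (bar n σ⁻¹) hσ
    rw [bar_mul_bar hq, inv_mul_cancel, idem_mul_bar hq] at this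
    exact ξ.symm this

theorem mem_permSubgroup {ξ : Con (PB n)} {q : ℕ} {hq : q ≤ n} {σ : Perm (Fin q)} :
    σ ∈ permSubgroup ξ hq ↔ ξ (bar n σ) (idem n q) := Iff.rfl

theorem permSubgroup_normal (ξ : Con (PB n)) {q : ℕ} (hq : q ≤ n) :
    (permSubgroup ξ hq).Normal := ⟨fun σ hσ τ => by
  have := con_mul_left ξ (bar n τ⁻¹) (con_mul_right ξ (bar n τ) hσ)
  rw [idem_mul_bar hq, bar_mul_bar hq, bar_mul_bar hq, bar_mul_bar hq, mul_inv_cancel] at this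
  exact this⟩

theorem rel_bar_iff {ξ : Con (PB n)} {q : ℕ} (hq : q ≤ n) {σ τ : Perm (Fin q)} :
    ξ (bar n σ) (bar n τ) ↔ σ * τ⁻¹ ∈ permSubgroup ξ hq := by
  rw [mem_permSubgroup]
  constructor
  · intro h
    have := con_mul_left ξ (bar n τ⁻¹) h
    rwa [bar_mul_bar hq, bar_mul_bar hq, mul_inv_cancel] at this
  · intro h
    have := con_mul_left ξ (bar n τ) h
    rwa [bar_mul_bar hq, bar_mul_bar hq, inv_mul_cancel_right, one_mul] at this

end Generation

/-! ### Congruences described by two flags, a rank and a normal subgroup -/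

section Classification

variable {n : ℕ}

/-! ### The relations `nu` -/

section Nu

variable {q : ℕ} {N : Subgroup (Perm (Fin q))}

theorem nu_barSet {x y : PB n} : nu (barSet n N) x y ↔ ∃ s t : PB n, ∃ σ ∈ N, ∃ τ ∈ N,
    x = s * bar n σ * t ∧ y = s * bar n τ * t ∧ rk x = rk (bar n σ) ∧ rk y = rk (bar n τ) := by
  simp only [nu, greenJ_iff_rk]
  constructor
  · rintro ⟨s, t, _, ⟨σ, hσ, rfl⟩, _, ⟨τ, hτ, rfl⟩, h⟩
    exact ⟨s, t, σ, hσ, τ, hτ, h⟩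
  · rintro ⟨s, t, σ, hσ, τ, hτ, h⟩
    exact ⟨s, t, _, ⟨σ, hσ, rfl⟩, _, ⟨τ, hτ, rfl⟩, h⟩

theorem nu_symm {N : Set (PB n)} {x y : PB n} (h : nu N x y) : nu N y x := by
  obtain ⟨s, t, a, ha, b, hb, h1, h2, h3, h4⟩ := h
  exact ⟨s, t, b, hb, a, ha, h2, h1, h4, h3⟩

theorem eq_of_nu_bot {x y : PB n} (h : nu (barSet n (⊥ : Subgroup (Perm (Fin q)))) x y) :
    x = y := by
  obtain ⟨s, t, σ, hσ, τ, hτ, rfl, rfl, -⟩ := nu_barSet.1 h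
  rw [Subgroup.mem_bot.1 hσ, Subgroup.mem_bot.1 hτ]

theorem rk_of_nu (hq : q ≤ n) {x y : PB n} (h : nu (barSet n N) x y) : rk x = q ∧ rk y = q := by
  obtain ⟨s, t, σ, hσ, τ, hτ, -, -, h1, h2⟩ := nu_barSet.1 h
  rw [rk_bar hq] at h1 h2
  exact ⟨h1, h2⟩

theorem nu_flip {x y : PB n} (h : nu (barSet n N) x y) :
    nu (barSet n N) (pbFlip x) (pbFlip y) := by
  obtain ⟨s, t, σ, hσ, τ, hτ, h1, h2, h3, h4⟩ := nu_barSet.1 h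
  refine nu_barSet.2 ⟨pbFlip t, pbFlip s, σ⁻¹, inv_mem hσ, τ⁻¹, inv_mem hτ, ?_, ?_, ?_, ?_⟩
  · rw [h1, flip_mul, flip_mul, flip_bar, mul_assoc]
  · rw [h2, flip_mul, flip_mul, flip_bar, mul_assoc]
  · rw [← flip_bar, rk_flip, rk_flip, h3]
  · rw [← flip_bar, rk_flip, rk_flip, h4]

/-- Both elements are right multiples of `s * idem n q` of rank `q`, so by stability they have its
upper row. -/
theorem sameTop_of_nu (hq : q ≤ n) {x y : PB n} (h : nu (barSet n N) x y) : SameTop x y := by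
  obtain ⟨hx, hy⟩ := rk_of_nu hq h
  obtain ⟨s, t, σ, hσ, τ, hτ, h1, h2, -⟩ := nu_barSet.1 h
  have key : ∀ (ρ : Perm (Fin q)) (z : PB n), z = s * bar n ρ * t → rk z = q →
      SameTop z (s * idem n q) := by
    intro ρ z hz hr
    rw [← idem_mul_bar hq ρ, ← mul_assoc, mul_assoc _ _ t] at hz
    subst hz
    refine sameTop_mul_of_rk_eq ?_
    have h3 := rk_mul_le_right s (idem n q)
    have h4 := rk_mul_le_left (s * idem n q) (bar n ρ * t)
    rw [rk_bar hq] at h3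
    omega
  exact (key σ x h1 hx).trans (key τ y h2 hy).symm

theorem sameBot_of_nu (hq : q ≤ n) {x y : PB n} (h : nu (barSet n N) x y) : SameBot x y :=
  sameTop_of_nu hq (nu_flip h)

/-- In coordinates, a pair in `nu` is a pair of permutations in one coset of `N`. The outer factors
`s` and `t` become elements of rank `q` in the local monoid, so they are permutations; the quotient
of the two inner permutations is conjugated by one of them, and normality absorbs this. -/
theorem nu_coord (hN : N.Normal) (hq : q ≤ n) {x y c d : PB n} (h : nu (barSet n N) x y)
    (hc : IsCoord q y c) (hd : IsCoord q (pbFlip y) d) : ∃ σ τ : Perm (Fin q), σ * τ⁻¹ ∈ N ∧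
      pbFlip c * x * d = bar n σ ∧ pbFlip c * y * d = bar n τ ∧
      x = c * bar n σ * pbFlip d ∧ y = c * bar n τ * pbFlip d := by
  obtain ⟨hx, hy⟩ := rk_of_nu hq h
  obtain ⟨σ, h1, h2⟩ := coord_eq_bar hy hc hd (sameTop_of_nu hq h).symm (sameBot_of_nu hq h).symm
  obtain ⟨τ, h3, h4⟩ := coord_eq_bar hy hc hd (SameTop.refl y) (SameBot.refl y)
  refine ⟨σ, τ, ?_, h1, h3, h2, h4⟩
  obtain ⟨s, t, a, ha, b, hb, h5, h6, -⟩ := nu_barSet.1 h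
  -- The idempotent is inserted on both sides of `bar n ρ` so that the outer factors fall into the
  -- local monoid.
  have e : ∀ ρ : Perm (Fin q), pbFlip c * (s * bar n ρ * t) * d =
      (pbFlip c * s * idem n q) * bar n ρ * (idem n q * t * d) := by
    intro ρ
    calc _ = pbFlip c * (s * (idem n q * bar n ρ * idem n q) * t) * d := by
          rw [idem_mul_bar hq, bar_mul_idem hq]
      _ = _ := by simp only [mul_assoc]
  rw [h5, e] at h1
  rw [h6, e] at h3
  have hrg : rk (pbFlip c * s * idem n q) = q := by
    have h7 := rk_mul_le_left (pbFlip c * s * idem n q) (bar n a * (idem n q * t * d))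
    rw [← mul_assoc, h1, rk_bar hq] at h7
    have h8 := rk_mul_le_right (pbFlip c * s) (idem n q)
    rw [rk_bar hq] at h8
    omega
  have hrh : rk (idem n q * t * d) = q := by
    have h7 := rk_mul_le_right (pbFlip c * s * idem n q * bar n a) (idem n q * t * d)
    rw [h1, rk_bar hq] at h7
    have h8 := rk_mul₃_le 1 (idem n q) (t * d)
    rw [one_mul, ← mul_assoc, rk_bar hq] at h8
    omega
  have hEE : idem n q * idem n q = idem n q := idem_mul_bar hq 1
  obtain ⟨g, hg⟩ := exists_bar_eq hq hrg (by
    simp only [← mul_assoc]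
    rw [hc.idem_mul_flip, mul_assoc _ (idem n q) (idem n q), hEE])
  obtain ⟨k, hk⟩ := exists_bar_eq hq hrh (by
    simp only [← mul_assoc]
    rw [hEE, mul_assoc, hd.mul_idem])
  rw [hg, hk, bar_mul_bar hq, bar_mul_bar hq] at h1 h3
  rw [← bar_injective hq h1, ← bar_injective hq h3]
  have := hN.conj_mem _ (mul_mem ha (inv_mem hb)) k
  convert this using 1
  group

theorem nu_of_coord (hq : q ≤ n) {c d : PB n} {σ τ : Perm (Fin q)} (h : σ * τ⁻¹ ∈ N)
    (hx : rk (c * bar n σ * d) = q) (hy : rk (c * bar n τ * d) = q) :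
    nu (barSet n N) (c * bar n σ * d) (c * bar n τ * d) := by
  refine nu_barSet.2 ⟨c * bar n τ, d, σ * τ⁻¹, h, 1, one_mem N, ?_, ?_, ?_, ?_⟩
  · rw [mul_assoc c (bar n τ), bar_mul_bar hq, inv_mul_cancel_right]
  · rw [mul_assoc c (bar n τ) (bar n 1), bar_mul_idem hq]
  · rw [hx, rk_bar hq]
  · rw [hy, rk_bar hq]

/-- Both pairs are read in the coordinates of the middle element, where transitivity is that of
cosets. -/
theorem nu_trans (hN : N.Normal) (hq : q ≤ n) {x y z : PB n} (h : nu (barSet n N) x y)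
    (h' : nu (barSet n N) y z) : nu (barSet n N) x z := by
  obtain ⟨hx, hy⟩ := rk_of_nu hq h
  obtain ⟨-, hz⟩ := rk_of_nu hq h'
  obtain ⟨c, hc⟩ := exists_isCoord hy
  obtain ⟨d, hd⟩ := exists_isCoord (α := pbFlip y) (by rw [rk_flip, hy])
  obtain ⟨σ, τ, h1, -, h2, h3, -⟩ := nu_coord hN hq h hc hd
  obtain ⟨ρ, τ', h4, -, h5, h6, -⟩ := nu_coord hN hq (nu_symm h') hc hd
  obtain rfl : τ = τ' := bar_injective hq (h2.symm.trans h5)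
  have h7 : σ * ρ⁻¹ ∈ N := by
    have := mul_mem h1 (inv_mem h4)
    convert this using 1
    group
  subst h3
  subst h6
  exact nu_of_coord hq h7 hx hz

theorem isCoord_idem (hq : q ≤ n) : IsCoord q (idem n q) (idem n q) := by
  have hEE : idem n q * idem n q = idem n q := idem_mul_bar hq 1
  exact ⟨by rw [flip_idem, hEE, hEE], by rw [flip_idem, hEE], by rw [flip_idem]⟩

theorem nu_bar_idem_iff (hN : N.Normal) (hq : q ≤ n) {σ : Perm (Fin q)} :
    nu (barSet n N) (bar n σ) (idem n q) ↔ σ ∈ N := by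
  constructor
  · intro h
    obtain ⟨ρ, τ, h1, h2, h3, -⟩ := nu_coord hN hq h (isCoord_idem hq)
      (by rw [flip_idem]; exact isCoord_idem hq)
    rw [flip_idem, idem_mul_bar hq, bar_mul_idem hq] at h2 h3
    rw [← bar_injective hq h2, ← bar_injective hq h3] at h1
    simpa using h1
  · intro h
    have := nu_of_coord (N := N) (c := 1) (d := 1) (σ := σ) (τ := 1) hq (by simpa using h)
      (by rw [one_mul, mul_one, rk_bar hq]) (by rw [one_mul, mul_one, rk_bar hq])
    simpa using this

end Nu

/-! ### The congruences in uniform notation -/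

/-- The relation with data `(A, B, q, N)`: equality, the relation `nu` of `N` in rank `q`, and,
below rank `q`, all pairs with the same upper blocks (unless `A`) and lower blocks (unless `B`). -/
def levelRel (A B : Prop) (q : ℕ) (N : Subgroup (Perm (Fin q))) (x y : PB n) : Prop :=
  x = y ∨ nu (barSet n N) x y ∨ (rk x < q ∧ rk y < q ∧ (A ∨ ∀ i j, UU x i j ↔ UU y i j) ∧
    (B ∨ ∀ i j, LL x i j ↔ LL y i j))

/-- The data for which `levelRel` is a congruence. -/
structure IsLevel (n : ℕ) (A B : Prop) (q : ℕ) (N : Subgroup (Perm (Fin q))) : Prop where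
  pos : 1 ≤ q
  -- The value `n + 1` is needed for the universal congruence, in which all ranks lie below the
  -- level. No elements of rank `n + 1` exist, and `N` is then required to be trivial.
  le : q ≤ n + 1
  normal : N.Normal
  eq_bot : n < q → N = ⊥
  full : 3 ≤ q → A ∧ B

section Level

variable {A B : Prop} {q : ℕ} {N : Subgroup (Perm (Fin q))}

theorem IsLevel.symm (h : IsLevel n A B q N) : IsLevel n B A q N :=
  ⟨h.pos, h.le, h.normal, h.eq_bot, fun h' => (h.full h').symm⟩

theorem IsLevel.of_nu (h : IsLevel n A B q N) {x y : PB n} (hxy : nu (barSet n N) x y) :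
    x = y ∨ q ≤ n := by
  by_cases hq : q ≤ n
  · exact Or.inr hq
  · have hb := h.eq_bot (by omega)
    subst hb
    exact Or.inl (eq_of_nu_bot hxy)

theorem levelRel_flip {x y : PB n} (h : levelRel A B q N x y) :
    levelRel B A q N (pbFlip x) (pbFlip y) := by
  rcases h with rfl | h | ⟨h1, h2, h3, h4⟩
  · exact Or.inl rfl
  · exact Or.inr (Or.inl (nu_flip h))
  · exact Or.inr (Or.inr ⟨by rwa [rk_flip], by rwa [rk_flip], h4, h3⟩)

theorem levelRel_symm {x y : PB n} (h : levelRel A B q N x y) : levelRel A B q N y x := by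
  rcases h with rfl | h | ⟨h1, h2, h3, h4⟩
  · exact Or.inl rfl
  · exact Or.inr (Or.inl (nu_symm h))
  · exact Or.inr (Or.inr ⟨h2, h1, h3.imp_right fun h i j => (h i j).symm,
      h4.imp_right fun h i j => (h i j).symm⟩)

/-- The part given by `nu` lives in rank exactly `q` and the remaining part strictly below, so the
mixed cases cannot occur. -/
theorem levelRel_trans (hl : IsLevel n A B q N) {x y z : PB n} (h : levelRel A B q N x y)
    (h' : levelRel A B q N y z) : levelRel A B q N x z := by
  rcases h with rfl | h | h
  · exact h'
  · rcases hl.of_nu h with rfl | hq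
    · exact h'
    rcases h' with rfl | h' | h'
    · exact Or.inr (Or.inl h)
    · exact Or.inr (Or.inl (nu_trans hl.normal hq h h'))
    · have := (rk_of_nu hq h).2
      have := h'.1
      omega
  · rcases h' with rfl | h' | h'
    · exact Or.inr (Or.inr h)
    · rcases hl.of_nu h' with rfl | hq
      · exact Or.inr (Or.inr h)
      have := (rk_of_nu hq h').1
      have := h.2.1
      omega
    · refine Or.inr (Or.inr ⟨h.1, h'.2.1, ?_, ?_⟩)
      · rcases h.2.2.1 with h1 | h1
        · exact Or.inl h1
        · exact h'.2.2.1.imp_right fun h2 i j => (h1 i j).trans (h2 i j)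
      · rcases h.2.2.2 with h1 | h1
        · exact Or.inl h1
        · exact h'.2.2.2.imp_right fun h2 i j => (h1 i j).trans (h2 i j)

/-- Permutations of at most two points act trivially on the minimal ideal. -/
theorem mul_bar_of_le_two (hq : q ≤ 2) (hqn : q ≤ n) {z : PB n} (hz : rk z = 0)
    (σ : Perm (Fin q)) : z * bar n σ = z * idem n q := by
  have key : ∀ (z : PB n) (σ : Perm (Fin q)) (i j : Fin n), LL (z * bar n σ) i j →
      LL (z * idem n q) i j := by
    intro z σ i j h
    by_cases hij : i = j
    · rw [hij]; exact LL_refl _ _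
    rw [bar_eq_pinj, LL_mul_pinj] at h
    obtain h | ⟨k, l, ⟨a, ha, ha'⟩, ⟨b, hb, hb'⟩, h⟩ := h
    · exact absurd h hij
    rw [idem, bar_eq_pinj, LL_mul_pinj]
    right
    have hab : σ a ≠ σ b := fun e => hij (Fin.ext (by omega))
    have hab' : a ≠ b := fun e => hab (e ▸ rfl)
    have hne : (a : ℕ) ≠ b := fun e => hab' (Fin.ext e)
    have hne' : (σ a : ℕ) ≠ σ b := fun e => hab (Fin.ext e)
    have ha2 := a.2
    have hb2 := b.2
    have hc2 := (σ a).2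
    have hd2 := (σ b).2
    -- There are at most two points, so `σ` either fixes both `a` and `b` or exchanges them; in both
    -- cases a hook on them is preserved.
    by_cases hc : (σ a : ℕ) = a
    · obtain rfl : k = i := Fin.ext (by omega)
      obtain rfl : l = j := Fin.ext (by omega)
      exact ⟨k, l, ⟨a, ha, ha⟩, ⟨b, hb, hb⟩, h⟩
    · obtain rfl : l = i := Fin.ext (by omega)
      obtain rfl : k = j := Fin.ext (by omega)
      exact ⟨l, k, ⟨b, hb, hb⟩, ⟨a, ha, ha⟩, LL_symm h⟩
  refine ext_of_rk_zero (rk_mul_left_zero hz _) (rk_mul_left_zero hz _) (fun i j => ?_)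
    fun i j => ⟨key z σ i j, fun h => ?_⟩
  · rw [UU_mul_iff (by omega), UU_mul_iff (by omega)]
  · have h1 : z * idem n q = z * bar n σ * bar n σ⁻¹ := by
      rw [mul_assoc, bar_mul_bar hqn, inv_mul_cancel]
    rw [h1] at h
    have h2 := key _ _ _ _ h
    rwa [mul_assoc, bar_mul_idem hqn] at h2

theorem mul_eq_mul_of_nu (hq : q ≤ 2) (hqn : q ≤ n) {x y : PB n} (h : nu (barSet n N) x y)
    {z : PB n} (hz : rk z = 0) : z * x = z * y := by
  obtain ⟨s, t, σ, hσ, τ, hτ, rfl, rfl, -⟩ := nu_barSet.1 h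
  have h1 : rk (z * s) = 0 := rk_mul_left_zero hz _
  simp only [← mul_assoc]
  rw [mul_bar_of_le_two hq hqn h1 σ, mul_bar_of_le_two hq hqn h1 τ]

theorem mul_eq_mul_of_nu' (hq : q ≤ 2) (hqn : q ≤ n) {x y : PB n} (h : nu (barSet n N) x y)
    {z : PB n} (hz : rk z = 0) : x * z = y * z := by
  apply flip_injective
  rw [flip_mul, flip_mul]
  exact mul_eq_mul_of_nu hq hqn (nu_flip h) (by rwa [rk_flip])

/-- The critical case is a pair in `nu` whose rank drops. For `q ≥ 3` both flags are set and nothing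
remains to be shown. For `q ≤ 2` the products have rank at most one, so their rows can be read off
after multiplication by an element of rank zero, and such an element does not see the difference
between the two permutations. -/
theorem levelRel_mul_left (hl : IsLevel n A B q N) (u : PB n) {x y : PB n}
    (h : levelRel A B q N x y) : levelRel A B q N (u * x) (u * y) := by
  rcases h with rfl | h | ⟨h1, h2, h3, h4⟩
  · exact Or.inl rfl
  · rcases hl.of_nu h with rfl | hq
    · exact Or.inl rfl
    obtain ⟨hx, hy⟩ := rk_of_nu hq h
    -- The factors `x` and `y` are right multiples of each other, hence so are the products.
    have hr : rk (u * x) = rk (u * y) := by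
      have h5 : GreenL x y := greenL_iff_sameBot.2 (sameBot_of_nu hq h)
      obtain ⟨⟨s, hs⟩, -⟩ := greenL_iff.1 h5
      have h6 : GreenR x y := greenR_iff_sameTop.2 (sameTop_of_nu hq h)
      obtain ⟨⟨t, ht⟩, ⟨t', ht'⟩⟩ := greenR_iff.1 h6
      apply le_antisymm
      · conv_lhs => rw [ht, ← mul_assoc]
        exact rk_mul_le_left _ _
      · conv_lhs => rw [ht', ← mul_assoc]
        exact rk_mul_le_left _ _
    rcases (rk_mul_le_right u x).lt_or_eq with h5 | h5
    · refine Or.inr (Or.inr ⟨by omega, by omega, ?_, ?_⟩)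
      · by_cases hq3 : 3 ≤ q
        · exact Or.inl (hl.full hq3).1
        · right
          intro i j
          rw [← UU_mul_iff (α := u * x) (by omega) (om n), ← UU_mul_iff (α := u * y) (by omega)
            (om n), mul_assoc, mul_assoc, mul_eq_mul_of_nu' (by omega) hq h rk_om]
      · by_cases hq3 : 3 ≤ q
        · exact Or.inl (hl.full hq3).2
        · right
          intro i j
          rw [← LL_mul_iff (β := u * x) (by omega) (om n), ← LL_mul_iff (β := u * y) (by omega)
            (om n), ← mul_assoc, ← mul_assoc, mul_eq_mul_of_nu (by omega) hq h
            (rk_mul_left_zero rk_om u)]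
    · right; left
      obtain ⟨s, t, σ, hσ, τ, hτ, h6, h7, h8, h9⟩ := nu_barSet.1 h
      refine nu_barSet.2 ⟨u * s, t, σ, hσ, τ, hτ, ?_, ?_, by omega, by omega⟩
      · rw [h6]; simp only [mul_assoc]
      · rw [h7]; simp only [mul_assoc]
  · have h5 := rk_mul_le_right u x
    have h6 := rk_mul_le_right u y
    refine Or.inr (Or.inr ⟨by omega, by omega, ?_, ?_⟩)
    · by_cases hq3 : 3 ≤ q
      · exact Or.inl (hl.full hq3).1
      · refine h3.imp_right fun h3 i j => ?_
        rw [← UU_mul_iff (α := u * x) (by omega) (om n), ← UU_mul_iff (α := u * y) (by omega)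
          (om n), mul_assoc, mul_assoc, mul_om_congr (by omega) (by omega) h3]
    · by_cases hq3 : 3 ≤ q
      · exact Or.inl (hl.full hq3).2
      · refine h4.imp_right fun h4 i j => ?_
        rw [LL_mul_iff (by omega), LL_mul_iff (by omega), h4]

theorem levelRel_mul_right (hl : IsLevel n A B q N) (u : PB n) {x y : PB n}
    (h : levelRel A B q N x y) : levelRel A B q N (x * u) (y * u) := by
  have := levelRel_flip (levelRel_mul_left hl.symm (pbFlip u) (levelRel_flip h))
  rwa [flip_mul, flip_mul, flip_flip, flip_flip, flip_flip] at this

/-- The congruence with given data. -/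
def levelCon (hl : IsLevel n A B q N) : Con (PB n) where
  r := levelRel A B q N
  iseqv := ⟨fun _ => Or.inl rfl, levelRel_symm, levelRel_trans hl⟩
  mul' {_ x _ _} h h' :=
    levelRel_trans hl (levelRel_mul_right hl _ h) (levelRel_mul_left hl x h')

theorem levelCon_apply {hl : IsLevel n A B q N} {x y : PB n} :
    levelCon hl x y ↔ levelRel A B q N x y := Iff.rfl

/-! ### Comparison of the congruences -/

theorem levelRel_mono {A' B' : Prop} {q' : ℕ} {N' : Subgroup (Perm (Fin q'))}
    (hl : IsLevel n A B q N) (hl' : IsLevel n A' B' q' N') (hA : A → A') (hB : B → B')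
    (hq : q < q' ∨ ∃ h : q = q', h ▸ N ≤ N') {x y : PB n} (h : levelRel A B q N x y) :
    levelRel A' B' q' N' x y := by
  rcases h with rfl | h | ⟨h1, h2, h3, h4⟩
  · exact Or.inl rfl
  · rcases hq with hq | ⟨rfl, hN⟩
    · rcases hl.of_nu h with rfl | hqn
      · exact Or.inl rfl
      obtain ⟨hx, hy⟩ := rk_of_nu hqn h
      have hpos := hl.pos
      by_cases hq3 : 3 ≤ q'
      · exact Or.inr (Or.inr ⟨by omega, by omega, Or.inl (hl'.full hq3).1,
          Or.inl (hl'.full hq3).2⟩)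
      -- With `q < q' ≤ 2` the smaller level is one, and the symmetric group of degree one is
      -- trivial.
      · obtain rfl : q = 1 := by omega
        have : N = ⊥ := Subsingleton.elim _ _
        subst this
        exact Or.inl (eq_of_nu_bot h)
    · right; left
      obtain ⟨s, t, σ, hσ, τ, hτ, h⟩ := nu_barSet.1 h
      exact nu_barSet.2 ⟨s, t, σ, hN hσ, τ, hN hτ, h⟩
  · have hqq : q ≤ q' := by
      rcases hq with hq | ⟨hq, -⟩ <;> omega
    exact Or.inr (Or.inr ⟨by omega, by omega, h3.imp_left hA, h4.imp_left hB⟩)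

/-- A pair of elements of rank zero with the same lower blocks but different upper blocks. -/
theorem exists_upper_pair (hn : 2 ≤ n) : ∃ x y : PB n, rk x = 0 ∧ rk y = 0 ∧
    (∀ i j, LL x i j ↔ LL y i j) ∧ ¬ ∀ i j, (UU x i j ↔ UU y i j) := by
  let a : Fin n := ⟨0, by omega⟩
  let b : Fin n := ⟨1, by omega⟩
  refine ⟨hook a b * om n, om n, rk_mul_right_zero rk_om _, rk_om, fun i j => ?_, fun h => ?_⟩
  · rw [LL_mul_iff (by rw [rk_om]; omega)]
  · have h1 : UU (om n) a b :=
      (h a b).1 (UU_mul_of_UU _ (UU_hook.2 (Or.inr (Or.inl ⟨rfl, rfl⟩))))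
    rw [UU_bar] at h1
    simp [a, b] at h1

theorem levelRel_upper (hl : IsLevel n A B q N) {x y : PB n} (hx : rk x = 0)
    (h : levelRel A B q N x y) (hne : ¬ ∀ i j, (UU x i j ↔ UU y i j)) : A := by
  rcases h with rfl | h | h
  · exact absurd (fun _ _ => Iff.rfl) hne
  · rcases hl.of_nu h with rfl | hq
    · exact absurd (fun _ _ => Iff.rfl) hne
    have := (rk_of_nu hq h).1
    have := hl.pos
    omega
  · exact h.2.2.1.resolve_right hne

theorem upper_of_le (hn : 2 ≤ n) {A' B' : Prop} {q' : ℕ} {N' : Subgroup (Perm (Fin q'))}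
    (hl : IsLevel n A B q N) (hl' : IsLevel n A' B' q' N')
    (h : ∀ x y : PB n, levelRel A B q N x y → levelRel A' B' q' N' x y) (hA : A) : A' := by
  obtain ⟨x, y, hx, hy, hL, hU⟩ := exists_upper_pair hn
  have hpos := hl.pos
  exact levelRel_upper hl' hx
    (h x y (Or.inr (Or.inr ⟨by omega, by omega, Or.inl hA, Or.inr hL⟩))) hU

theorem not_levelRel_idem {p : ℕ} (hp : 1 ≤ p) (hqp : q ≤ p) (hpn : p ≤ n)
    (hl : IsLevel n A B q N) : ¬ levelRel A B q N (idem n p) (om n) := by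
  have hrp : rk (idem n p) = p := rk_bar hpn 1
  have hne : idem n p ≠ om n := fun e => by
    rw [e, rk_om] at hrp
    omega
  rintro (h | h | h)
  · exact hne h
  · rcases hl.of_nu h with h | hq
    · exact hne h
    have := (rk_of_nu hq h).2
    have := rk_om (n := n)
    have := hl.pos
    omega
  · have := h.1
    omega

/-- Each datum has its test pairs: pairs of rank zero that agree in one row for the flags, pairs
`(bar n σ, idem n q)` for the subgroup, and `(idem n q', om n)` to exclude `q' < q`. -/
theorem levelRel_le_iff (hn : 2 ≤ n) {A' B' : Prop} {q' : ℕ} {N' : Subgroup (Perm (Fin q'))}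
    (hl : IsLevel n A B q N) (hl' : IsLevel n A' B' q' N') :
    (∀ x y : PB n, levelRel A B q N x y → levelRel A' B' q' N' x y) ↔
      (A → A') ∧ (B → B') ∧ (q < q' ∨ ∃ h : q = q', h ▸ N ≤ N') := by
  refine ⟨fun h => ⟨upper_of_le hn hl hl' h, upper_of_le hn hl.symm hl'.symm fun x y hxy => ?_, ?_⟩,
    fun h x y => levelRel_mono hl hl' h.1 h.2.1 h.2.2⟩
  · have := levelRel_flip (h _ _ (levelRel_flip hxy))
    rwa [flip_flip, flip_flip] at this
  · rcases lt_trichotomy q q' with hq | rfl | hq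
    · exact Or.inl hq
    · refine Or.inr ⟨rfl, fun σ hσ => ?_⟩
      by_cases hqn : q ≤ n
      · rcases h _ _ (Or.inr (Or.inl ((nu_bar_idem_iff hl.normal hqn).2 hσ))) with h1 | h1 | h1
        · rw [bar_injective hqn h1]
          exact one_mem _
        · exact (nu_bar_idem_iff hl'.normal hqn).1 h1
        · have := h1.1
          rw [rk_bar hqn] at this
          omega
      · have hb := hl.eq_bot (by omega)
        subst hb
        rw [Subgroup.mem_bot.1 hσ]
        exact one_mem _
    · exfalso
      have hle := hl.le
      have hpos := hl'.pos
      -- All hooks are absent from both `idem n q'` and `om n`, so they are related below level `q`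
      -- whatever the flags.
      refine not_levelRel_idem hl'.pos le_rfl (by omega) hl' (h _ _ (Or.inr (Or.inr
        ⟨?_, ?_, Or.inr ?_, Or.inr ?_⟩)))
      · rw [rk_bar (by omega)]; exact hq
      · rw [rk_om]; omega
      · simp
      · simp

/-! ### Every congruence has data -/

/-- If the rows differ, the rank of `x` collapses when it is positive, so it lies below `q`. If they
agree, `x` and `y` differ by a permutation in coordinates: in rank `q` it lies in `N`, and in a
higher rank it must be trivial, since otherwise a rank not below `q` would collapse. -/
theorem rel_levelRel_of_rel {ξ : Con (PB n)} (hl : IsLevel n (HasUpper ξ) (HasLower ξ) q N)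
    (hN : ∀ h : q ≤ n, N = permSubgroup ξ h)
    (hc : ∀ r, 1 ≤ r → r ≤ n → Collapses ξ r → r < q) {x y : PB n} (h : ξ x y)
    (hr : rk y ≤ rk x) : levelRel (HasUpper ξ) (HasLower ξ) q N x y := by
  have hpos := hl.pos
  by_cases hs : SameTop x y ∧ SameBot x y
  · rcases lt_trichotomy (rk x) q with hq | hq | hq
    · exact Or.inr (Or.inr ⟨hq, by omega, Or.inr hs.1.1, Or.inr hs.2.1⟩)
    · have hqn : q ≤ n := hq ▸ rk_le x
      obtain ⟨c, d, σ, h1, h2, h3, h4⟩ := exists_coord_eq hq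
      obtain ⟨τ, h5, h6⟩ := coord_eq_bar hq h1 h2 hs.1 hs.2
      have h7 := con_mul_right ξ d (con_mul_left ξ (pbFlip c) h)
      rw [h3, h5, rel_bar_iff hqn, ← hN hqn] at h7
      have hy : rk y = q := by rw [← hs.1.rk_eq, hq]
      right; left
      subst h4
      subst h6
      exact nu_of_coord hqn h7 hq hy
    · left
      obtain ⟨c, d, σ, h1, h2, h3, h4⟩ := exists_coord_eq (x := x) rfl
      obtain ⟨τ, h5, h6⟩ := coord_eq_bar rfl h1 h2 hs.1 hs.2
      have h7 := con_mul_right ξ d (con_mul_left ξ (pbFlip c) h)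
      rw [h3, h5, rel_bar_iff (rk_le x)] at h7
      by_contra hne
      have h8 : σ * τ⁻¹ ≠ 1 := fun e => hne (by
        rw [h4, h6, mul_inv_eq_one.1 e])
      have h9 := collapses_of_bar (rk_le x) (by omega) h8 h7
      have := hc _ (by omega) (by have := rk_le x; omega) h9
      omega
  · have hlt : rk x < q := by
      rcases Nat.eq_zero_or_pos (rk x) with h0 | h0
      · omega
      · refine hc _ h0 (rk_le x) ?_
        rw [not_and_or] at hs
        rcases hs with hs | hs
        · exact collapses_of_not_sameTop h rfl hr h0 hs
        · exact collapses_of_not_sameBot h rfl hr h0 hs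
    refine Or.inr (Or.inr ⟨hlt, by omega, ?_, ?_⟩)
    · by_cases hq3 : 3 ≤ q
      · exact Or.inl (hl.full hq3).1
      · by_cases hU : ∀ i j, (UU x i j ↔ UU y i j)
        · exact Or.inr hU
        · exact Or.inl ⟨x, y, h, by omega, by omega, hU⟩
    · by_cases hq3 : 3 ≤ q
      · exact Or.inl (hl.full hq3).2
      · by_cases hL : ∀ i j, (LL x i j ↔ LL y i j)
        · exact Or.inr hL
        · exact Or.inl ⟨x, y, h, by omega, by omega, hL⟩

/-- For `q ≥ 3` the collapse of rank `q - 1 ≥ 2` relates everything below the level. For `q ≤ 2`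
both elements are moved to the minimal ideal by `x ↦ x * om n * x`, and `x * om n * y` connects
their images: one step changes only lower blocks, the other only upper blocks. -/
theorem rel_of_levelRel {ξ : Con (PB n)} (hl : IsLevel n (HasUpper ξ) (HasLower ξ) q N)
    (hN : ∀ h : q ≤ n, N = permSubgroup ξ h)
    (hc : ∀ r, 1 ≤ r → r < q → Collapses ξ r) {x y : PB n}
    (h : levelRel (HasUpper ξ) (HasLower ξ) q N x y) : ξ x y := by
  rcases h with rfl | h | ⟨h1, h2, h3, h4⟩
  · exact ξ.refl _
  · rcases hl.of_nu h with rfl | hq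
    · exact ξ.refl _
    obtain ⟨s, t, σ, hσ, τ, hτ, rfl, rfl, -⟩ := nu_barSet.1 h
    refine con_mul_right ξ t (con_mul_left ξ s ?_)
    rw [rel_bar_iff hq, ← hN hq]
    exact mul_mem hσ (inv_mem hτ)
  · by_cases hq3 : 3 ≤ q
    · have hle := hl.le
      exact (hc (q - 1) (by omega) (by omega)).rel (by omega) (by omega) (by omega) (by omega)
    have key : ∀ z : PB n, rk z < q → ξ z (z * om n * z) := by
      intro z hz
      rcases Nat.eq_zero_or_pos (rk z) with h0 | h0
      · rw [mul_mul_self_of_rk_zero h0]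
        exact ξ.refl _
      · exact (hc 1 le_rfl (by omega)).rel_retract (by omega)
    have hz : ∀ z w : PB n, rk (z * om n * w) = 0 := fun z w =>
      rk_mul_left_zero (rk_mul_right_zero rk_om _) _
    have hU : ∀ z w : PB n, rk z < q → ∀ i j, UU (z * om n * w) i j ↔ UU z i j := by
      intro z w hz i j
      rw [mul_assoc, UU_mul_iff (by omega)]
    have hL : ∀ z w : PB n, rk w < q → ∀ i j, LL (z * om n * w) i j ↔ LL w i j := by
      intro z w hz i j
      rw [LL_mul_iff (by omega)]
    refine ξ.trans (key x h1) (ξ.trans (y := x * om n * y) ?_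
      (ξ.trans (y := y * om n * y) ?_ (ξ.symm (key y h2))))
    · rcases h4 with h4 | h4
      · exact h4.rel (hz _ _) (hz _ _) fun i j => by rw [hU _ _ h1, hU _ _ h1]
      · rw [mul_assoc, mul_assoc, om_mul_congr (by omega) (by omega) h4]
        exact ξ.refl _
    · rcases h3 with h3 | h3
      · exact h3.rel (hz _ _) (hz _ _) fun i j => by rw [hL _ _ h2, hL _ _ h2]
      · rw [mul_om_congr (by omega) (by omega) h3]
        exact ξ.refl _

end Level

/-- Every congruence of the partial Brauer monoid is one of the listed relations. -/
theorem exists_level (ξ : Con (PB n)) : ∃ (A B : Prop) (q : ℕ) (N : Subgroup (Perm (Fin q)))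
    (hl : IsLevel n A B q N), ξ = levelCon hl := by
  classical
  -- The greatest collapsing rank, or zero if no positive rank collapses; the level is `q₀ + 1`.
  let q₀ := Nat.findGreatest (fun r => r = 0 ∨ Collapses ξ r) n
  have hq₀ : q₀ ≤ n := Nat.findGreatest_le n
  have hspec : q₀ = 0 ∨ Collapses ξ q₀ :=
    Nat.findGreatest_spec (P := fun r => r = 0 ∨ Collapses ξ r) (Nat.zero_le n) (Or.inl rfl)
  have hc1 : ∀ r, 1 ≤ r → r ≤ n → Collapses ξ r → r < q₀ + 1 := fun r _ h2 h3 =>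
    Nat.lt_succ_of_le (Nat.le_findGreatest h2 (Or.inr h3))
  have hc2 : ∀ r, 1 ≤ r → r < q₀ + 1 → Collapses ξ r := fun r h1 h2 => by
    rcases hspec with h | h
    · omega
    · exact h.mono (by omega)
  -- If `q₀ = n`, there is no group in rank `q₀ + 1`, and the trivial subgroup is the required
  -- default.
  let N : Subgroup (Perm (Fin (q₀ + 1))) :=
    if h : q₀ + 1 ≤ n then permSubgroup ξ h else ⊥
  have hN : ∀ h : q₀ + 1 ≤ n, N = permSubgroup ξ h := fun h => dif_pos h
  have hl : IsLevel n (HasUpper ξ) (HasLower ξ) (q₀ + 1) N := by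
    refine ⟨by omega, by omega, ?_, fun h => dif_neg (by omega), fun h => ?_⟩
    · by_cases h : q₀ + 1 ≤ n
      · rw [hN h]; exact permSubgroup_normal ξ h
      · have : N = ⊥ := dif_neg h
        rw [this]; infer_instance
    · have := hc2 q₀ (by omega) (by omega)
      exact ⟨this.hasUpper (by omega) hq₀, this.hasLower (by omega) hq₀⟩
  refine ⟨_, _, _, N, hl, Con.ext fun x y => ⟨fun h => ?_, fun h => rel_of_levelRel hl hN hc2 h⟩⟩
  rcases le_total (rk y) (rk x) with hr | hr
  · exact rel_levelRel_of_rel hl hN hc1 h hr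
  · exact levelRel_symm (rel_levelRel_of_rel hl hN hc1 (ξ.symm h) hr)

end Classification

/-! ### Normal subgroups of symmetric groups -/

section Symmetric

open Equiv.Perm

variable {q : ℕ}

/-- All cycles of an element of order three have length three, and four points have room for only
one. -/
theorem isThreeCycle_of_pow_three {ρ : Perm (Fin 4)} (h1 : ρ ≠ 1) (h3 : ρ ^ 3 = 1) :
    ρ.IsThreeCycle := by
  have ho : orderOf ρ = 3 := by
    exact orderOf_eq_prime h3 h1
  obtain ⟨k, hk⟩ := cycleType_prime_order (σ := ρ) (by rw [ho]; exact Nat.prime_three)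
  have hs := ρ.sum_cycleType
  have hc : ρ.support.card ≤ 4 := by simpa using Finset.card_le_univ ρ.support
  rw [hk, ho, Multiset.sum_replicate] at hs
  have hk0 : k = 0 := by
    simp only [smul_eq_mul] at hs
    omega
  rw [IsThreeCycle, hk, ho, hk0]
  rfl

theorem cycleType_eq_two_two {ρ : Perm (Fin 4)} (h2 : ρ * ρ = 1) (hf : ∀ i, ρ i ≠ i) :
    ρ.cycleType = {2, 2} := by
  have h1 : ρ ≠ 1 := fun h => hf 0 (by rw [h]; rfl)
  have ho : orderOf ρ = 2 := orderOf_eq_prime (by rw [pow_two, h2]) h1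
  obtain ⟨k, hk⟩ := cycleType_prime_order (σ := ρ) (by rw [ho]; exact Nat.prime_two)
  have hs := ρ.sum_cycleType
  have hc : ρ.support = Finset.univ := by
    ext i
    simp [hf i]
  rw [hk, ho, Multiset.sum_replicate, hc] at hs
  have hk0 : k = 1 := by
    simp at hs
    omega
  rw [hk, ho, hk0]
  rfl

/-- A normal subgroup that contains `σ` contains these commutators. So in degree four a normal
subgroup not inside the Klein group contains a three-cycle. -/
theorem exists_commutator_three_cycle : ∀ σ : Perm (Fin 4), σ ≠ 1 →
    ¬ (σ * σ = 1 ∧ ∀ i, σ i ≠ i) → ∃ τ : Perm (Fin 4),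
      σ * (τ * σ⁻¹ * τ⁻¹) ≠ 1 ∧ (σ * (τ * σ⁻¹ * τ⁻¹)) ^ 3 = 1 := by
  decide +kernel

theorem klein_mul_mem : ∀ σ τ : Perm (Fin 4), (σ = 1 ∨ (σ * σ = 1 ∧ ∀ i, σ i ≠ i)) →
    (τ = 1 ∨ (τ * τ = 1 ∧ ∀ i, τ i ≠ i)) →
    (σ * τ = 1 ∨ (σ * τ * (σ * τ) = 1 ∧ ∀ i, (σ * τ) i ≠ i)) := by
  decide +kernel

/-- The left side is decidable by enumeration, the right side is invariant under conjugation; both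
forms are needed. -/
theorem mem_klein_iff {σ : Perm (Fin 4)} :
    (σ = 1 ∨ (σ * σ = 1 ∧ ∀ i, σ i ≠ i)) ↔ σ = 1 ∨ σ.cycleType = {2, 2} := by
  refine or_congr Iff.rfl ⟨fun h => cycleType_eq_two_two h.1 h.2, fun h => ⟨?_, fun i hi => ?_⟩⟩
  · have : orderOf σ = 2 := by rw [← lcm_cycleType, h]; rfl
    rw [← pow_two, ← this, pow_orderOf_eq_one]
  · have hs := σ.sum_cycleType
    rw [h] at hs
    have : σ.support = Finset.univ := by
      rw [← Finset.card_eq_iff_eq_univ, ← hs]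
      rfl
    have hi' : i ∈ σ.support := by rw [this]; exact Finset.mem_univ i
    exact mem_support.1 hi' hi

/-- The Klein four-group. -/
def kleinSubgroup : Subgroup (Perm (Fin 4)) where
  carrier := {σ | σ = 1 ∨ (σ * σ = 1 ∧ ∀ i, σ i ≠ i)}
  one_mem' := Or.inl rfl
  mul_mem' {σ τ} hσ hτ := klein_mul_mem σ τ hσ hτ
  inv_mem' {σ} hσ := by
    rcases hσ with rfl | ⟨h1, h2⟩
    · exact Or.inl inv_one
    · have : σ⁻¹ = σ := inv_eq_of_mul_eq_one_left h1
      rw [this]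
      exact Or.inr ⟨h1, h2⟩

theorem isKlein_kleinSubgroup : IsKlein kleinSubgroup := ⟨rfl, fun _ => mem_klein_iff⟩

theorem kleinSubgroup_normal : kleinSubgroup.Normal := ⟨fun σ hσ τ => by
  change _ ∨ _ at hσ
  change _ ∨ _
  rw [mem_klein_iff] at hσ ⊢
  rw [cycleType_conj]
  exact hσ.imp_left fun h => by rw [h, mul_one, mul_inv_cancel]⟩

theorem kleinSubgroup_ne_bot : kleinSubgroup ≠ ⊥ := by
  intro h
  have h1 : (c[0, 1] * c[2, 3] : Perm (Fin 4)) ∈ kleinSubgroup :=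
    Or.inr ⟨by decide, by decide⟩
  rw [h, Subgroup.mem_bot] at h1
  exact absurd h1 (by decide)

/-- All three-cycles are conjugate in the symmetric group, and they generate the alternating group.
-/
theorem alternatingGroup_le_of_three_cycle {N : Subgroup (Perm (Fin q))} (hN : N.Normal)
    {ρ : Perm (Fin q)} (hρ : ρ.IsThreeCycle) (h : ρ ∈ N) : alternatingGroup (Fin q) ≤ N := by
  rw [← closure_three_cycles_eq_alternating, Subgroup.closure_le]
  intro σ hσ
  obtain ⟨τ, rfl⟩ := isConj_iff.1 (isConj_iff_cycleType_eq.2 (hρ.trans hσ.symm))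
  exact hN.conj_mem ρ h τ

theorem eq_alternating_or_top {N : Subgroup (Perm (Fin q))} (h : alternatingGroup (Fin q) ≤ N) :
    N = alternatingGroup (Fin q) ∨ N = ⊤ := by
  by_cases h' : N ≤ alternatingGroup (Fin q)
  · exact Or.inl (le_antisymm h' h)
  · right
    obtain ⟨σ, hσ, hσ'⟩ := SetLike.not_le_iff_exists.1 h'
    rw [mem_alternatingGroup] at hσ'
    rw [eq_top_iff]
    intro τ _
    by_cases hτ : sign τ = 1
    · exact h (mem_alternatingGroup.2 hτ)
    · have h1 : τ * σ⁻¹ ∈ N := h (by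
        rw [mem_alternatingGroup, Perm.sign_mul, Perm.sign_inv, (Int.units_eq_one_or _).resolve_left hσ',
          (Int.units_eq_one_or _).resolve_left hτ]
        rfl)
      have := mul_mem h1 hσ
      rwa [inv_mul_cancel_right] at this

/-- Commutators of `σ ∈ N` with arbitrary permutations are even and lie in `N`, so they are trivial
and `σ` is central. On at least three points only the identity is central: if `σ` moves `i`, it does
not commute with the transposition of `σ i` and a third point. -/
theorem eq_bot_of_disjoint_alternating (hq : 3 ≤ q) {N : Subgroup (Perm (Fin q))} (hN : N.Normal)
    (h : ∀ σ ∈ N, σ ∈ alternatingGroup (Fin q) → σ = 1) : N = ⊥ := by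
  rw [Subgroup.eq_bot_iff_forall]
  intro σ hσ
  have hc : ∀ τ, τ * σ = σ * τ := by
    intro τ
    have h1 : τ * σ * τ⁻¹ * σ⁻¹ = 1 := by
      apply h
      · exact mul_mem (hN.conj_mem σ hσ τ) (inv_mem hσ)
      · rw [mem_alternatingGroup]
        simp only [Perm.sign_mul, Perm.sign_inv]
        rw [mul_comm (sign τ), mul_assoc (sign σ), Int.units_mul_self, mul_one,
          Int.units_mul_self]
    rw [mul_inv_eq_one, mul_inv_eq_iff_eq_mul] at h1
    exact h1
  by_contra hσ1
  obtain ⟨i, hi⟩ : ∃ i, σ i ≠ i := by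
    by_contra! hall
    exact hσ1 (Equiv.ext hall)
  obtain ⟨k, hk1, hk2⟩ := Fin.exists_ne_and_ne_of_two_lt i (σ i) (by omega)
  have h1 := congrArg (fun τ => τ i) (hc (swap (σ i) k))
  simp only [Perm.mul_apply, swap_apply_left, swap_apply_of_ne_of_ne hi.symm hk1.symm] at h1
  exact hk2 h1

theorem normal_of_simple (hq : 3 ≤ q) (hs : IsSimpleGroup (alternatingGroup (Fin q)))
    {N : Subgroup (Perm (Fin q))} (hN : N.Normal) :
    N = ⊥ ∨ N = alternatingGroup (Fin q) ∨ N = ⊤ := by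
  have h1 : (N.subgroupOf (alternatingGroup (Fin q))).Normal := inferInstance
  rcases h1.eq_bot_or_eq_top with h | h
  · left
    refine eq_bot_of_disjoint_alternating hq hN fun σ hσ hσ' => ?_
    have h2 : (⟨σ, hσ'⟩ : alternatingGroup (Fin q)) ∈ N.subgroupOf (alternatingGroup (Fin q)) :=
      hσ
    rw [h, Subgroup.mem_bot] at h2
    exact congrArg Subtype.val h2
  · right
    exact eq_alternating_or_top (Subgroup.subgroupOf_eq_top.1 h)

/-- The normal subgroups of the symmetric groups. -/
theorem normal_cases {N : Subgroup (Perm (Fin q))} (hN : N.Normal) :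
    N = ⊥ ∨ IsKlein N ∨ (3 ≤ q ∧ IsAlt N) ∨ N = ⊤ := by
  rcases (by omega : q ≤ 1 ∨ q = 2 ∨ q = 3 ∨ q = 4 ∨ 5 ≤ q) with hq | rfl | rfl | rfl | hq
  · left
    have : Subsingleton (Fin q) := Fin.subsingleton_iff_le_one.2 hq
    exact Subsingleton.elim _ _
  · have : IsSimpleGroup (Perm (Fin 2)) :=
      isSimpleGroup_of_prime_card (p := 2) (by simp [Nat.card_eq_fintype_card, Fintype.card_perm])
    rcases hN.eq_bot_or_eq_top with h | h
    · exact Or.inl h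
    · exact Or.inr (Or.inr (Or.inr h))
  · have : IsSimpleGroup (alternatingGroup (Fin 3)) :=
      isSimpleGroup_of_prime_card (p := 3) (by
        rw [nat_card_alternatingGroup]
        simp [Nat.factorial])
    rcases normal_of_simple le_rfl this hN with h | h | h
    · exact Or.inl h
    · exact Or.inr (Or.inr (Or.inl ⟨le_rfl, h⟩))
    · exact Or.inr (Or.inr (Or.inr h))
  -- The alternating group of degree four is not simple. Inside the Klein group conjugacy of the
  -- double transpositions decides; outside it a commutator provides a three-cycle.
  · by_cases h : ∀ σ ∈ N, σ ∈ kleinSubgroup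
    · by_cases hb : N = ⊥
      · exact Or.inl hb
      · right; left
        obtain ⟨⟨σ, hσ⟩, hσ1⟩ := Subgroup.ne_bot_iff_exists_ne_one.1 hb
        replace hσ1 : σ ≠ 1 := fun e => hσ1 (Subtype.ext e)
        have hσ2 := (mem_klein_iff.1 (h _ hσ)).resolve_left hσ1
        refine ⟨rfl, fun τ => ⟨fun hτ => mem_klein_iff.1 (h _ hτ), ?_⟩⟩
        rintro (rfl | hτ)
        · exact one_mem N
        · obtain ⟨ρ, rfl⟩ := isConj_iff.1 (isConj_iff_cycleType_eq.2 (hσ2.trans hτ.symm))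
          exact hN.conj_mem _ hσ ρ
    · push Not at h
      obtain ⟨σ, hσ, hσ'⟩ := h
      have h1 : ¬ (σ = 1 ∨ (σ * σ = 1 ∧ ∀ i, σ i ≠ i)) := hσ'
      rw [not_or] at h1
      obtain ⟨τ, h2, h3⟩ := exists_commutator_three_cycle σ h1.1 h1.2
      have h4 := alternatingGroup_le_of_three_cycle hN (isThreeCycle_of_pow_three h2 h3)
        (mul_mem hσ (hN.conj_mem _ (inv_mem hσ) τ))
      rcases eq_alternating_or_top h4 with h | h
      · exact Or.inr (Or.inr (Or.inl ⟨by omega, h⟩))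
      · exact Or.inr (Or.inr (Or.inr h))
  · rcases normal_of_simple (by omega) (alternatingGroup.isSimpleGroup (by simpa using hq)) hN
      with h | h | h
    · exact Or.inl h
    · exact Or.inr (Or.inr (Or.inl ⟨by omega, h⟩))
    · exact Or.inr (Or.inr (Or.inr h))

theorem alternating_ne_bot (hq : 3 ≤ q) : alternatingGroup (Fin q) ≠ ⊥ := by
  have := alternatingGroup.nontrivial_of_three_le_card (α := Fin q) (by simpa using hq)
  exact (Subgroup.nontrivial_iff_ne_bot _).1 this

theorem top_ne_alternating (hq : 2 ≤ q) : (⊤ : Subgroup (Perm (Fin q))) ≠ alternatingGroup _ := by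
  intro h
  have h1 : swap (⟨0, by omega⟩ : Fin q) ⟨1, by omega⟩ ∈ alternatingGroup (Fin q) := by
    rw [← h]; trivial
  rw [mem_alternatingGroup, sign_swap (by simp)] at h1
  exact absurd h1 (by decide)

theorem top_ne_bot (hq : 2 ≤ q) : (⊤ : Subgroup (Perm (Fin q))) ≠ ⊥ := by
  intro h
  have h1 : swap (⟨0, by omega⟩ : Fin q) ⟨1, by omega⟩ ∈ (⊥ : Subgroup (Perm (Fin q))) := by
    rw [← h]; trivial
  rw [Subgroup.mem_bot, swap_eq_one_iff] at h1
  simp at h1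

theorem kleinSubgroup_lt : kleinSubgroup < alternatingGroup (Fin 4) := by
  refine lt_of_le_of_ne (fun σ hσ => ?_) fun h => ?_
  · rw [mem_alternatingGroup]
    rcases mem_klein_iff.1 hσ with rfl | h
    · exact sign_one
    · rw [sign_of_cycleType, h]
      decide
  · have h1 : (c[0, 1, 2] : Perm (Fin 4)) ∈ kleinSubgroup := by
      rw [h, mem_alternatingGroup]
      decide
    have h2 : ¬ ((c[0, 1, 2] : Perm (Fin 4)) = 1 ∨ ((c[0, 1, 2] : Perm (Fin 4)) * c[0, 1, 2] = 1 ∧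
        ∀ i, (c[0, 1, 2] : Perm (Fin 4)) i ≠ i)) := by decide
    exact h2 h1

theorem IsKlein.eq {N : Subgroup (Perm (Fin 4))} (h : IsKlein N) : N = kleinSubgroup := by
  ext σ
  rw [h.2, isKlein_kleinSubgroup.2]

/-- The position of a normal subgroup in the list `1`, `K`, alternating group, symmetric group. -/
noncomputable def code (N : Subgroup (Perm (Fin q))) : ℕ :=
  open scoped Classical in if N = ⊥ then 0 else if N = ⊤ then 3 else if IsAlt N then 2 else 1

theorem code_bot : code (⊥ : Subgroup (Perm (Fin q))) = 0 := if_pos rfl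

theorem code_spec (hq : 2 ≤ q) {N : Subgroup (Perm (Fin q))} (hN : N.Normal) (hb : N ≠ ⊥) :
    (code N = 1 ∧ q = 4 ∧ IsKlein N ∧ ¬ IsAlt N ∧ N ≠ ⊤) ∨
    (code N = 2 ∧ 3 ≤ q ∧ ¬ IsKlein N ∧ IsAlt N ∧ N ≠ ⊤) ∨
    (code N = 3 ∧ ¬ IsKlein N ∧ ¬ IsAlt N ∧ N = ⊤) := by
  rcases normal_cases hN with h | h | ⟨h3, h⟩ | h
  · exact absurd h hb
  · obtain rfl := h.1
    obtain rfl := h.eq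
    have h1 : ¬ IsAlt kleinSubgroup := kleinSubgroup_lt.ne
    have h2 : kleinSubgroup ≠ ⊤ := (lt_of_lt_of_le kleinSubgroup_lt le_top).ne
    refine Or.inl ⟨?_, rfl, h, h1, h2⟩
    rw [code, if_neg hb, if_neg h2, if_neg h1]
  · have h2 : N ≠ ⊤ := fun e => top_ne_alternating hq (e ▸ h)
    refine Or.inr (Or.inl ⟨?_, h3, fun hk => ?_, h, h2⟩)
    · rw [code, if_neg hb, if_neg h2, if_pos h]
    · obtain rfl := hk.1
      obtain rfl := hk.eq
      exact kleinSubgroup_lt.ne h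
  · have h1 : ¬ IsAlt N := fun e => top_ne_alternating hq (h ▸ e)
    refine Or.inr (Or.inr ⟨?_, fun hk => ?_, h1, h⟩)
    · rw [code, if_neg hb, if_pos h]
    · obtain rfl := hk.1
      obtain rfl := hk.eq
      exact (lt_of_lt_of_le kleinSubgroup_lt le_top).ne h

/-- The normal subgroups of a symmetric group form a chain, so inclusion is comparison of positions.
-/
theorem le_iff_code (hq : 1 ≤ q) {N N' : Subgroup (Perm (Fin q))} (hN : N.Normal)
    (hN' : N'.Normal) : N ≤ N' ↔ code N ≤ code N' := by
  by_cases hb : N = ⊥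
  · subst hb
    simp [code_bot]
  have hq2 : 2 ≤ q := by
    by_contra hlt
    have : Subsingleton (Fin q) := Fin.subsingleton_iff_le_one.2 (by omega)
    exact hb (Subsingleton.elim _ _)
  by_cases hb' : N' = ⊥
  · subst hb'
    rw [code_bot, le_bot_iff]
    rcases code_spec hq2 hN hb with h | h | h <;> simp [hb, h.1]
  rcases code_spec hq2 hN hb with ⟨h, rfl, h1, -⟩ | ⟨h, -, h0, h1, h2⟩ | ⟨h, h0, h2, rfl⟩ <;>
    rcases code_spec hq2 hN' hb' with ⟨h', h4, h1', -⟩ | ⟨h', -, h0', h1', h2'⟩ | ⟨h', h0', h2', rfl⟩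
  · simp [h1.eq, h1'.eq]
  · rw [h, h', h1.eq, h1']
    simp [kleinSubgroup_lt.le]
  · simp [h, h']
  · subst h4
    rw [h, h', h1, h1'.eq]
    simp [kleinSubgroup_lt.not_ge]
  · rw [h1, h1']
    simp
  · simp [h, h']
  · subst h4
    rw [h, h', top_le_iff, h1'.eq]
    simp [(lt_of_lt_of_le kleinSubgroup_lt le_top).ne]
  · rw [h, h', top_le_iff]
    simp [h2']
  · simp

end Symmetric

/-! ### Ideals, retractions and the listed relations in uniform notation -/

section Ideals

variable {n : ℕ}

/-! ### Ideals and retractions -/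

theorem mem_rankIdeal {q : ℕ} {x : PB n} : x ∈ rankIdeal n q ↔ rk x ≤ q := Iff.rfl

theorem isIdeal_rankIdeal (n q : ℕ) : IsIdeal (rankIdeal n q) :=
  ⟨⟨om n, by rw [mem_rankIdeal, rk_om]; omega⟩, fun x hx a =>
    ⟨(rk_mul_le_right a x).trans hx, (rk_mul_le_left x a).trans hx⟩⟩

theorem IsIdeal.mem_of_rk_le {I : Set (PB n)} (hI : IsIdeal I) {x y : PB n} (hx : x ∈ I)
    (h : rk y ≤ rk x) : y ∈ I := by
  obtain ⟨s, t, rfl⟩ := jLe_iff.2 h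
  exact (hI.2 _ (hI.2 x hx s).1 t).2

theorem IsIdeal.eq_rankIdeal {I : Set (PB n)} (hI : IsIdeal I) : ∃ q ≤ n, I = rankIdeal n q := by
  classical
  let q := Nat.findGreatest (fun r => ∃ x ∈ I, rk x = r) n
  obtain ⟨x₀, hx₀⟩ := hI.1
  obtain ⟨x, hx, hxq⟩ : ∃ x ∈ I, rk x = q :=
    Nat.findGreatest_spec (P := fun r => ∃ x ∈ I, rk x = r) (rk_le x₀) ⟨x₀, hx₀, rfl⟩
  refine ⟨q, Nat.findGreatest_le n, Set.Subset.antisymm (fun y hy => ?_) fun y hy => ?_⟩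
  · exact Nat.le_findGreatest (P := fun r => ∃ x ∈ I, rk x = r) (rk_le y) ⟨y, hy, rfl⟩
  · exact hI.mem_of_rk_le hx (hxq ▸ hy)

theorem isIdeal_iff (I : Set (PB n)) : IsIdeal I ↔ ∃ q ≤ n, I = rankIdeal n q :=
  ⟨fun h => h.eq_rankIdeal, by rintro ⟨q, -, rfl⟩; exact isIdeal_rankIdeal n q⟩

theorem isMinimalIdeal_iff {M : Set (PB n)} : IsMinimalIdeal M ↔ M = rankIdeal n 0 := by
  have hsub : ∀ I : Set (PB n), IsIdeal I → rankIdeal n 0 ⊆ I := by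
    rintro I hI x hx
    obtain ⟨y, hy⟩ := hI.1
    exact hI.mem_of_rk_le hy (le_trans hx (Nat.zero_le _))
  constructor
  · rintro ⟨h1, h2⟩
    exact (h2 _ (isIdeal_rankIdeal n 0) (hsub M h1)).symm
  · rintro rfl
    exact ⟨isIdeal_rankIdeal n 0, fun I hI h => h.antisymm (hsub I hI)⟩

/-- The map cuts the only possible transversal. It is multiplicative because at rank at most one the
upper blocks of a product come from its first factor and the lower blocks from its last. -/
theorem isRetraction_of_le_one {q : ℕ} (hq : q ≤ 1) :
    IsRetraction (rankIdeal n q) (rankIdeal n 0) (fun x => x * om n * x) := by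
  have h0 : ∀ x y : PB n, rk (x * om n * y) = 0 := fun x y =>
    rk_mul_left_zero (rk_mul_right_zero rk_om _) _
  refine ⟨isMinimalIdeal_iff.2 rfl, fun x _ => (h0 x x).le, fun x hx y hy => ?_, fun x hx =>
    mul_mul_self_of_rk_zero (Nat.le_zero.1 hx) _⟩
  rw [mem_rankIdeal] at hx hy
  have hxy := rk_mul_le_left x y
  refine ext_of_rk_zero (h0 _ _) (rk_mul_left_zero (h0 _ _) _) (fun i j => ?_) fun i j => ?_
  · simp only [mul_assoc]
    rw [UU_mul_iff (by omega), UU_mul_iff (by omega)]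
  · simp only [← mul_assoc]
    rw [LL_mul_iff (by omega), LL_mul_iff (by omega)]

/-- The product `x * z` lies in the minimal ideal, so `f` fixes it and it equals `f x * z`. Since `f
x` has rank zero, its upper blocks can be read off, and the values of a retraction are forced. -/
theorem IsRetraction.UU_iff {I M : Set (PB n)} {f : PB n → PB n} (hI : IsIdeal I)
    (hf : IsRetraction I M f) {x : PB n} (hx : x ∈ I) {z : PB n} (hz : rk z = 0) (i j : Fin n) :
    UU (x * z) i j ↔ UU (f x) i j := by
  obtain ⟨h1, h2, h3, h4⟩ := hf
  obtain rfl := isMinimalIdeal_iff.1 h1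
  have hzI : z ∈ I := hI.mem_of_rk_le hx (by omega)
  have h5 := h3 x hx z hzI
  rw [h4 _ (rk_mul_right_zero hz x).le, h4 z hz.le] at h5
  have h6 : rk (f x) ≤ 0 := h2 x hx
  rw [h5, UU_mul_iff (by omega)]

theorem IsRetraction.LL_iff {I M : Set (PB n)} {f : PB n → PB n} (hI : IsIdeal I)
    (hf : IsRetraction I M f) {x : PB n} (hx : x ∈ I) {z : PB n} (hz : rk z = 0) (i j : Fin n) :
    LL (z * x) i j ↔ LL (f x) i j := by
  obtain ⟨h1, h2, h3, h4⟩ := hf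
  obtain rfl := isMinimalIdeal_iff.1 h1
  have hzI : z ∈ I := hI.mem_of_rk_le hx (by omega)
  have h5 := h3 z hzI x hx
  rw [h4 _ (rk_mul_left_zero hz x).le, h4 z hz.le] at h5
  have h6 : rk (f x) ≤ 0 := h2 x hx
  rw [h5, LL_mul_iff (by omega)]

theorem greenR_iff_of_rk_zero {x y : PB n} (hx : rk x = 0) (hy : rk y = 0) :
    GreenR x y ↔ ∀ i j, UU x i j ↔ UU y i j := by
  rw [greenR_iff_sameTop]
  refine ⟨fun h => h.1, fun h => ⟨h, ?_⟩⟩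
  rw [rk_eq_ncard, Set.ncard_eq_zero] at hx hy
  rw [hx, hy]

theorem greenL_iff_of_rk_zero {x y : PB n} (hx : rk x = 0) (hy : rk y = 0) :
    GreenL x y ↔ ∀ i j, LL x i j ↔ LL y i j := by
  rw [greenL_iff_sameBot, SameBot, ← greenR_iff_sameTop,
    greenR_iff_of_rk_zero (by rwa [rk_flip]) (by rwa [rk_flip])]
  rfl

/-- At rank at most one every retraction preserves the blocks within each row, so the condition does
not depend on the retraction chosen, and one exists. -/
theorem exists_retraction_iff {q : ℕ} (hq : q ≤ 1) {K : PB n → PB n → Prop} {P : Prop} {x y : PB n}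
    (hx : rk x ≤ q) (hy : rk y ≤ q)
    (hK : ∀ x' y' : PB n, rk x' = 0 → rk y' = 0 → (∀ i j, UU x' i j ↔ UU x i j) →
      (∀ i j, LL x' i j ↔ LL x i j) → (∀ i j, UU y' i j ↔ UU y i j) →
      (∀ i j, LL y' i j ↔ LL y i j) → (K x' y' ↔ P)) :
    (∃ (M : Set (PB n)) (f : PB n → PB n), IsRetraction (rankIdeal n q) M f ∧ K (f x) (f y)) ↔
      P := by
  have key : ∀ (M : Set (PB n)) (f : PB n → PB n), IsRetraction (rankIdeal n q) M f →
      (K (f x) (f y) ↔ P) := by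
    intro M f hf
    have hI := isIdeal_rankIdeal n q
    obtain rfl := isMinimalIdeal_iff.1 hf.1
    refine hK _ _ (Nat.le_zero.1 (hf.2.1 x hx)) (Nat.le_zero.1 (hf.2.1 y hy))
      (fun i j => ?_) (fun i j => ?_) (fun i j => ?_) fun i j => ?_
    · rw [← hf.UU_iff hI hx rk_om, UU_mul_iff (by omega)]
    · rw [← hf.LL_iff hI hx rk_om, LL_mul_iff (by omega)]
    · rw [← hf.UU_iff hI hy rk_om, UU_mul_iff (by omega)]
    · rw [← hf.LL_iff hI hy rk_om, LL_mul_iff (by omega)]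
  constructor
  · rintro ⟨M, f, hf, h⟩
    exact (key M f hf).1 h
  · intro h
    exact ⟨_, _, isRetraction_of_le_one hq, (key _ _ (isRetraction_of_le_one hq)).2 h⟩

theorem lamRel_iff {q : ℕ} (h1 : 1 ≤ q) (hq : q ≤ 2) {N : Subgroup (Perm (Fin q))} {x y : PB n} :
    lamRel (rankIdeal n (q - 1)) (barSet n N) x y ↔ levelRel True False q N x y := by
  refine or_congr Iff.rfl (or_congr Iff.rfl ?_)
  rw [true_or, false_or, true_and, mem_rankIdeal, mem_rankIdeal]
  have e : ∀ z : PB n, rk z < q ↔ rk z ≤ q - 1 := fun z => by omega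
  rw [e, e]
  refine and_congr_right fun hx => and_congr_right fun hy => ?_
  refine exists_retraction_iff (by omega) hx hy fun x' y' hx' hy' _ h2 _ h4 => ?_
  rw [greenL_iff_of_rk_zero hx' hy']
  simp only [h2, h4]

theorem rhoRel_iff {q : ℕ} (h1 : 1 ≤ q) (hq : q ≤ 2) {N : Subgroup (Perm (Fin q))} {x y : PB n} :
    rhoRel (rankIdeal n (q - 1)) (barSet n N) x y ↔ levelRel False True q N x y := by
  refine or_congr Iff.rfl (or_congr Iff.rfl ?_)
  rw [true_or, false_or, and_true, mem_rankIdeal, mem_rankIdeal]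
  have e : ∀ z : PB n, rk z < q ↔ rk z ≤ q - 1 := fun z => by omega
  rw [e, e]
  refine and_congr_right fun hx => and_congr_right fun hy => ?_
  refine exists_retraction_iff (by omega) hx hy fun x' y' hx' hy' h2 _ h4 _ => ?_
  rw [greenR_iff_of_rk_zero hx' hy']
  simp only [h2, h4]

theorem muRel_iff {q : ℕ} (h1 : 1 ≤ q) (hq : q ≤ 2) {N : Subgroup (Perm (Fin q))} {x y : PB n} :
    muRel (rankIdeal n (q - 1)) (barSet n N) x y ↔ levelRel False False q N x y := by
  refine or_congr Iff.rfl (or_congr Iff.rfl ?_)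
  rw [false_or, false_or, mem_rankIdeal, mem_rankIdeal]
  have e : ∀ z : PB n, rk z < q ↔ rk z ≤ q - 1 := fun z => by omega
  rw [e, e]
  refine and_congr_right fun hx => and_congr_right fun hy => ?_
  refine exists_retraction_iff (by omega) hx hy fun x' y' hx' hy' h1 h2 h3 h4 => ?_
  rw [GreenH, greenR_iff_of_rk_zero hx' hy', greenL_iff_of_rk_zero hx' hy']
  simp only [h1, h2, h3, h4]

/-- The level is `q + 1` because the collapsed part lies strictly below the level; the group there
is trivial. -/
theorem reesRel_iff {q : ℕ} {x y : PB n} :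
    reesRel (rankIdeal n q) x y ↔
      levelRel True True (q + 1) (⊥ : Subgroup (Perm (Fin (q + 1)))) x y := by
  rw [reesRel, levelRel, true_or, true_or, and_true, and_true, mem_rankIdeal, mem_rankIdeal,
    Nat.lt_succ_iff, Nat.lt_succ_iff]
  constructor
  · rintro (h | h)
    · exact Or.inl h
    · exact Or.inr (Or.inr h)
  · rintro (h | h | h)
    · exact Or.inl h
    · exact Or.inl (eq_of_nu_bot h)
    · exact Or.inr h

theorem reesNRel_iff {q : ℕ} (h1 : 1 ≤ q) {N : Subgroup (Perm (Fin q))} {x y : PB n} :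
    reesNRel (rankIdeal n (q - 1)) (barSet n N) x y ↔ levelRel True True q N x y := by
  have e : ∀ z : PB n, rk z < q ↔ rk z ≤ q - 1 := fun z => by omega
  rw [reesNRel, levelRel, true_or, true_or, and_true, and_true, mem_rankIdeal, mem_rankIdeal, e, e]

end Ideals

/-! ### The bijection between names and congruences -/

section Labels

variable {n : ℕ}

/-! ### The congruence with a given name -/

/-- The congruence relates elements of the minimal ideal with different upper blocks. -/
def CongLabel.upper : CongLabel n → Bool
  | .rho _ => false
  | .mu _ => false
  | _ => true

/-- The congruence relates elements of the minimal ideal with different lower blocks. -/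
def CongLabel.lower : CongLabel n → Bool
  | .lam _ => false
  | .mu _ => false
  | _ => true

/-- The rank in which the relation `nu` of the congruence lives. -/
def CongLabel.level : CongLabel n → ℕ
  | .lam c => c.q
  | .rho c => c.q
  | .mu c => c.q
  | .rees q _ => q + 1
  | .norm q _ _ _ _ _ => q

/-- The normal subgroup that determines the relation `nu` of the congruence. -/
def CongLabel.sub : (l : CongLabel n) → Subgroup (Perm (Fin l.level))
  | .lam c => c.subgroup
  | .rho c => c.subgroup
  | .mu c => c.subgroup
  | .rees _ _ => ⊥
  | .norm _ _ _ N _ _ => N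

theorem RetractLabel.q_pos (c : RetractLabel) : 1 ≤ c.q := by cases c <;> simp [RetractLabel.q]
theorem RetractLabel.q_le (c : RetractLabel) : c.q ≤ 2 := by cases c <;> simp [RetractLabel.q]

theorem RetractLabel.normal (c : RetractLabel) : c.subgroup.Normal := by
  cases c <;> simp only [RetractLabel.subgroup] <;> infer_instance

theorem CongLabel.isLevel (hn : 2 ≤ n) (l : CongLabel n) :
    IsLevel n (l.upper = true) (l.lower = true) l.level l.sub := by
  have hc : ∀ (A B : Prop) (c : RetractLabel), IsLevel n A B c.q c.subgroup := by
    intro A B c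
    have h1 := c.q_pos
    have h2 := c.q_le
    exact ⟨h1, by omega, c.normal, fun h => by omega, fun h => by omega⟩
  rcases l with c | c | c | ⟨q, hq⟩ | ⟨q, h2, hq, N, hN, hN'⟩
  · exact hc _ _ c
  · exact hc _ _ c
  · exact hc _ _ c
  · exact ⟨by simp [level], by simpa [level] using hq, by simp only [sub]; infer_instance,
      fun _ => rfl, fun _ => ⟨rfl, rfl⟩⟩
  · exact ⟨by simp only [level]; omega, by simp only [level]; omega, hN,
      fun h => by simp only [level] at h; omega, fun _ => ⟨rfl, rfl⟩⟩

/-- The congruence with a given name. -/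
def CongLabel.con (hn : 2 ≤ n) (l : CongLabel n) : Con (PB n) := levelCon (l.isLevel hn)

theorem CongLabel.con_iff_rel (hn : 2 ≤ n) (l : CongLabel n) (x y : PB n) :
    l.con hn x y ↔ l.rel x y := by
  have hT : (true = true) = True := by simp
  have hF : (false = true) = False := by simp
  rw [con, levelCon_apply]
  rcases l with c | c | c | ⟨q, hq⟩ | ⟨q, h2, hq, N, hN, hN'⟩
  · change levelRel (true = true) (false = true) c.q c.subgroup x y ↔ _
    rw [hT, hF]
    exact (lamRel_iff c.q_pos c.q_le).symm
  · change levelRel (false = true) (true = true) c.q c.subgroup x y ↔ _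
    rw [hT, hF]
    exact (rhoRel_iff c.q_pos c.q_le).symm
  · change levelRel (false = true) (false = true) c.q c.subgroup x y ↔ _
    rw [hF]
    exact (muRel_iff c.q_pos c.q_le).symm
  · change levelRel (true = true) (true = true) (q + 1) ⊥ x y ↔ _
    rw [hT]
    exact reesRel_iff.symm
  · change levelRel (true = true) (true = true) q N x y ↔ _
    rw [hT]
    exact (reesNRel_iff (by omega)).symm

/-- The position of the rank and the normal subgroup of a congruence in the chain of all of
them. -/
noncomputable def CongLabel.height (l : CongLabel n) : ℕ := 4 * l.level + code l.sub

theorem code_lt {q : ℕ} (N : Subgroup (Perm (Fin q))) : code N < 4 := by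
  unfold code
  split_ifs <;> omega

/-- Since `code` is less than four, `4 * q + code N` encodes the lexicographic order on pairs of a
rank and a normal subgroup. -/
theorem level_le_iff {q q' : ℕ} (hq : 1 ≤ q) {N : Subgroup (Perm (Fin q))}
    {N' : Subgroup (Perm (Fin q'))} (hN : N.Normal) (hN' : N'.Normal) :
    (q < q' ∨ ∃ h : q = q', h ▸ N ≤ N') ↔ 4 * q + code N ≤ 4 * q' + code N' := by
  have := code_lt N
  have := code_lt N'
  constructor
  · rintro (h | ⟨rfl, h⟩)
    · omega
    · have := (le_iff_code hq hN hN').1 h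
      omega
  · intro h
    rcases (by omega : q < q' ∨ q = q') with h' | rfl
    · exact Or.inl h'
    · exact Or.inr ⟨rfl, (le_iff_code hq hN hN').2 (by omega)⟩

theorem levelCon_le_iff (hn : 2 ≤ n) {A B A' B' : Prop} {q q' : ℕ} {N : Subgroup (Perm (Fin q))}
    {N' : Subgroup (Perm (Fin q'))} (hl : IsLevel n A B q N) (hl' : IsLevel n A' B' q' N') :
    levelCon hl ≤ levelCon hl' ↔
      (A → A') ∧ (B → B') ∧ 4 * q + code N ≤ 4 * q' + code N' := by
  rw [← level_le_iff hl.pos hl.normal hl'.normal, ← levelRel_le_iff hn hl hl']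
  exact Con.le_def

theorem CongLabel.con_le_iff (hn : 2 ≤ n) (l l' : CongLabel n) : l.con hn ≤ l'.con hn ↔
    (l.upper = true → l'.upper = true) ∧ (l.lower = true → l'.lower = true) ∧
      l.height ≤ l'.height :=
  levelCon_le_iff hn _ _

/-- The heights of the congruences of the first and the second kind. -/
def RetractLabel.height : RetractLabel → ℕ
  | .zero => 4
  | .one => 8
  | .symTwo => 11

theorem code_top_two : code (⊤ : Subgroup (Perm (Fin 2))) = 3 := by
  rw [code, if_neg (top_ne_bot le_rfl), if_pos rfl]

theorem RetractLabel.height_eq (c : RetractLabel) : 4 * c.q + code c.subgroup = c.height := by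
  rcases c with _ | _ | _
  · exact congrArg (4 * 1 + ·) code_bot
  · exact congrArg (4 * 2 + ·) code_bot
  · exact congrArg (4 * 2 + ·) code_top_two

theorem RetractLabel.height_injective {c d : RetractLabel} (h : c.height = d.height) : c = d := by
  cases c <;> cases d <;> simp_all [RetractLabel.height]

theorem CongLabel.height_lam (c : RetractLabel) : (lam c : CongLabel n).height = c.height :=
  c.height_eq

theorem CongLabel.height_rho (c : RetractLabel) : (rho c : CongLabel n).height = c.height :=
  c.height_eq

theorem CongLabel.height_mu (c : RetractLabel) : (mu c : CongLabel n).height = c.height :=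
  c.height_eq

theorem CongLabel.height_rees (q : ℕ) (hq : q ≤ n) : (rees q hq).height = 4 * (q + 1) :=
  congrArg (4 * (q + 1) + ·) code_bot

theorem CongLabel.height_norm {q : ℕ} (h2 : 2 ≤ q) (hq : q ≤ n) (N : Subgroup (Perm (Fin q)))
    (hN : N.Normal) (hN' : N ≠ ⊥) : (norm q h2 hq N hN hN').height = 4 * q + code N := rfl

theorem code_pos {q : ℕ} {N : Subgroup (Perm (Fin q))} (hN : N ≠ ⊥) : 0 < code N := by
  rw [code, if_neg hN]
  split_ifs <;> omega

/-- Names with both flags set are told apart by the residue of the height modulo four, which is zero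
exactly for the Rees congruences. -/
theorem CongLabel.key_injective {l l' : CongLabel n} (hA : l.upper = l'.upper)
    (hB : l.lower = l'.lower) (hh : l.height = l'.height) : l = l' := by
  rcases l with c | c | c | ⟨q, hq⟩ | ⟨q, h2, hq, N, hN, hN'⟩ <;>
    rcases l' with d | d | d | ⟨q', hq'⟩ | ⟨q', h2', hq', N', hM, hM'⟩ <;>
    simp only [upper, lower, reduceCtorEq] at hA hB <;>
    simp only [height_lam, height_rho, height_mu, height_rees, height_norm] at hh
  · rw [RetractLabel.height_injective hh]
  · rw [RetractLabel.height_injective hh]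
  · rw [RetractLabel.height_injective hh]
  · obtain rfl : q = q' := by omega
    rfl
  · have := code_lt N'
    have := code_pos hM'
    omega
  · have := code_lt N
    have := code_pos hN'
    omega
  · have := code_lt N'
    have := code_lt N
    obtain rfl : q = q' := by omega
    obtain rfl : N = N' := le_antisymm ((le_iff_code (by omega) hN hM).2 (by omega))
      ((le_iff_code (by omega) hM hN).2 (by omega))
    rfl

theorem CongLabel.con_injective (hn : 2 ≤ n) : Function.Injective (CongLabel.con hn) := by
  intro l l' h
  have h1 := (con_le_iff hn l l').1 h.le
  have h2 := (con_le_iff hn l' l).1 h.ge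
  exact key_injective (Bool.eq_iff_iff.2 ⟨h1.1, h2.1⟩) (Bool.eq_iff_iff.2 ⟨h1.2.1, h2.2.1⟩)
    (le_antisymm h1.2.2 h2.2.2)

/-- The possible heights of congruences. -/
def IsHeight (h : ℕ) : Prop := h = 4 ∨ h = 8 ∨ h = 11 ∨ (12 ≤ h ∧ (h % 4 = 1 → h = 17))

theorem CongLabel.isHeight (l : CongLabel n) : IsHeight l.height ∧ l.height ≤ 4 * (n + 1) ∨
    n < 2 := by
  rcases lt_or_ge n 2 with hn | hn
  · exact Or.inr hn
  left
  have hc : ∀ c : RetractLabel, IsHeight c.height ∧ c.height ≤ 4 * (n + 1) := by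
    rintro (_ | _ | _) <;> simp [IsHeight, RetractLabel.height] <;> omega
  rcases l with c | c | c | ⟨q, hq⟩ | ⟨q, h2, hq, N, hN, hN'⟩
  · rw [height_lam]; exact hc c
  · rw [height_rho]; exact hc c
  · rw [height_mu]; exact hc c
  · rw [height_rees]
    refine ⟨?_, by omega⟩
    unfold IsHeight
    omega
  · rw [height_norm]
    rcases code_spec h2 hN hN' with h | h | h <;> refine ⟨?_, by omega⟩ <;> unfold IsHeight <;>
      omega

theorem CongLabel.full_of_height (l : CongLabel n) (h : 12 ≤ l.height) :
    l.upper = true ∧ l.lower = true := by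
  have hc : ∀ c : RetractLabel, c.height ≤ 11 := by
    rintro (_ | _ | _) <;> simp [RetractLabel.height]
  rcases l with c | c | c | ⟨q, hq⟩ | ⟨q, h2, hq, N, hN, hN'⟩
  · rw [height_lam] at h; have := hc c; omega
  · rw [height_rho] at h; have := hc c; omega
  · rw [height_mu] at h; have := hc c; omega
  · exact ⟨rfl, rfl⟩
  · exact ⟨rfl, rfl⟩

/-- Below 12 there are only the heights 4, 8 and 11, each with all four combinations of flags; with
both flags set they belong to `R_0`, `R_1` and `R_{S_2}`. From 12 on, the residue of the height
modulo four tells the kind: 0 for a Rees congruence, 1 for the Klein group (only 17 = 4 · 4 + 1), 2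
for an alternating group and 3 for a full symmetric group. -/
theorem CongLabel.exists_of_height (hn : 2 ≤ n) (a b : Bool) {h : ℕ} (hh : IsHeight h)
    (hle : h ≤ 4 * (n + 1)) (hfull : 12 ≤ h → a = true ∧ b = true) :
    ∃ l : CongLabel n, l.upper = a ∧ l.lower = b ∧ l.height = h := by
  rcases (by omega : h ≤ 11 ∨ 12 ≤ h) with h11 | h12
  · obtain ⟨c, rfl⟩ : ∃ c : RetractLabel, c.height = h := by
      rcases hh with rfl | rfl | rfl | hh
      · exact ⟨.zero, rfl⟩
      · exact ⟨.one, rfl⟩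
      · exact ⟨.symTwo, rfl⟩
      · omega
    rcases a with _ | _ <;> rcases b with _ | _
    · exact ⟨.mu c, rfl, rfl, height_mu c⟩
    · exact ⟨.rho c, rfl, rfl, height_rho c⟩
    · exact ⟨.lam c, rfl, rfl, height_lam c⟩
    · rcases c with _ | _ | _
      · exact ⟨.rees 0 (by omega), rfl, rfl, height_rees _ _⟩
      · exact ⟨.rees 1 (by omega), rfl, rfl, height_rees _ _⟩
      · exact ⟨.norm 2 le_rfl hn ⊤ inferInstance (top_ne_bot le_rfl), rfl, rfl,
          congrArg (4 * 2 + ·) code_top_two⟩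
  · obtain ⟨rfl, rfl⟩ := hfull h12
    obtain ⟨q, r, hr, rfl⟩ : ∃ q r, r < 4 ∧ h = 4 * q + r := ⟨h / 4, h % 4, by omega, by omega⟩
    have hq3 : 3 ≤ q := by omega
    have hspec := fun (N : Subgroup (Perm (Fin q))) (hN : N.Normal) (hN' : N ≠ ⊥) =>
      code_spec (by omega) hN hN'
    interval_cases r
    · exact ⟨.rees (q - 1) (by omega), rfl, rfl, by rw [height_rees]; omega⟩
    · obtain rfl : q = 4 := by
        rcases hh with hh | hh | hh | ⟨-, hh⟩
        · omega
        · omega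
        · omega
        · have := hh (by omega)
          omega
      refine ⟨.norm 4 (by omega) (by omega) kleinSubgroup kleinSubgroup_normal
        kleinSubgroup_ne_bot, rfl, rfl, ?_⟩
      rw [height_norm]
      rcases hspec _ kleinSubgroup_normal kleinSubgroup_ne_bot with h | h | h
      · rw [h.1]
      · exact absurd isKlein_kleinSubgroup h.2.2.1
      · exact absurd isKlein_kleinSubgroup h.2.1
    · have hN : (alternatingGroup (Fin q)).Normal := inferInstance
      refine ⟨.norm q (by omega) (by omega) (alternatingGroup (Fin q)) hN
        (alternating_ne_bot hq3), rfl, rfl, ?_⟩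
      rw [height_norm]
      rcases hspec _ hN (alternating_ne_bot hq3) with h | h | h
      · exact absurd rfl h.2.2.2.1
      · rw [h.1]
      · exact absurd rfl h.2.2.1
    · refine ⟨.norm q (by omega) (by omega) ⊤ inferInstance (top_ne_bot (by omega)), rfl, rfl, ?_⟩
      rw [height_norm, code, if_neg (top_ne_bot (by omega)), if_pos rfl]

/-- The order on congruences sees only flags and height, so a name with the right flags and height
names the given congruence. -/
theorem CongLabel.con_surjective (hn : 2 ≤ n) : Function.Surjective (CongLabel.con hn) := by
  classical
  intro ξ
  obtain ⟨A, B, q, N, hl, rfl⟩ := exists_level ξ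
  have hcode : code N = 0 ∨ (2 ≤ q ∧ q ≤ n ∧ N ≠ ⊥) := by
    by_cases hb : N = ⊥
    · left; subst hb; exact code_bot
    · right
      refine ⟨?_, ?_, hb⟩
      · by_contra hlt
        have : Subsingleton (Fin q) := Fin.subsingleton_iff_le_one.2 (by omega)
        exact hb (Subsingleton.elim _ _)
      · by_contra hlt
        exact hb (hl.eq_bot (by omega))
  have hpos := hl.pos
  have hle := hl.le
  have hh : IsHeight (4 * q + code N) ∧ 4 * q + code N ≤ 4 * (n + 1) := by
    unfold IsHeight
    rcases hcode with h | ⟨h2, hqn, hb⟩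
    · omega
    · rcases code_spec h2 hl.normal hb with h | h | h <;> omega
  obtain ⟨l, h1, h2, h3⟩ := exists_of_height hn (decide A) (decide B) hh.1 hh.2 (fun h => by
    have := code_lt N
    simpa using hl.full (by omega))
  have h4 := l.isLevel hn
  have hA : (l.upper = true) ↔ A := by rw [h1]; simp
  have hB : (l.lower = true) ↔ B := by rw [h2]; simp
  refine ⟨l, ?_⟩
  exact le_antisymm ((levelCon_le_iff hn h4 hl).2 ⟨hA.1, hB.1, h3.le⟩)
    ((levelCon_le_iff hn hl h4).2 ⟨hA.2, hB.2, h3.ge⟩)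

end Labels

/-! ### Hasse diagrams from flags and heights -/

section Covers

variable {n : ℕ}

/-! ### Covering pairs -/

/-- `h'` is the height that follows `h`. -/
def NextHeight (h h' : ℕ) : Prop :=
  (h = 4 ∧ h' = 8) ∨ (h = 8 ∧ h' = 11) ∨ (11 ≤ h ∧ ((h % 4 = 0 ∧ h ≠ 16 ∧ h' = h + 2) ∨
    ((h % 4 ≠ 0 ∨ h = 16) ∧ h' = h + 1)))

/-- Among the heights from 12 on, a multiple of four is followed by an alternating group two steps
further, except that 16 is followed by the Klein group at 17. -/
theorem exists_nextHeight {h h' : ℕ} (hh : IsHeight h) (hh' : IsHeight h') (hlt : h < h') :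
    ∃ k, NextHeight h k ∧ IsHeight k ∧ k ≤ h' := by
  unfold NextHeight IsHeight at *
  rcases hh with rfl | rfl | rfl | hh
  · exact ⟨8, by omega, by omega, by omega⟩
  · exact ⟨11, by omega, by omega, by omega⟩
  · exact ⟨12, by omega, by omega, by omega⟩
  · by_cases h0 : h % 4 = 0 ∧ h ≠ 16
    · exact ⟨h + 2, by omega, by omega, by omega⟩
    · exact ⟨h + 1, by omega, by omega, by omega⟩

theorem NextHeight.lt {h h' : ℕ} (hh : NextHeight h h') : h < h' := by
  unfold NextHeight at hh
  omega

theorem NextHeight.eq_or_eq {h h' k : ℕ} (hh : NextHeight h h') (hk : IsHeight k) (h1 : h ≤ k)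
    (h2 : k ≤ h') : k = h ∨ k = h' := by
  unfold NextHeight IsHeight at *
  omega

theorem RetractLabel.step_iff (c d : RetractLabel) : c.Step d ↔ NextHeight c.height d.height := by
  cases c <;> cases d <;> simp [RetractLabel.Step, NextHeight, RetractLabel.height]

theorem code_iff {q : ℕ} (hq : 2 ≤ q) {N : Subgroup (Perm (Fin q))} (hN : N.Normal)
    (hb : N ≠ ⊥) :
    (IsKlein N ↔ code N = 1) ∧ (IsAlt N ↔ code N = 2) ∧ (N = ⊤ ↔ code N = 3) ∧ 1 ≤ code N ∧
      code N ≤ 3 ∧ (code N = 1 → q = 4) ∧ (code N = 2 → 3 ≤ q) := by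
  rcases code_spec hq hN hb with ⟨h, h4, hk, ha, ht⟩ | ⟨h, h4, hk, ha, ht⟩ | ⟨h, hk, ha, ht⟩ <;>
    rw [h]
  · simp [hk, ha, ht, h4]
  · simp [hk, ha, ht, h4]
  · simp only [hk, ha, iff_true_intro ht]
    simp

namespace CongLabel

theorem chainEdge_iff {l l' : CongLabel n} (hu : l.upper = true ∧ l.lower = true)
    (hu' : l'.upper = true ∧ l'.lower = true) :
    l.ChainEdge l' ↔ NextHeight l.height l'.height := by
  rcases l with c | c | c | ⟨q, hq⟩ | ⟨q, h2, hq, N, hN, hN'⟩ <;>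
    simp only [upper, lower, reduceCtorEq, and_false, false_and] at hu <;>
    rcases l' with d | d | d | ⟨q', hq'⟩ | ⟨q', h2', hq', N', hM, hM'⟩ <;>
    simp only [upper, lower, reduceCtorEq, and_false, false_and] at hu' <;>
    simp only [ChainEdge, height_rees, height_norm, NextHeight, IsFirst]
  · omega
  · obtain ⟨hk, ha, ht, h1, h3, h4, h5⟩ := code_iff h2' hM hM'
    simp only [hk, ha, ht]
    omega
  · obtain ⟨hk, ha, ht, h1, h3, h4, h5⟩ := code_iff h2 hN hN'
    simp only [ht]
    omega
  · obtain ⟨hk, ha, ht, h1, h3, h4, h5⟩ := code_iff h2 hN hN'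
    obtain ⟨hk', ha', ht', h1', h3', h4', h5'⟩ := code_iff h2' hM hM'
    simp only [hk, ha, ha', ht']
    omega

theorem isTopOf_iff {c : RetractLabel} {l : CongLabel n} (hu : l.upper = true ∧ l.lower = true) :
    l.IsTopOf c ↔ c.height = l.height := by
  rcases l with d | d | d | ⟨q, hq⟩ | ⟨q, h2, hq, N, hN, hN'⟩ <;>
    simp only [upper, lower, reduceCtorEq, and_false, false_and] at hu
  · rw [height_rees]
    rcases c with _ | _ | _ <;> simp [IsTopOf, RetractLabel.height] <;> omega
  · rw [height_norm]
    obtain ⟨hk, ha, ht, h1, h3, h4, h5⟩ := code_iff h2 hN hN'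
    rcases c with _ | _ | _ <;>
      simp only [IsTopOf, RetractLabel.height, ht, reduceCtorEq, false_and, true_and,
        false_iff] <;> omega

theorem edge_iff_chainEdge {l l' : CongLabel n} (hu : l.upper = true ∧ l.lower = true)
    (hu' : l'.upper = true ∧ l'.lower = true) : l.Edge l' ↔ l.ChainEdge l' := by
  cases l <;> cases l' <;> first | exact Iff.rfl | simp [upper, lower] at hu hu'

theorem starEdge_iff_chainEdge {l l' : CongLabel n} (hu : l.upper = true ∧ l.lower = true)
    (hu' : l'.upper = true ∧ l'.lower = true) : l.StarEdge l' ↔ l.ChainEdge l' := by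
  cases l <;> cases l' <;> first | exact Iff.rfl | simp [upper, lower] at hu hu'

theorem edge_iff_isTopOf {l l' : CongLabel n} {c : RetractLabel} (h : l = .lam c ∨ l = .rho c)
    (hu' : l'.upper = true ∧ l'.lower = true) : l.Edge l' ↔ c.height = l'.height := by
  rw [← isTopOf_iff hu']
  rcases h with rfl | rfl <;> cases l' <;> first | exact Iff.rfl | simp [upper, lower] at hu'

theorem starEdge_iff_isTopOf {l : CongLabel n} {c : RetractLabel}
    (hu : l.upper = true ∧ l.lower = true) :
    (mu c : CongLabel n).StarEdge l ↔ c.height = l.height := by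
  rw [← isTopOf_iff hu]
  cases l <;> first | exact Iff.rfl | simp [upper, lower] at hu

/-- The edges of the Hasse diagram in terms of heights. -/
theorem edge_iff {l l' : CongLabel n} : l.Edge l' ↔
    (l.upper = l'.upper ∧ l.lower = l'.lower ∧ NextHeight l.height l'.height) ∨
    (l.height = l'.height ∧ ((l.upper = false ∧ l'.upper = true ∧ l.lower = l'.lower) ∨
      (l.lower = false ∧ l'.lower = true ∧ l.upper = l'.upper))) := by
  have hne : ∀ {c d : RetractLabel}, c.height = d.height ↔ c = d := fun {c d} =>
    ⟨RetractLabel.height_injective, fun h => h ▸ rfl⟩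
  by_cases hu : l.upper = true ∧ l.lower = true <;>
    by_cases hu' : l'.upper = true ∧ l'.lower = true
  · rw [edge_iff_chainEdge hu hu', chainEdge_iff hu hu', hu.1, hu.2, hu'.1, hu'.2]
    simp
  · rcases l with c | c | c | c | c <;> rcases l' with d | d | d | d | d <;>
      simp [upper, lower, Edge, ChainEdge] at hu hu' ⊢
  · rcases l with c | c | c | c | c
    · rw [edge_iff_isTopOf (Or.inl rfl) hu', height_lam, hu'.1, hu'.2]
      simp [upper, lower]
    · rw [edge_iff_isTopOf (Or.inr rfl) hu', height_rho, hu'.1, hu'.2]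
      simp [upper, lower]
    · rcases l' with d | d | d | d | d <;> simp [upper, lower, Edge, ChainEdge] at hu hu' ⊢
    · exact absurd ⟨rfl, rfl⟩ hu
    · exact absurd ⟨rfl, rfl⟩ hu
  · rcases l with c | c | c | c | c <;> rcases l' with d | d | d | d | d <;>
      simp [upper, lower] at hu hu' <;>
      simp [Edge, height_lam, height_rho, height_mu, upper, lower, RetractLabel.step_iff, hne,
        IsTopOf]

/-- The edges of the Hasse diagram of the lattice of `*`-congruences in terms of heights. -/
theorem starEdge_iff {l l' : CongLabel n} (h : l.upper = l.lower) (h' : l'.upper = l'.lower) :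
    l.StarEdge l' ↔ (l.upper = l'.upper ∧ NextHeight l.height l'.height) ∨
    (l.height = l'.height ∧ l.upper = false ∧ l'.upper = true) := by
  rcases l with c | c | c | ⟨q, hq⟩ | ⟨q, h2, hq, N, hN, hN'⟩ <;>
    simp only [upper, lower, reduceCtorEq] at h <;>
    rcases l' with d | d | d | ⟨q', hq'⟩ | ⟨q', h2', hq', N', hM, hM'⟩ <;>
    simp only [upper, lower, reduceCtorEq] at h'
  · simp [StarEdge, height_mu, upper, RetractLabel.step_iff]
  · rw [starEdge_iff_isTopOf ⟨rfl, rfl⟩, height_mu]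
    simp [upper]
  · rw [starEdge_iff_isTopOf ⟨rfl, rfl⟩, height_mu]
    simp [upper]
  all_goals first
    | simp [StarEdge, upper, ChainEdge]; done
    | (rw [starEdge_iff_chainEdge ⟨rfl, rfl⟩ ⟨rfl, rfl⟩, chainEdge_iff ⟨rfl, rfl⟩ ⟨rfl, rfl⟩]
       simp [upper])

theorem not_isLeftRight_iff {l : CongLabel n} : ¬ l.IsLeftRight ↔ l.upper = l.lower := by
  cases l <;> simp [IsLeftRight, upper, lower]

/-- The involution exchanges the two flags and preserves the level and the subgroup. -/
theorem isStarCon_iff (hn : 2 ≤ n) (l : CongLabel n) :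
    IsStarCon (l.con hn) ↔ l.upper = l.lower := by
  constructor
  · intro h
    have hl := l.isLevel hn
    have h1 : levelCon hl ≤ levelCon hl.symm := Con.le_def.2 fun {x y} hxy => by
      have := levelRel_flip (h x y hxy)
      rwa [flip_flip, flip_flip] at this
    have h2 := (levelCon_le_iff hn hl hl.symm).1 h1
    exact Bool.eq_iff_iff.2 ⟨h2.1, h2.2.1⟩
  · intro h x y hxy
    have h1 := levelRel_flip (show levelRel _ _ _ _ x y from hxy)
    change levelRel (l.upper = true) (l.lower = true) _ _ _ _
    rw [h] at h1 ⊢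
    exact h1

theorem height_spec (hn : 2 ≤ n) (l : CongLabel n) :
    IsHeight l.height ∧ l.height ≤ 4 * (n + 1) := l.isHeight.resolve_right (by omega)

theorem con_covBy_iff (hn : 2 ≤ n) (l l' : CongLabel n) :
    l.con hn ⋖ l'.con hn ↔ l.Edge l' := by
  rw [edge_iff]
  constructor
  · intro h
    have hle := (con_le_iff hn l l').1 h.le
    have hne : l ≠ l' := fun e => h.lt.ne (e ▸ rfl)
    -- Every admissible triple of two flags and a height belongs to a congruence, so no triple lies
    -- strictly between the ends of a covering pair. It is tested on triples that differ from the
    -- lower end in one coordinate.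
    have key : ∀ (a b : Bool) (k : ℕ), IsHeight k → k ≤ l'.height →
        (12 ≤ k → a = true ∧ b = true) → (l.upper = true → a = true) → (l.lower = true → b = true) →
        l.height ≤ k → (a = true → l'.upper = true) → (b = true → l'.lower = true) →
        (¬ (a = l.upper ∧ b = l.lower ∧ k = l.height)) →
        a = l'.upper ∧ b = l'.lower ∧ k = l'.height := by
      intro a b k h1 h2 h3 h4 h5 h6 h7 h8 h9
      obtain ⟨m, rfl, rfl, rfl⟩ := exists_of_height hn a b h1
        (h2.trans (l'.height_spec hn).2) h3
      rcases h.eq_or_eq ((con_le_iff hn l m).2 ⟨h4, h5, h6⟩)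
        ((con_le_iff hn m l').2 ⟨h7, h8, h2⟩) with h10 | h10
      · rw [con_injective hn h10] at h9
        exact absurd ⟨rfl, rfl, rfl⟩ h9
      · rw [con_injective hn h10]
        exact ⟨rfl, rfl, rfl⟩
    have hfull : 12 ≤ l.height → l.upper = true ∧ l.lower = true := l.full_of_height
    have hfull' : 12 ≤ l'.height → l'.upper = true ∧ l'.lower = true := l'.full_of_height
    by_cases hu : l.upper = l'.upper
    · by_cases hl : l.lower = l'.lower
      · have hlt : l.height < l'.height :=
          lt_of_le_of_ne hle.2.2 fun e => hne (key_injective hu hl e)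
        obtain ⟨k, hk1, hk2, hk3⟩ := exists_nextHeight (l.height_spec hn).1
          (l'.height_spec hn).1 hlt
        have := key l.upper l.lower k hk2 hk3
          (fun h12 => by rw [hu, hl]; exact hfull' (h12.trans hk3)) id id hk1.lt.le hle.1 hle.2.1
          (fun e => hk1.lt.ne' e.2.2)
        rw [← this.2.2]
        exact Or.inl ⟨hu, hl, hk1⟩
      · have h1 : l.lower = false := by
          by_contra h1
          rw [Bool.not_eq_false] at h1
          exact hl (h1.trans (hle.2.1 h1).symm)
        have h2 : l'.lower = true := by
          by_contra h2
          rw [Bool.not_eq_true] at h2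
          exact hl (h1.trans h2.symm)
        have := key l.upper true l.height (l.height_spec hn).1 hle.2.2
          (fun h12 => by rw [(hfull h12).2] at h1; cases h1) id (fun _ => rfl) le_rfl hle.1
          (fun _ => h2) (fun e => by rw [h1] at e; cases e.2.1)
        exact Or.inr ⟨this.2.2, Or.inr ⟨h1, h2, hu⟩⟩
    · have h1 : l.upper = false := by
        by_contra h1
        rw [Bool.not_eq_false] at h1
        exact hu (h1.trans (hle.1 h1).symm)
      have h2 : l'.upper = true := by
        by_contra h2
        rw [Bool.not_eq_true] at h2
        exact hu (h1.trans h2.symm)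
      have := key true l.lower l.height (l.height_spec hn).1 hle.2.2
        (fun h12 => by rw [(hfull h12).1] at h1; cases h1) (fun _ => rfl) id le_rfl
        (fun _ => h2) hle.2.1 (fun e => by rw [h1] at e; cases e.1)
      exact Or.inr ⟨this.2.2, Or.inl ⟨h1, h2, this.2.1⟩⟩
  · intro h
    rw [covBy_iff_lt_and_eq_or_eq]
    constructor
    · rw [lt_iff_le_not_ge, con_le_iff, con_le_iff]
      rcases h with ⟨h1, h2, h3⟩ | ⟨h3, ⟨h1, h2, h4⟩ | ⟨h1, h2, h4⟩⟩
      · have := h3.lt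
        rw [h1, h2]
        exact ⟨⟨id, id, this.le⟩, fun h => by omega⟩
      · simp [h1, h2, h3, h4]
      · simp [h1, h2, h3, h4]
    · intro ξ hξ hξ'
      obtain ⟨m, rfl⟩ := con_surjective hn ξ
      have h5 := (con_le_iff hn l m).1 hξ
      have h6 := (con_le_iff hn m l').1 hξ'
      rcases h with ⟨h1, h2, h3⟩ | ⟨h3, ⟨h1, h2, h4⟩ | ⟨h1, h2, h4⟩⟩
      · have h7 : m.upper = l.upper := Bool.eq_iff_iff.2 ⟨fun h => h1 ▸ h6.1 h, h5.1⟩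
        have h8 : m.lower = l.lower := Bool.eq_iff_iff.2 ⟨fun h => h2 ▸ h6.2.1 h, h5.2.1⟩
        rcases h3.eq_or_eq (m.height_spec hn).1 h5.2.2 h6.2.2 with h | h
        · exact Or.inl (congrArg _ (key_injective h7 h8 h))
        · exact Or.inr (congrArg _ (key_injective (h7.trans h1) (h8.trans h2) h))
      · have h8 : m.lower = l.lower := Bool.eq_iff_iff.2 ⟨fun h => h4 ▸ h6.2.1 h, h5.2.1⟩
        have h9 : m.height = l.height := le_antisymm (h3 ▸ h6.2.2) h5.2.2
        rcases hm : m.upper with _ | _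
        · exact Or.inl (congrArg _ (key_injective (hm.trans h1.symm) h8 h9))
        · exact Or.inr (congrArg _ (key_injective (hm.trans h2.symm) (h8.trans h4) (h9.trans h3)))
      · have h8 : m.upper = l.upper := Bool.eq_iff_iff.2 ⟨fun h => h4 ▸ h6.1 h, h5.1⟩
        have h9 : m.height = l.height := le_antisymm (h3 ▸ h6.2.2) h5.2.2
        rcases hm : m.lower with _ | _
        · exact Or.inl (congrArg _ (key_injective h8 (hm.trans h1.symm) h9))
        · exact Or.inr (congrArg _ (key_injective (h8.trans h4) (hm.trans h2.symm) (h9.trans h3)))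

theorem con_star_covBy_iff (hn : 2 ≤ n) (l l' : CongLabel n) (h : IsStarCon (l.con hn))
    (h' : IsStarCon (l'.con hn)) :
    (⟨l.con hn, h⟩ : {c : Con (PB n) // IsStarCon c}) ⋖ ⟨l'.con hn, h'⟩ ↔ l.StarEdge l' := by
  have hs := (isStarCon_iff hn l).1 h
  have hs' := (isStarCon_iff hn l').1 h'
  rw [starEdge_iff hs hs']
  constructor
  · intro hc
    have hle := (con_le_iff hn l l').1 (Subtype.mk_le_mk.1 hc.le)
    have hne : l ≠ l' := fun e => by subst e; exact hc.lt.ne rfl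
    -- Only triples with equal flags compete here, so a single step may switch both flags at once.
    have key : ∀ (a : Bool) (k : ℕ), IsHeight k → k ≤ l'.height →
        (12 ≤ k → a = true) → (l.upper = true → a = true) →
        l.height ≤ k → (a = true → l'.upper = true) →
        (¬ (a = l.upper ∧ k = l.height)) → k = l'.height := by
      intro a k h1 h2 h3 h4 h6 h7 h9
      obtain ⟨m, hma, hmb, rfl⟩ := exists_of_height hn a a h1
        (h2.trans (l'.height_spec hn).2) (fun h => ⟨h3 h, h3 h⟩)
      have hm : IsStarCon (m.con hn) := (isStarCon_iff hn m).2 (hma.trans hmb.symm)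
      subst hma
      have e1 : (⟨l.con hn, h⟩ : {c : Con (PB n) // IsStarCon c}) ≤ ⟨m.con hn, hm⟩ :=
        (con_le_iff hn l m).2 ⟨h4, by rwa [← hs, hmb], h6⟩
      have e2 : (⟨m.con hn, hm⟩ : {c : Con (PB n) // IsStarCon c}) ≤ ⟨l'.con hn, h'⟩ :=
        (con_le_iff hn m l').2 ⟨h7, by rwa [← hs', hmb], h2⟩
      rcases hc.eq_or_eq e1 e2 with h10 | h10
      · rw [con_injective hn (congrArg Subtype.val h10)] at h9
        exact absurd ⟨rfl, rfl⟩ h9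
      · rw [con_injective hn (congrArg Subtype.val h10)]
    by_cases hu : l.upper = l'.upper
    · have hlt : l.height < l'.height := lt_of_le_of_ne hle.2.2 fun e =>
        hne (key_injective hu (by rw [← hs, ← hs', hu]) e)
      obtain ⟨k, hk1, hk2, hk3⟩ := exists_nextHeight (l.height_spec hn).1
        (l'.height_spec hn).1 hlt
      have := key l.upper k hk2 hk3
        (fun h12 => by rw [hu]; exact (l'.full_of_height (h12.trans hk3)).1) id hk1.lt.le hle.1
        (fun e => hk1.lt.ne' e.2)
      rw [← this]
      exact Or.inl ⟨hu, hk1⟩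
    · have h1 : l.upper = false := by
        by_contra h1
        rw [Bool.not_eq_false] at h1
        exact hu (h1.trans (hle.1 h1).symm)
      have h2 : l'.upper = true := by
        by_contra h2
        rw [Bool.not_eq_true] at h2
        exact hu (h1.trans h2.symm)
      have := key true l.height (l.height_spec hn).1 hle.2.2 (fun _ => rfl) (fun _ => rfl) le_rfl
        (fun _ => h2) (fun e => by rw [h1] at e; cases e.1)
      exact Or.inr ⟨this, h1, h2⟩
  · intro hc
    rw [covBy_iff_lt_and_eq_or_eq]
    constructor
    · rw [Subtype.mk_lt_mk, lt_iff_le_not_ge, con_le_iff, con_le_iff, ← hs, ← hs']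
      rcases hc with ⟨h1, h3⟩ | ⟨h3, h1, h2⟩
      · have := h3.lt
        rw [h1]
        exact ⟨⟨id, id, this.le⟩, fun h => by omega⟩
      · simp [h1, h2, h3]
    · rintro ⟨ξ, hstar⟩ hξ hξ'
      obtain ⟨m, rfl⟩ := con_surjective hn ξ
      have hm := (isStarCon_iff hn m).1 hstar
      have h5 := (con_le_iff hn l m).1 (Subtype.mk_le_mk.1 hξ)
      have h6 := (con_le_iff hn m l').1 (Subtype.mk_le_mk.1 hξ')
      have hleft : m.upper = l.upper → m.height = l.height → m = l := fun e1 e2 =>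
        key_injective e1 (by rw [← hm, ← hs, e1]) e2
      have hright : m.upper = l'.upper → m.height = l'.height → m = l' := fun e1 e2 =>
        key_injective e1 (by rw [← hm, ← hs', e1]) e2
      have main : m = l ∨ m = l' := by
        rcases hc with ⟨h1, h3⟩ | ⟨h3, h1, h2⟩
        · have h7 : m.upper = l.upper := Bool.eq_iff_iff.2 ⟨fun h => h1 ▸ h6.1 h, h5.1⟩
          rcases h3.eq_or_eq (m.height_spec hn).1 h5.2.2 h6.2.2 with h | h
          · exact Or.inl (hleft h7 h)
          · exact Or.inr (hright (h7.trans h1) h)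
        · have h9 : m.height = l.height := le_antisymm (h3 ▸ h6.2.2) h5.2.2
          rcases hu : m.upper with _ | _
          · exact Or.inl (hleft (hu.trans h1.symm) h9)
          · exact Or.inr (hright (hu.trans h2.symm) (h9.trans h3))
      rcases main with rfl | rfl
      · exact Or.inl rfl
      · exact Or.inr rfl

end CongLabel

end Covers

/-! ### Maximal subgroups and the classification of IN-pairs -/

section INPairs

variable {n : ℕ}

/-! ### Maximal subgroups -/

theorem stableJClass (e : PB n) : StableJClass e := fun _ _ _ =>
  ⟨fun h => greenR_iff_sameTop.2 (sameTop_mul_of_rk_eq (greenJ_iff_rk.1 h)),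
    fun h => greenL_iff_sameBot.2 (sameBot_mul_of_rk_eq (greenJ_iff_rk.1 h))⟩

theorem regularJClass (e : PB n) : RegularJClass e := fun x _ => ⟨pbFlip x, (mul_flip_mul x).symm⟩

theorem mem_hClass_idem_iff {q : ℕ} (hq : q ≤ n) {x : PB n} :
    x ∈ HClass (idem n q) ↔ ∃ σ : Perm (Fin q), x = bar n σ := by
  have hEE : idem n q * idem n q = idem n q := idem_mul_bar hq 1
  constructor
  · rintro ⟨h1, h2⟩
    rw [greenR_iff_sameTop] at h1
    rw [greenL_iff_sameBot] at h2
    refine exists_bar_eq hq (h1.rk_eq.trans (rk_bar hq 1)) ?_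
    have h3 := h1.symm.mul_eq
    have h4 := h2.symm.mul_eq
    rw [flip_idem, hEE] at h3 h4
    rw [h3, h4]
  · rintro ⟨σ, rfl⟩
    refine ⟨greenR_iff_sameTop.2 ?_, greenL_iff_sameBot.2 ?_⟩
    · have := sameTop_mul_of_rk_eq (α := idem n q) (β := bar n σ)
        (by rw [idem_mul_bar hq, rk_bar hq, rk_bar hq])
      rwa [idem_mul_bar hq] at this
    · have := sameBot_mul_of_rk_eq (α := bar n σ) (β := idem n q)
        (by rw [bar_mul_idem hq, rk_bar hq, rk_bar hq])
      rwa [bar_mul_idem hq] at this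

theorem isNormalSubgroupAt_barSet {q : ℕ} (hq : q ≤ n) {N : Subgroup (Perm (Fin q))}
    (hN : N.Normal) : IsNormalSubgroupAt (idem n q) (barSet n N) := by
  refine ⟨idem_mul_bar hq 1, ?_, ⟨1, one_mem N, rfl⟩, ?_, ?_, ?_⟩
  · rintro _ ⟨σ, -, rfl⟩
    exact (mem_hClass_idem_iff hq).2 ⟨σ, rfl⟩
  · rintro _ ⟨σ, hσ, rfl⟩ _ ⟨τ, hτ, rfl⟩
    exact ⟨τ * σ, mul_mem hτ hσ, bar_mul_bar hq σ τ⟩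
  · rintro _ ⟨σ, hσ, rfl⟩
    refine ⟨bar n σ⁻¹, ⟨σ⁻¹, inv_mem hσ, rfl⟩, ?_, ?_⟩
    · rw [bar_mul_bar hq, inv_mul_cancel]
    · rw [bar_mul_bar hq, mul_inv_cancel]
  · rintro g hg h hh hgh _ ⟨ρ, hρ, rfl⟩
    obtain ⟨σ, rfl⟩ := (mem_hClass_idem_iff hq).1 hg
    obtain ⟨τ, rfl⟩ := (mem_hClass_idem_iff hq).1 hh
    rw [bar_mul_bar hq] at hgh
    obtain rfl := eq_inv_of_mul_eq_one_right (bar_injective hq hgh)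
    refine ⟨τ * ρ * τ⁻¹, hN.conj_mem ρ hρ τ, ?_⟩
    rw [bar_mul_bar hq, bar_mul_bar hq, mul_assoc]

theorem isINPair_barSet {q : ℕ} (h1 : 1 ≤ q) (hq : q ≤ n) {N : Subgroup (Perm (Fin q))}
    (hN : N.Normal) : IsINPair (rankIdeal n (q - 1)) (barSet n N) := by
  refine ⟨isIdeal_rankIdeal n _, idem n q, isNormalSubgroupAt_barSet hq hN, stableJClass _,
    regularJClass _, ?_, fun y hy hle => ?_⟩
  · rw [mem_rankIdeal, rk_bar hq]
    omega
  · rw [mem_rankIdeal] at hy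
    rw [jLe_iff, rk_bar hq] at hle
    rw [greenJ_iff_rk, rk_bar hq]
    omega

theorem barSet_nontrivial {q : ℕ} (hq : q ≤ n) {N : Subgroup (Perm (Fin q))} :
    (barSet n N).Nontrivial ↔ N ≠ ⊥ := by
  constructor
  · rintro ⟨_, ⟨σ, hσ, rfl⟩, _, ⟨τ, hτ, rfl⟩, hne⟩ rfl
    rw [Subgroup.mem_bot.1 hσ, Subgroup.mem_bot.1 hτ] at hne
    exact hne rfl
  · intro h
    obtain ⟨σ, h1⟩ := N.ne_bot_iff_exists_ne_one.1 h
    exact ⟨bar n (σ : Perm (Fin q)), ⟨σ, σ.2, rfl⟩, idem n q, ⟨1, one_mem N, rfl⟩,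
      fun e => h1 (Subtype.ext (bar_injective hq e))⟩

/-! ### Identification of the maximal subgroups of a `J`-class -/

/-- The elements `x` and `y` give an isomorphism from the distinguished maximal subgroup of rank
`q` to the maximal subgroup at `e`. -/
structure IsChart (q : ℕ) (e x y : PB n) : Prop where
  mul_eq : x * y = e
  mul_eq' : y * x = idem n q
  left_mul : e * x = x
  mul_idem : x * idem n q = x
  idem_mul : idem n q * y = y
  mul_right : y * e = y

/-- With coordinates `a` of `e`, the chart consists of `a` and `pbFlip a * e`; the extra factor `e`
is there because `e` need not be a projection. At the distinguished idempotent the trivial chart is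
chosen, so that no identification takes place there. -/
theorem exists_isChart {q : ℕ} {e : PB n} (he : IsIdempotentElem e) (hr : rk e = q) :
    ∃ x y, IsChart q e x y ∧ (e = idem n q → x = e ∧ y = e) := by
  have he' : e * e = e := he
  by_cases h : e = idem n q
  · exact ⟨e, e, ⟨he', by rw [he', h], he', by rw [← h, he'], by rw [← h, he'], he'⟩,
      fun _ => ⟨rfl, rfl⟩⟩
  · obtain ⟨a, ha⟩ := exists_isCoord hr
    have h1 : e * a = a := by
      have h2 : e * pbFlip e * a = a := by
        rw [← ha.mul_flip_self, mul_flip_mul]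
      rw [← h2, ← mul_assoc, ← mul_assoc, he']
    exact ⟨a, pbFlip a * e, ⟨ha.mul_flip_mul, by rw [mul_assoc, h1, ha.flip_mul_self], h1,
      ha.mul_idem, by rw [← mul_assoc, ha.idem_mul_flip], by rw [mul_assoc, he']⟩,
      fun h' => absurd h' h⟩

namespace IsChart

variable {q : ℕ} {e x y : PB n}

theorem mul_bar_mul (h : IsChart q e x y) (hq : q ≤ n) (σ τ : Perm (Fin q)) :
    x * bar n σ * y * (x * bar n τ * y) = x * bar n (τ * σ) * y := by
  have : x * bar n σ * y * (x * bar n τ * y) = x * (bar n σ * (y * x)) * bar n τ * y := by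
    simp only [mul_assoc]
  rw [this, h.mul_eq', bar_mul_idem hq, mul_assoc x, bar_mul_bar hq]

theorem mul_one_mul (h : IsChart q e x y) : x * idem n q * y = e := by
  rw [h.mul_idem, h.mul_eq]

theorem conj_mul (h : IsChart q e x y) (hq : q ≤ n) (σ : Perm (Fin q)) :
    y * (x * bar n σ * y) * x = bar n σ := by
  have : y * (x * bar n σ * y) * x = (y * x) * bar n σ * (y * x) := by simp only [mul_assoc]
  rw [this, h.mul_eq', idem_mul_bar hq, bar_mul_idem hq]

theorem mem_hClass (h : IsChart q e x y) (hq : q ≤ n) (σ : Perm (Fin q)) :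
    x * bar n σ * y ∈ HClass e := by
  have h1 := h.mul_bar_mul hq σ σ⁻¹
  have h2 := h.mul_bar_mul hq σ⁻¹ σ
  rw [inv_mul_cancel] at h1
  rw [mul_inv_cancel] at h2
  rw [h.mul_one_mul] at h1 h2
  refine ⟨greenR_iff.2 ⟨⟨x * bar n σ * y, ?_⟩, ⟨_, h1.symm⟩⟩,
    greenL_iff.2 ⟨⟨x * bar n σ * y, ?_⟩, ⟨_, h2.symm⟩⟩⟩
  · rw [← mul_assoc, ← mul_assoc, h.left_mul]
  · rw [mul_assoc _ y e, h.mul_right]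

/-- Carried into the local monoid at the distinguished idempotent by the chart, `g` keeps its rank
`q`, so it becomes a permutation. -/
theorem exists_eq (h : IsChart q e x y) (hq : q ≤ n) (he : e * e = e) {g : PB n}
    (hg : g ∈ HClass e) : ∃ σ : Perm (Fin q), g = x * bar n σ * y := by
  obtain ⟨h1, h2⟩ := hg
  have hr : rk e = q := by
    apply le_antisymm
    · rw [← h.mul_one_mul]
      exact (rk_mul₃_le _ _ _).trans (rk_bar hq _).le
    · calc q = rk (y * e * x) := by rw [h.mul_right, h.mul_eq', rk_bar hq]
        _ ≤ rk e := rk_mul₃_le _ _ _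
  have hrg : rk g = q := (greenR_iff_sameTop.1 h1).rk_eq.trans hr
  obtain ⟨⟨s, hs⟩, -⟩ := greenR_iff.1 h1
  obtain ⟨⟨t, ht⟩, -⟩ := greenL_iff.1 h2
  have h3 : e * g = g := by rw [hs, ← mul_assoc, he]
  have h4 : g * e = g := by rw [ht, mul_assoc, he]
  have h5 : x * (y * g * x) * y = g := by
    have : x * (y * g * x) * y = x * y * g * (x * y) := by simp only [mul_assoc]
    rw [this, h.mul_eq, h3, h4]
  have h6 : idem n q * (y * g * x) * idem n q = y * g * x := by
    have : idem n q * (y * g * x) * idem n q = idem n q * y * g * (x * idem n q) := by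
      simp only [mul_assoc]
    rw [this, h.idem_mul, h.mul_idem]
  obtain ⟨σ, hσ⟩ := exists_bar_eq hq (le_antisymm ((rk_mul₃_le _ _ _).trans hrg.le)
    (by rw [← hrg]; conv_lhs => rw [← h5]
        exact rk_mul₃_le _ _ _)) h6
  exact ⟨σ, by rw [← hσ, h5]⟩

/-- The preimage of a normal subgroup of the maximal subgroup at `e`. -/
def subgroup (h : IsChart q e x y) (hq : q ≤ n) {N : Set (PB n)} (hN : IsNormalSubgroupAt e N) :
    Subgroup (Perm (Fin q)) where
  carrier := {σ | x * bar n σ * y ∈ N}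
  mul_mem' {σ τ} hσ hτ := by
    change x * bar n (σ * τ) * y ∈ N
    rw [← h.mul_bar_mul hq]
    exact hN.2.2.2.1 _ hτ _ hσ
  one_mem' := by
    change x * idem n q * y ∈ N
    rw [h.mul_one_mul]
    exact hN.2.2.1
  inv_mem' {σ} hσ := by
    change x * bar n σ⁻¹ * y ∈ N
    obtain ⟨z, hz, -, h2⟩ := hN.2.2.2.2.1 _ hσ
    obtain ⟨τ, rfl⟩ := h.exists_eq hq hN.1 (hN.2.1 hz)
    rw [h.mul_bar_mul hq, ← h.mul_one_mul] at h2
    have h3 := congrArg (fun z => y * z * x) h2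
    simp only [h.conj_mul hq] at h3
    rwa [← eq_inv_of_mul_eq_one_right (bar_injective hq h3)]

theorem mem_subgroup (h : IsChart q e x y) (hq : q ≤ n) {N : Set (PB n)}
    (hN : IsNormalSubgroupAt e N) {σ : Perm (Fin q)} :
    σ ∈ h.subgroup hq hN ↔ x * bar n σ * y ∈ N := Iff.rfl

theorem subgroup_normal (h : IsChart q e x y) (hq : q ≤ n) {N : Set (PB n)}
    (hN : IsNormalSubgroupAt e N) : (h.subgroup hq hN).Normal := by
  refine ⟨fun σ hσ τ => ?_⟩
  have h1 := h.mul_bar_mul hq τ⁻¹ τ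
  rw [mul_inv_cancel, h.mul_one_mul] at h1
  rw [mem_subgroup, ← h.mul_bar_mul hq, ← h.mul_bar_mul hq, ← mul_assoc]
  exact hN.2.2.2.2.2 _ (h.mem_hClass hq _) _ (h.mem_hClass hq _) h1 _ hσ

theorem mem_iff (h : IsChart q e x y) (hq : q ≤ n) {N : Set (PB n)}
    (hN : IsNormalSubgroupAt e N) {g : PB n} :
    g ∈ N ↔ ∃ σ ∈ h.subgroup hq hN, g = x * bar n σ * y := by
  constructor
  · intro hg
    obtain ⟨σ, rfl⟩ := h.exists_eq hq hN.1 (hN.2.1 hg)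
    exact ⟨σ, hg, rfl⟩
  · rintro ⟨σ, hσ, rfl⟩
    exact hσ

theorem corresponding (h : IsChart q e x y) (hq : q ≤ n) {N : Set (PB n)}
    (hN : IsNormalSubgroupAt e N) : Corresponding N (barSet n (h.subgroup hq hN)) := by
  have hinv : ∀ σ : Perm (Fin q), x * bar n σ * y ∈ HClass e := h.mem_hClass hq
  refine ⟨e, idem n q, y, x, hN, isNormalSubgroupAt_barSet hq (h.subgroup_normal hq hN), ?_, ?_,
    ?_, ?_⟩
  · intro g hg
    obtain ⟨σ, rfl⟩ := h.exists_eq hq hN.1 hg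
    rw [h.conj_mul hq]
    exact ⟨(mem_hClass_idem_iff hq).2 ⟨σ, rfl⟩, rfl⟩
  · intro g hg
    obtain ⟨σ, rfl⟩ := (mem_hClass_idem_iff hq).1 hg
    exact ⟨hinv σ, h.conj_mul hq σ⟩
  · intro g hg g' hg'
    obtain ⟨σ, rfl⟩ := h.exists_eq hq hN.1 hg
    obtain ⟨τ, rfl⟩ := h.exists_eq hq hN.1 hg'
    rw [h.mul_bar_mul hq, h.conj_mul hq, h.conj_mul hq, h.conj_mul hq, bar_mul_bar hq]
  · ext g
    constructor
    · rintro ⟨σ, hσ, rfl⟩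
      exact ⟨_, hσ, h.conj_mul hq σ⟩
    · rintro ⟨g, hg, rfl⟩
      obtain ⟨σ, hσ, rfl⟩ := (h.mem_iff hq hN).1 hg
      exact ⟨σ, hσ, h.conj_mul hq σ⟩

/-- The outer factors `s` and `t` in the definition of `nu` absorb the two elements of the chart. -/
theorem nu_eq (h : IsChart q e x y) (hq : q ≤ n) {N : Set (PB n)}
    (hN : IsNormalSubgroupAt e N) : nu N = nu (barSet n (h.subgroup hq hN)) := by
  have hrk : ∀ σ : Perm (Fin q), rk (x * bar n σ * y) = rk (bar n σ) := fun σ =>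
    le_antisymm (rk_mul₃_le _ _ _) (by
      conv_lhs => rw [← h.conj_mul hq σ]
      exact rk_mul₃_le _ _ _)
  funext u v
  apply propext
  constructor
  · rintro ⟨s, t, a, ha, b, hb, rfl, rfl, h3, h4⟩
    obtain ⟨σ, hσ, rfl⟩ := (h.mem_iff hq hN).1 ha
    obtain ⟨τ, hτ, rfl⟩ := (h.mem_iff hq hN).1 hb
    rw [greenJ_iff_rk, hrk] at h3 h4
    exact nu_barSet.2 ⟨s * x, y * t, σ, hσ, τ, hτ, by simp only [mul_assoc],
      by simp only [mul_assoc], h3, h4⟩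
  · intro huv
    obtain ⟨s, t, σ, hσ, τ, hτ, rfl, rfl, h3, h4⟩ := nu_barSet.1 huv
    have key : ∀ ρ : Perm (Fin q), s * y * (x * bar n ρ * y) * (x * t) = s * bar n ρ * t := by
      intro ρ
      conv_rhs => rw [← h.conj_mul hq ρ]
      simp only [mul_assoc]
    refine ⟨s * y, x * t, _, hσ, _, hτ, (key σ).symm, (key τ).symm, ?_, ?_⟩
    · rw [greenJ_iff_rk, hrk, h3]
    · rw [greenJ_iff_rk, hrk, h4]

end IsChart

/-! ### Classification of the IN-pairs -/

theorem IsINPair.exists_barSet {I N : Set (PB n)} (h : IsINPair I N) :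
    ∃ (q : ℕ) (N' : Subgroup (Perm (Fin q))), 1 ≤ q ∧ q ≤ n ∧ N'.Normal ∧
      I = rankIdeal n (q - 1) ∧ Corresponding N (barSet n N') ∧ nu N = nu (barSet n N') ∧
      (N ⊆ barSet n (⊤ : Subgroup (Perm (Fin q))) → N = barSet n N') := by
  obtain ⟨hI, e, hN, -, -, heI, hmin⟩ := h
  obtain ⟨p, -, rfl⟩ := (isIdeal_iff I).1 hI
  rw [mem_rankIdeal, not_le] at heI
  have hen := rk_le e
  have hp : p + 1 ≤ n := by omega
  -- Minimality of the `J`-class is tested on the idempotent whose rank is just above the ideal.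
  have hr : p + 1 = rk e := by
    have := hmin (idem n (p + 1)) (by rw [mem_rankIdeal, rk_bar hp]; omega)
      (by rw [jLe_iff, rk_bar hp]; omega)
    rwa [greenJ_iff_rk, rk_bar hp] at this
  obtain ⟨x, y, hc, hxy⟩ := exists_isChart hN.1 hr.symm
  refine ⟨p + 1, hc.subgroup hp hN, by omega, hp, hc.subgroup_normal hp hN, rfl,
    hc.corresponding hp hN, hc.nu_eq hp hN, fun hsub => ?_⟩
  -- The identity of `N` is now an idempotent permutation, hence the distinguished idempotent, and
  -- its chart is trivial.
  obtain ⟨σ, -, hσ⟩ := hsub hN.2.2.1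
  have h1 : e * e = e := hN.1
  rw [hσ, bar_mul_bar hp] at h1
  have h2 : σ = 1 := mul_eq_left.1 (bar_injective hp h1)
  have he : e = idem n (p + 1) := by rw [hσ, h2]
  obtain ⟨hx, hy⟩ := hxy he
  have h3 : ∀ σ : Perm (Fin (p + 1)), x * bar n σ * y = bar n σ := fun σ => by
    rw [hx, hy, he, idem_mul_bar hp, bar_mul_idem hp]
  ext g
  rw [hc.mem_iff hp hN]
  simp only [h3, barSet, Set.mem_ofPred_eq]

theorem Corresponding.nontrivial {S : Type*} [Monoid S] {N₁ N₂ : Set S}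
    (h : Corresponding N₁ N₂) (hN : N₁.Nontrivial) : N₂.Nontrivial := by
  obtain ⟨e₁, e₂, a, b, h1, -, h3, -, -, rfl⟩ := h
  refine hN.image_of_injOn fun g hg g' hg' hgg => ?_
  rw [← (h3 g (h1.2.1 hg)).2, ← (h3 g' (h1.2.1 hg')).2]
  exact congrArg (fun z => b * z * a) hgg

theorem IsProperINPair.exists_barSet {I N : Set (PB n)} (h : IsProperINPair I N) :
    ∃ (q : ℕ) (N' : Subgroup (Perm (Fin q))), 2 ≤ q ∧ q ≤ n ∧ N'.Normal ∧ N' ≠ ⊥ ∧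
      I = rankIdeal n (q - 1) ∧ Corresponding N (barSet n N') ∧ nu N = nu (barSet n N') ∧
      (N ⊆ barSet n (⊤ : Subgroup (Perm (Fin q))) → N = barSet n N') := by
  obtain ⟨q, N', h1, hq, hN', hI, hc, h3⟩ := h.1.exists_barSet
  have hne : N' ≠ ⊥ := (barSet_nontrivial hq).1 (hc.nontrivial h.2)
  refine ⟨q, N', ?_, hq, hN', hne, hI, hc, h3⟩
  by_contra h2
  obtain rfl : q = 1 := by omega
  exact hne (Subsingleton.elim _ _)

theorem isRetractableINPair_label (hn : 2 ≤ n) (c : RetractLabel) :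
    IsRetractableINPair (c.ideal n) (c.group n) := by
  have h1 := c.q_pos
  have h2 := c.q_le
  have hq : c.q ≤ n := h2.trans hn
  refine ⟨isINPair_barSet h1 hq c.normal, rankIdeal n 0, isMinimalIdeal_iff.2 rfl,
    ⟨_, isRetraction_of_le_one (by omega)⟩, ?_⟩
  rintro z hz _ ⟨σ, -, rfl⟩ _ ⟨τ, -, rfl⟩
  have hz0 : rk z = 0 := Nat.le_zero.1 hz
  constructor
  · rw [mul_bar_of_le_two h2 hq hz0, mul_bar_of_le_two h2 hq hz0 τ]
  · apply flip_injective
    have hz1 : rk (pbFlip z) = 0 := by rw [rk_flip, hz0]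
    rw [flip_mul, flip_mul, flip_bar, flip_bar, mul_bar_of_le_two h2 hq hz1,
      mul_bar_of_le_two h2 hq hz1 τ⁻¹]

/-- The ideals that contain elements of rank two are not retractable. -/
theorem le_one_of_isRetraction {p : ℕ} (hn : 2 ≤ n) {M : Set (PB n)} {f : PB n → PB n}
    (hf : IsRetraction (rankIdeal n p) M f) : p ≤ 1 := by
  by_contra hp
  let a : Fin n := ⟨0, by omega⟩
  let b : Fin n := ⟨1, by omega⟩
  have hx : idem n 2 ∈ rankIdeal n p := by
    rw [mem_rankIdeal, rk_bar hn]
    omega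
  have hI := isIdeal_rankIdeal n p
  -- The upper blocks of `f (idem n 2)` would be those of `idem n 2 * z` for every `z` of rank zero,
  -- but the choices with and without a hook on the first two vertices disagree.
  have h1 := hf.UU_iff hI hx (z := hook a b * om n) (rk_mul_right_zero rk_om _) a b
  have h2 := hf.UU_iff hI hx (z := om n) rk_om a b
  have h3 : UU (idem n 2 * (hook a b * om n)) a b :=
    UU_mul (UL_idem.2 ⟨rfl, by simp [a]⟩) (UU_mul_of_UU _ (UU_hook.2 (Or.inr (Or.inl ⟨rfl, rfl⟩))))
      (UL_idem.2 ⟨rfl, by simp [b]⟩)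
  have h4 := h2.2 (h1.1 h3)
  have hab : a ≠ b := by simp [a, b]
  rw [idem_mul_idem_of_ge (Nat.zero_le 2), UU_bar] at h4
  exact hab h4

theorem IsRetractableINPair.exists_label (hn : 2 ≤ n) {I N : Set (PB n)}
    (h : IsRetractableINPair I N) :
    ∃ c : RetractLabel, I = c.ideal n ∧ Corresponding N (c.group n) ∧ nu N = nu (c.group n) ∧
      (N ⊆ barSet n (⊤ : Subgroup (Perm (Fin c.q))) → N = c.group n) := by
  obtain ⟨hIN, M, -, ⟨f, hf⟩, -⟩ := h
  obtain ⟨q, N', h1, hq, hN', rfl, h3⟩ := hIN.exists_barSet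
  have h2 := le_one_of_isRetraction hn hf
  obtain rfl | rfl : q = 1 ∨ q = 2 := by omega
  · obtain rfl : N' = ⊥ := Subsingleton.elim _ _
    exact ⟨.zero, rfl, h3⟩
  · by_cases hb : N' = ⊥
    · subst hb
      exact ⟨.one, rfl, h3⟩
    -- In degree two the positions of the Klein and alternating groups are excluded, so a
    -- non-trivial normal subgroup is the full group.
    · obtain ⟨-, -, ht, h5, h6, h7, h8⟩ := code_iff le_rfl hN' hb
      obtain rfl := ht.2 (by omega)
      exact ⟨.symTwo, rfl, h3⟩

end INPairs

end PartialBrauer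

/-- The congruences and `*`-congruences of the partial Brauer monoid. -/
theorem theorem6p1 (n : ℕ) (hn : 2 ≤ n) :
    -- the ideals
    (∀ I : Set (PB n), IsIdeal I ↔ ∃ q ≤ n, I = rankIdeal n q) ∧
    -- the proper IN-pairs
    (∀ (q : ℕ) (N : Subgroup (Equiv.Perm (Fin q))), 2 ≤ q → q ≤ n → N.Normal → N ≠ ⊥ →
      IsProperINPair (rankIdeal n (q - 1)) (barSet n N)) ∧
    (∀ I N : Set (PB n), IsProperINPair I N →
      ∃ (q : ℕ) (N' : Subgroup (Equiv.Perm (Fin q))), 2 ≤ q ∧ q ≤ n ∧ N'.Normal ∧ N' ≠ ⊥ ∧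
        I = rankIdeal n (q - 1) ∧ Corresponding N (barSet n N') ∧ nu N = nu (barSet n N') ∧
        (N ⊆ barSet n (⊤ : Subgroup (Equiv.Perm (Fin q))) → N = barSet n N')) ∧
    -- the retractable IN-pairs
    (∀ c : RetractLabel, IsRetractableINPair (c.ideal n) (c.group n)) ∧
    (∀ I N : Set (PB n), IsRetractableINPair I N →
      ∃ c : RetractLabel, I = c.ideal n ∧ Corresponding N (c.group n) ∧
        nu N = nu (c.group n) ∧
        (N ⊆ barSet n (⊤ : Subgroup (Equiv.Perm (Fin c.q))) → N = c.group n)) ∧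
    -- the congruences: all the listed relations are congruences, they are distinct, and every
    -- congruence is listed
    ∃ e : CongLabel n ≃ Con (PB n),
      (∀ (l : CongLabel n) (α β : PB n), e l α β ↔ l.rel α β) ∧
      -- the `*`-congruences
      (∀ l : CongLabel n, IsStarCon (e l) ↔ ¬ l.IsLeftRight) ∧
      -- the Hasse diagram of the congruence lattice
      (∀ l l' : CongLabel n, e l ⋖ e l' ↔ l.Edge l') ∧
      -- the Hasse diagram of the lattice of `*`-congruences
      (∀ (l l' : CongLabel n) (h : IsStarCon (e l)) (h' : IsStarCon (e l')),
        (⟨e l, h⟩ : {c : Con (PB n) // IsStarCon c}) ⋖ ⟨e l', h'⟩ ↔ l.StarEdge l') := by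
  refine ⟨isIdeal_iff, fun q N h2 hq hN hb =>
    ⟨isINPair_barSet (by omega) hq hN, (barSet_nontrivial hq).2 hb⟩,
    fun I N h => h.exists_barSet, isRetractableINPair_label hn, fun I N h => h.exists_label hn,
    Equiv.ofBijective (CongLabel.con hn)
      ⟨CongLabel.con_injective hn, CongLabel.con_surjective hn⟩,
    CongLabel.con_iff_rel hn, fun l => ?_, CongLabel.con_covBy_iff hn,
    CongLabel.con_star_covBy_iff hn⟩
  rw [CongLabel.not_isLeftRight_iff]
  exact CongLabel.isStarCon_iff hn l
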